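/- **Theorem 8.2 (Teorema Penalizzazione), with its accompanying remark.** Let $n\ge 1$, let $\Omega\subset\mathbb R^n$ be a bounded connected open set, let $0<\alpha<\beta$, $0<\gamma\le 1$, $0<d<|\Omega|$ and $u_0\in H^1(\Omega)$. Let $A$ be a matrix-valued function on $\Omega$ such that, for some $0<\lambda\le\Lambda$, $\lambda|\xi|^2\le\langle A(x)\xi,\xi\rangle\le\Lambda|\xi|^2$ for all $x\in\Omega$, $\xi\in\mathbb R^n$, and $A$ is Hölder continuous on $\Omega$ with exponent $\gamma$, i.e. $\sup_{x\ne y\in\Omega}|A(x)-A(y)|/|x-y|^\gamma<\infty$. For a measurable set $E$ of finite perimeter, with Gauss–Green measure $\mu_E$ (the finite $\mathbb R^n$-valued measure with $\int_E\nabla\varphi\,dx=\int\varphi\,d\mu_E$ for all $\varphi\in C^1_c(\mathbb R^n)$), let $\partial^*E$ be the reduced boundary, i.e. the set of $x$ where the limit $\nu_E(x)=\lim_{r\to0^+}\mu_E(B_r(x))/|\mu_E|(B_r(x))$ exists and has norm $1$. For open $G\subset\Omega$ and $E\subset\Omega$ put $$\mathcal F_A(E,u;G)=\int_G\sigma_E|\nabla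 u|^2\,dx+\int_{G\cap\partial^*E}\langle A\nu_E,\nu_E\rangle^{1/2}\,d\mathcal H^{n-1},\qquad \sigma_E=\alpha\mathbb 1_E+\beta\mathbb 1_{\Omega\setminus E},$$ $$\mathcal F_\kappa(E,u)=\mathcal F_A(E,u;\Omega)+\kappa\,\big||E|-d\big|^\gamma .$$ Call $(E,u)$ admissible if $E\subset\Omega$ has finite perimeter and $u\in u_0+H^1_0(\Omega)$. A constrained minimizer is a minimizer of $\mathcal F_A(\cdot,\cdot;\Omega)$ among the admissible pairs with $|E|=d$; a penalized minimizer (for $\kappa$) is a minimizer of $\mathcal F_\kappa$ among all admissible pairs. Then there exists $\kappa_0>0$ such that: 1. for every $\kappa\ge\kappa_0$, every penalized minimizer $(E,u)$ for $\kappa$ satisfies $|E|=d$ and is a constrained minimizer; 2. every constrained minimizer is a penalized minimizer for every $\kappa\ge\kappa_0$; 3. if in addition $\frac{n-1}{n}<\gamma<1$, then, with $\mu:=\gamma n-n+1$, one has $0<\mu\le1$, $A$ is Hölder continuous on $\Omega$ with exponent $\mu$, and every constrained minimizer $(E,u)$ is, for every $\kappa\ge\kappa_0$ and every $U\Subset\Omega$,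 a $(\kappa,\mu)$-minimizer of $\mathcal F_A$ in $U$: for every ball $B_r(x_0)\subset U$, $$\mathcal F_A(E,u;B_r(x_0))\le\mathcal F_A(F,v;B_r(x_0))+\kappa|E\vartriangle F|^{\frac{n-1}{n}+\frac{\mu}{n}}$$ whenever $F$ is a set of finite perimeter with $F\vartriangle E\Subset B_r(x_0)$ and $v-u\in H^1_0(B_r(x_0))$. (These are the hypotheses of the regularity theorem for $(\kappa,\mu)$-minimizers.) -/

import Mathlib

open MeasureTheory Set Filter Topology
open scoped ENNReal NNReal ContDiff

noncomputable section

namespace FreeBoundary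

/-- Euclidean space `ℝⁿ` with its Euclidean norm. -/
abbrev Euc (n : ℕ) : Type := EuclideanSpace ℝ (Fin n)

/-! ### Sobolev spaces `H¹(G)` and `H¹₀(G)` -/

/-- `φ ∈ C_c^∞(G)`. -/
def IsTest {n : ℕ} (G : Set (Euc n)) (φ : Euc n → ℝ) : Prop :=
  ContDiff ℝ ∞ φ ∧ HasCompactSupport φ ∧ tsupport φ ⊆ G

/-- `g` is a square integrable weak gradient of `u` on `G`. -/
def IsWeakGradient {n : ℕ} (G : Set (Euc n)) (u : Euc n → ℝ) (g : Euc n → Euc n) : Prop :=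
  MemLp g 2 (volume.restrict G) ∧
    ∀ φ : Euc n → ℝ, IsTest G φ →
      ∫ x in G, u x • gradient φ x = - ∫ x in G, φ x • g x

/-- `u ∈ H¹(G)` (only the values of `u` on `G` matter). -/
def MemH1 {n : ℕ} (G : Set (Euc n)) (u : Euc n → ℝ) : Prop :=
  MemLp u 2 (volume.restrict G) ∧ ∃ g, IsWeakGradient G u g

open Classical in
/-- The weak gradient `∇u` of `u` on `G`, unique up to null sets for `u ∈ H¹(G)`. -/
def weakGradient {n : ℕ} (G : Set (Euc n)) (u : Euc n → ℝ) : Euc n → Euc n :=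
  if h : ∃ g, IsWeakGradient G u g then Classical.choose h else 0

/-- `u ∈ H¹₀(G)`, the closure of `C_c^∞(G)` in `H¹(G)`. -/
def MemH10 {n : ℕ} (G : Set (Euc n)) (u : Euc n → ℝ) : Prop :=
  MemH1 G u ∧ ∀ ε : ℝ≥0∞, 0 < ε → ∃ φ : Euc n → ℝ, IsTest G φ ∧
    eLpNorm (fun x => u x - φ x) 2 (volume.restrict G) < ε ∧
    eLpNorm (fun x => weakGradient G u x - gradient φ x) 2 (volume.restrict G) < ε

/-! ### Sets of finite perimeter, reduced boundary, anisotropic perimeter -/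

/-- `m` is the Gauss-Green measure of `E`, of finite total variation on `ℝⁿ`. -/
def IsGaussGreen {n : ℕ} (E : Set (Euc n)) (m : VectorMeasure (Euc n) (Euc n)) : Prop :=
  IsFiniteMeasure m.variation ∧
    ∀ φ : Euc n → ℝ, ContDiff ℝ 1 φ → HasCompactSupport φ →
      ∫ x in E, gradient φ x = ∫ᵛ x, φ x ∂•m

/-- `E` is Lebesgue measurable and has finite perimeter: `|μ_E|(ℝⁿ) < ∞`. -/
def HasFinitePerimeter {n : ℕ} (E : Set (Euc n)) : Prop :=
  NullMeasurableSet E volume ∧ ∃ m, IsGaussGreen E m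

open Classical in
/-- The (unique) Gauss-Green measure `μ_E` of a set of finite perimeter. -/
def gaussGreen {n : ℕ} (E : Set (Euc n)) : VectorMeasure (Euc n) (Euc n) :=
  if h : ∃ m, IsGaussGreen E m then Classical.choose h else 0

/-- The quotient `μ_E(B_r(x)) / |μ_E|(B_r(x))`; it is `0` where the denominator vanishes, so
that points off the support of `μ_E` do not belong to the reduced boundary below. -/
def normalRatio {n : ℕ} (E : Set (Euc n)) (x : Euc n) (r : ℝ) : Euc n :=
  ((gaussGreen E).variation (Metric.ball x r)).toReal⁻¹ • gaussGreen E (Metric.ball x r)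

/-- The reduced boundary `∂*E`. -/
def reducedBoundary {n : ℕ} (E : Set (Euc n)) : Set (Euc n) :=
  {x | ∃ ν : Euc n, ‖ν‖ = 1 ∧ Tendsto (normalRatio E x) (𝓝[>] 0) (𝓝 ν)}

/-- The measure-theoretic outer unit normal `ν_E`, meaningful on `∂*E`. -/
def outerNormal {n : ℕ} (E : Set (Euc n)) (x : Euc n) : Euc n :=
  limUnder (𝓝[>] (0 : ℝ)) (normalRatio E x)

/-- The Hausdorff measure `𝓗^{n-1}` on `ℝⁿ` (`n ≥ 1`) with the usual normalization: the constant
is `ω_{n-1} / 2^{n-1}`, as Mathlib's `μH[s]` sums the numbers `(diam)^s`. -/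
def surfaceMeasure (n : ℕ) : Measure (Euc n) :=
  ((volume (Metric.ball (0 : Euc (n - 1)) 1)) / 2 ^ (n - 1)) • Measure.hausdorffMeasure ((n : ℝ) - 1)

/-- `⟨M ξ, ξ⟩`. -/
def quadForm {n : ℕ} (M : Matrix (Fin n) (Fin n) ℝ) (ξ : Euc n) : ℝ :=
  inner ℝ (Matrix.toEuclideanCLM (𝕜 := ℝ) M ξ) ξ

/-- `Φ_A(E; G) = ∫_{G ∩ ∂*E} ⟨A ν_E, ν_E⟩^{1/2} d𝓗^{n-1}`. -/
def anisoPerimeter {n : ℕ} (A : Euc n → Matrix (Fin n) (Fin n) ℝ) (E G : Set (Euc n)) : ℝ≥0∞ :=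
  ∫⁻ x in G ∩ reducedBoundary E,
    ENNReal.ofReal (Real.sqrt (quadForm (A x) (outerNormal E x))) ∂(surfaceMeasure n)

/-- `λ|ξ|² ≤ ⟨A(x)ξ, ξ⟩ ≤ Λ|ξ|²` for all `x ∈ Ω` and `ξ ∈ ℝⁿ`. -/
def UniformlyElliptic {n : ℕ} (Ω : Set (Euc n)) (A : Euc n → Matrix (Fin n) (Fin n) ℝ)
    (lam Lam : ℝ) : Prop :=
  ∀ x ∈ Ω, ∀ ξ : Euc n, lam * ‖ξ‖ ^ 2 ≤ quadForm (A x) ξ ∧ quadForm (A x) ξ ≤ Lam * ‖ξ‖ ^ 2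

/-- `[A]_{C^γ(Ω)} < ∞`, with the operator norm on matrices. -/
def HolderMatrix {n : ℕ} (Ω : Set (Euc n)) (A : Euc n → Matrix (Fin n) (Fin n) ℝ)
    (γ : ℝ) : Prop :=
  ∃ C : ℝ, ∀ x ∈ Ω, ∀ y ∈ Ω,
    ‖Matrix.toEuclideanCLM (𝕜 := ℝ) (A x - A y)‖ ≤ C * ‖x - y‖ ^ γ

/-! ### The functionals and their minimizers -/

/-- `σ_E = α 1_E + β 1_{Ω ∖ E}`. -/
def sigma {n : ℕ} (α β : ℝ) (Ω E : Set (Euc n)) (x : Euc n) : ℝ :=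
  E.indicator (fun _ => α) x + (Ω \ E).indicator (fun _ => β) x

/-- `F_A(E, u; G) = ∫_G σ_E |∇u|² dx + Φ_A(E; G)` for open `G ⊆ Ω`, with values in `[0, ∞]`. -/
def energy {n : ℕ} (α β : ℝ) (A : Euc n → Matrix (Fin n) (Fin n) ℝ) (Ω E : Set (Euc n))
    (u : Euc n → ℝ) (G : Set (Euc n)) : ℝ≥0∞ :=
  (∫⁻ x in G, ENNReal.ofReal (sigma α β Ω E x * ‖weakGradient G u x‖ ^ 2)) +
    anisoPerimeter A E G

/-- `F_κ(E, u; Ω) = F_A(E, u; Ω) + κ ||E| - d|^γ`. -/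
def penalizedEnergy {n : ℕ} (α β : ℝ) (A : Euc n → Matrix (Fin n) (Fin n) ℝ) (Ω : Set (Euc n))
    (d γ κ : ℝ) (E : Set (Euc n)) (u : Euc n → ℝ) : ℝ≥0∞ :=
  energy α β A Ω E u Ω + ENNReal.ofReal (κ * |(volume E).toReal - d| ^ γ)

/-- Competitors: `E ⊆ Ω` of finite perimeter and `u ∈ u₀ + H¹₀(Ω)`. -/
def Admissible {n : ℕ} (Ω : Set (Euc n)) (u₀ : Euc n → ℝ) (E : Set (Euc n))
    (u : Euc n → ℝ) : Prop :=
  E ⊆ Ω ∧ HasFinitePerimeter E ∧ MemH10 Ω (fun x => u x - u₀ x)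

/-- `(E, u)` minimizes `F_A(·, ·; Ω)` among admissible pairs satisfying `|E| = d`. -/
def IsConstrainedMinimizer {n : ℕ} (α β : ℝ) (A : Euc n → Matrix (Fin n) (Fin n) ℝ)
    (Ω : Set (Euc n)) (u₀ : Euc n → ℝ) (d : ℝ) (E : Set (Euc n)) (u : Euc n → ℝ) : Prop :=
  Admissible Ω u₀ E u ∧ volume E = ENNReal.ofReal d ∧
    ∀ (F : Set (Euc n)) (v : Euc n → ℝ), Admissible Ω u₀ F v → volume F = ENNReal.ofReal d →
      energy α β A Ω E u Ω ≤ energy α β A Ω F v Ω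

/-- `(E, u)` minimizes `F_κ` among all admissible pairs. -/
def IsPenalizedMinimizer {n : ℕ} (α β : ℝ) (A : Euc n → Matrix (Fin n) (Fin n) ℝ)
    (Ω : Set (Euc n)) (u₀ : Euc n → ℝ) (d γ κ : ℝ) (E : Set (Euc n)) (u : Euc n → ℝ) : Prop :=
  Admissible Ω u₀ E u ∧
    ∀ (F : Set (Euc n)) (v : Euc n → ℝ), Admissible Ω u₀ F v →
      penalizedEnergy α β A Ω d γ κ E u ≤ penalizedEnergy α β A Ω d γ κ F v

/-- `S ⋐ G`. -/
def CompactlyContained {n : ℕ} (S G : Set (Euc n)) : Prop :=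
  IsCompact (closure S) ∧ closure S ⊆ G

/-- `(E, u)`, with `E ⊆ Ω` of finite perimeter and `u ∈ H¹(Ω)`, is a `(κ, μ)`-minimizer of `F_A`
in `U`. -/
def IsAlmostMinimizer {n : ℕ} (α β : ℝ) (A : Euc n → Matrix (Fin n) (Fin n) ℝ)
    (Ω : Set (Euc n)) (κ μ : ℝ) (U E : Set (Euc n)) (u : Euc n → ℝ) : Prop :=
  E ⊆ Ω ∧ HasFinitePerimeter E ∧ MemH1 Ω u ∧
    ∀ (x₀ : Euc n) (r : ℝ), 0 < r → Metric.ball x₀ r ⊆ U →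
      ∀ (F : Set (Euc n)) (v : Euc n → ℝ), HasFinitePerimeter F →
        CompactlyContained (symmDiff F E) (Metric.ball x₀ r) →
        MemH10 (Metric.ball x₀ r) (fun x => v x - u x) →
        energy α β A Ω E u (Metric.ball x₀ r) ≤
          energy α β A Ω F v (Metric.ball x₀ r) +
            ENNReal.ofReal (κ * (volume (symmDiff E F)).toReal ^
              (((n : ℝ) - 1) / n + μ / n))

end FreeBoundary

end

open MeasureTheory Set Filter Topology
open scoped ENNReal NNReal ContDiff

namespace FreeBoundary

variable {n : ℕ}

/-! ### Gradients of scalar functions -/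

section Gradient

/-! Everything reduces to one estimate, `exists_volume_correction`. There is a constant `C` such
that every admissible pair `(E, u)` can be replaced by an admissible pair `(F, v)` with `|F| = d`,
of finite energy, whose energy exceeds that of `(E, u)` by at most `C ||E| - d|^γ`. Take `κ₀ = C +
1`. Comparing a penalized minimizer with its own correction gives `κ t ≤ C t` for `t = ||E| - d|^γ`,
so `t = 0`. A constrained minimizer has at most the energy of the correction of any competitor,
hence at most the penalized energy of that competitor. Almost minimality follows by gluing a local
competitor to `(E, u)` outside the ball and cancelling the finite energy there: the volume defect is
at most `|E △ F|`, and `(n-1)/n + μ/n = γ`.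

To correct the volume, let `J` be the energy of one fixed pair `(E₀, u₀)` with `E₀` a finite union
of cubes of total volume `d`. If `J` is within the allowed bound, use that pair. Otherwise `E` has
energy below `J`, hence bounded perimeter in `Ω`, and `|E|` is close to `d`. Now deform by a shear
`x ↦ x + t φ(x) e` with `φ` a test function in `Ω`. This is a rank-one perturbation of the identity,
so the volume of the image is exactly affine in `t`, with slope `∫_E ∂_e φ`, and `t = (d - |E|) /
slope` restores the volume. The bulk energy grows by a factor at most `1 + 8|t|`, the surface energy
by at most `1 + C|t|^γ` because `A` is `γ`-Hölder. Boundary values survive because the shear is the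
identity off a compact subset of `Ω`.

The slope must be bounded below uniformly (`exists_nondegenerate`). Suppose it is not, along a
sequence of sets. The indicator, mollified at a fixed scale, then has gradient tending to zero
locally, while its `L¹` distance to the indicator is at most the scale times the perimeter. So in
each small ball either the set or its complement disappears in the limit. Connectedness of `Ω` makes
this alternative global, which contradicts `0 < d < |Ω|`.

The surface term needs two facts about integrals over `∂*E`, obtained from density estimates,
without De Giorgi's rectifiability theorem. First, the perimeter is controlled by `𝓗^{n-1}` on
`∂*E`: `|μ_E|` is concentrated on `∂*E`, where its balls have mass at most `C r^{n-1}`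
(`IsPolar.measure_le_hausdorffMeasure`). Second, shears carry reduced boundaries to reduced
boundaries, with the normal transformed by the cofactor matrix. Shears do not map balls to balls, so
this uses doubling of `|μ_E|` at points of `∂*E`, hence the lower density bound
`IsPolar.pow_le_measure_ball`. All isoperimetric input comes from a single inequality: the `L¹` norm
of `1_E(· + h) - 1_E` on a ball is at most `|h|` times the perimeter in a larger ball
(`IsPolar.lintegral_translate_le`). -/

lemma inner_gradient_eq_fderiv (φ : Euc n → ℝ) (x v : Euc n) :
    inner ℝ (gradient φ x) v = fderiv ℝ φ x v := by
  rw [inner_gradient_left]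

lemma norm_gradient (φ : Euc n → ℝ) (x : Euc n) : ‖gradient φ x‖ = ‖fderiv ℝ φ x‖ := by
  simp [gradient]

lemma gradient_mul {φ ψ : Euc n → ℝ} {x : Euc n} (hφ : DifferentiableAt ℝ φ x)
    (hψ : DifferentiableAt ℝ ψ x) :
    gradient (fun y => φ y * ψ y) x = φ x • gradient ψ x + ψ x • gradient φ x := by
  simp [gradient, fderiv_fun_mul hφ hψ]

lemma gradient_fun_add {φ ψ : Euc n → ℝ} {x : Euc n} (hφ : DifferentiableAt ℝ φ x)
    (hψ : DifferentiableAt ℝ ψ x) :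
    gradient (fun y => φ y + ψ y) x = gradient φ x + gradient ψ x := by
  simp [gradient, fderiv_fun_add hφ hψ]

lemma gradient_const_mul {φ : Euc n → ℝ} {x : Euc n} (c : ℝ) :
    gradient (fun y => c * φ y) x = c • gradient φ x := by
  simp only [gradient]
  rw [show (fun y => c * φ y) = c • φ from rfl, fderiv_const_smul_field, Pi.smul_apply, map_smulₛₗ]
  simp

lemma ContDiff.continuous_gradient {φ : Euc n → ℝ} (h : ContDiff ℝ 1 φ) :
    Continuous (gradient φ) :=
  (InnerProductSpace.toDual ℝ (Euc n)).symm.continuous.comp (h.continuous_fderiv one_ne_zero)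

lemma tsupport_gradient_subset (φ : Euc n → ℝ) : tsupport (gradient φ) ⊆ tsupport φ := by
  refine (closure_mono fun x hx => ?_).trans (tsupport_fderiv_subset ℝ (f := φ))
  simp only [Function.mem_support] at hx ⊢
  intro h
  exact hx (by simp [gradient, h])

lemma gradient_eq_zero_of_notMem {φ : Euc n → ℝ} {x : Euc n} (hx : x ∉ tsupport φ) :
    gradient φ x = 0 := by
  by_contra h
  exact hx (tsupport_gradient_subset φ (subset_tsupport _ h))

lemma HasCompactSupport.gradient {φ : Euc n → ℝ} (h : HasCompactSupport φ) :
    HasCompactSupport (gradient φ) :=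
  IsCompact.of_isClosed_subset h (isClosed_tsupport _) (tsupport_gradient_subset φ)

lemma integrable_gradient {φ : Euc n → ℝ} (h : ContDiff ℝ 1 φ) (hc : HasCompactSupport φ)
    (μ : Measure (Euc n)) [IsFiniteMeasureOnCompacts μ] : Integrable (gradient φ) μ :=
  (ContDiff.continuous_gradient h).integrable_of_hasCompactSupport (HasCompactSupport.gradient hc)

lemma gradient_bounded {φ : Euc n → ℝ} (h : ContDiff ℝ 1 φ) (hc : HasCompactSupport φ) :
    ∃ C, ∀ x, ‖gradient φ x‖ ≤ C :=
  (HasCompactSupport.gradient hc).exists_bound_of_continuous (ContDiff.continuous_gradient h)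

end Gradient

/-! ### Polar form of the Gauss-Green measure -/

/-- `μ` is the total variation and `f` the unit density of a Gauss-Green measure of `E`. -/
structure IsPolar (E : Set (Euc n)) (μ : Measure (Euc n)) (f : Euc n → Euc n) : Prop where
  finite : IsFiniteMeasure μ
  measurable : Measurable f
  norm_eq_one : ∀ᵐ x ∂μ, ‖f x‖ = 1
  integral_gradient : ∀ φ : Euc n → ℝ, ContDiff ℝ 1 φ → HasCompactSupport φ →
    ∫ x in E, gradient φ x = ∫ x, φ x • f x ∂μ

lemma integrable_of_norm_eq_one {X : Type*} [MeasurableSpace X] {μ : Measure X} [IsFiniteMeasure μ]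
    {f : X → Euc n} (hf : Measurable f) (h1 : ∀ᵐ x ∂μ, ‖f x‖ = 1) : Integrable f μ :=
  Integrable.of_bound hf.aestronglyMeasurable 1 (h1.mono fun _ h => h.le)

lemma variation_withDensity_of_norm_eq_one {X : Type*} [MeasurableSpace X] {μ : Measure X}
    [IsFiniteMeasure μ] {f : X → Euc n} (hf : Measurable f) (h1 : ∀ᵐ x ∂μ, ‖f x‖ = 1) :
    (μ.withDensityᵥ f).variation = μ := by
  rw [Measure.variation_withDensityᵥ (integrable_of_norm_eq_one hf h1)]
  conv_rhs => rw [← withDensity_one (μ := μ)]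
  refine withDensity_congr_ae (h1.mono fun x hx => ?_)
  simp [← ofReal_norm, hx]

/-- Translates integrals against a vector measure into Bochner integrals. Both sides are additive
and `L¹`-continuous in the integrand, so indicators of measurable sets suffice. -/
lemma integral_withDensityVec {X : Type*} [MeasurableSpace X] {μ : Measure X}
    [IsFiniteMeasure μ] {f : X → Euc n} (hf : Measurable f) (h1 : ∀ᵐ x ∂μ, ‖f x‖ = 1)
    {φ : X → ℝ} (hφ : Integrable φ μ) :
    ∫ᵛ x, φ x ∂•(μ.withDensityᵥ f) = ∫ x, φ x • f x ∂μ := by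
  have hv := variation_withDensity_of_norm_eq_one hf h1
  have hfi := integrable_of_norm_eq_one hf h1
  have hsm : ∀ g : X → ℝ, Integrable g μ → Integrable (fun x => g x • f x) μ := fun g hg => by
    refine hg.mono (hg.aestronglyMeasurable.smul hf.aestronglyMeasurable) ?_
    filter_upwards [h1] with x hx
    simp [norm_smul, hx]
  have hI : ∀ g : X → ℝ, Integrable g μ → (μ.withDensityᵥ f).Integrable g := fun g hg => by
    rw [VectorMeasure.Integrable, hv]; exact hg
  refine Integrable.induction (μ := μ)
    (P := fun g => ∫ᵛ x, g x ∂•(μ.withDensityᵥ f) = ∫ x, g x • f x ∂μ) ?_ ?_ ?_ ?_ hφ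
  · intro c s hs _
    have : IsFiniteMeasure ((μ.withDensityᵥ f).variation.restrict s) := by rw [hv]; infer_instance
    rw [VectorMeasure.integral_indicator_const _ hs, withDensityᵥ_apply hfi hs]
    simp only [ContinuousLinearMap.lsmul_apply]
    rw [← integral_smul, ← integral_indicator hs]
    congr 1 with x
    by_cases hx : x ∈ s <;> simp [hx]
  · intro g k _ hg hk hg' hk'
    simp only [Pi.add_apply]
    rw [VectorMeasure.integral_fun_add (hI g hg) (hI k hk), hg', hk', ← integral_add (hsm g hg) (hsm k hk)]
    simp [add_smul]
  · have c1 : Continuous fun g : Lp ℝ 1 μ => ∫ᵛ x, g x ∂•(μ.withDensityᵥ f) := by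
      have := VectorMeasure.continuous_integral (μ := μ.withDensityᵥ f)
        (B := ContinuousLinearMap.lsmul ℝ ℝ) (E := ℝ)
      rw [hv] at this
      exact this
    have c2 : Continuous fun g : Lp ℝ 1 μ => ∫ x, g x • f x ∂μ := by
      refine (LipschitzWith.of_dist_le_mul (K := 1) fun g k => ?_).continuous
      have hg := L1.integrable_coeFn g
      have hk := L1.integrable_coeFn k
      rw [dist_eq_norm, dist_eq_norm, ← integral_sub (hsm _ hg) (hsm _ hk), L1.norm_eq_integral_norm]
      refine (norm_integral_le_integral_norm _).trans ?_
      simp only [NNReal.coe_one, one_mul]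
      refine integral_mono_ae ((hsm _ hg).sub (hsm _ hk)).norm (L1.integrable_coeFn _).norm ?_
      filter_upwards [h1, Lp.coeFn_sub g k] with x hx hx2
      rw [hx2]
      simp [← sub_smul, norm_smul, hx]
    exact isClosed_eq c1 c2
  · intro g k hgk hg hk
    have hgk' : g =ᵐ[(μ.withDensityᵥ f).variation] k := by rwa [hv]
    refine (VectorMeasure.integral_congr_ae hgk').symm.trans (hk.trans ?_)
    exact integral_congr_ae (hgk.mono fun x hx => by simp [hx])

/-- Radon–Nikodym coordinate by coordinate with respect to the variation. The norm of the density is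
then forced to be one, since `‖f‖` times the variation is again the variation. -/
lemma exists_polar_density {X : Type*} [MeasurableSpace X] (m : VectorMeasure X (Euc n))
    [IsFiniteMeasure m.variation] :
    ∃ f : X → Euc n, Measurable f ∧ (∀ᵐ x ∂m.variation, ‖f x‖ = 1) ∧
      m.variation.withDensityᵥ f = m := by
  let s : Fin n → SignedMeasure X := fun i =>
    m.mapRange (EuclideanSpace.proj (𝕜 := ℝ) i).toAddMonoidHom
      (EuclideanSpace.proj (𝕜 := ℝ) i).continuous
  have hs : ∀ i A, s i A = m A i := fun i A => rfl
  have hac : ∀ i, s i ≪ᵥ m.variation.toENNRealVectorMeasure := by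
    intro i
    refine VectorMeasure.AbsolutelyContinuous.mk fun A hA h => ?_
    rw [Measure.toENNRealVectorMeasure_apply_measurable hA] at h
    have h2 := m.enorm_measure_le_variation A
    rw [h] at h2
    have : m A = 0 := by simpa using h2
    rw [hs, this]; rfl
  let f : X → Euc n := fun x => WithLp.toLp 2 fun i => (s i).rnDeriv m.variation x
  have hfm : Measurable f := by
    refine (WithLp.measurable_toLp 2 _).comp (measurable_pi_lambda _ fun i => ?_)
    exact SignedMeasure.measurable_rnDeriv _ _
  have hfi : Integrable f m.variation := by
    refine Integrable.of_eval_piLp fun i => ?_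
    exact SignedMeasure.integrable_rnDeriv _ _
  have heq : m.variation.withDensityᵥ f = m := by
    ext A hA i
    rw [withDensityᵥ_apply hfi hA]
    rw [eval_integral_piLp (fun j => (SignedMeasure.integrable_rnDeriv _ _).restrict)]
    rw [← withDensityᵥ_apply (SignedMeasure.integrable_rnDeriv _ _) hA,
      SignedMeasure.withDensityᵥ_rnDeriv_eq _ _ (hac i), hs]
  have hv := Measure.variation_withDensityᵥ hfi
  rw [heq] at hv
  have h1 : (fun x => ‖f x‖ₑ) =ᵐ[m.variation] 1 := by
    refine (withDensity_eq_iff_of_sigmaFinite hfm.enorm.aemeasurable aemeasurable_one).1 ?_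
    rw [← hv]; exact withDensity_one.symm
  refine ⟨f, hfm, h1.mono fun x hx => ?_, heq⟩
  have hx' : ‖f x‖ₑ = 1 := hx
  rw [← toReal_enorm, hx']; simp

lemma IsPolar.smul_integrable {E : Set (Euc n)} {μ : Measure (Euc n)} {f : Euc n → Euc n}
    (h : IsPolar E μ f) {φ : Euc n → ℝ} (hφ : Integrable φ μ) :
    Integrable (fun x => φ x • f x) μ := by
  refine hφ.mono (hφ.aestronglyMeasurable.smul h.measurable.aestronglyMeasurable) ?_
  filter_upwards [h.norm_eq_one] with x hx
  simp [norm_smul, hx]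

lemma IsPolar.isGaussGreen {E : Set (Euc n)} {μ : Measure (Euc n)} {f : Euc n → Euc n}
    (h : IsPolar E μ f) : IsGaussGreen E (μ.withDensityᵥ f) := by
  have := h.finite
  have hv := variation_withDensity_of_norm_eq_one h.measurable h.norm_eq_one
  refine ⟨by rw [hv]; infer_instance, fun φ hφ hc => ?_⟩
  rw [h.integral_gradient φ hφ hc, integral_withDensityVec h.measurable h.norm_eq_one]
  exact hφ.continuous.integrable_of_hasCompactSupport hc

lemma IsGaussGreen.exists_polar {E : Set (Euc n)} {m : VectorMeasure (Euc n) (Euc n)}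
    (h : IsGaussGreen E m) : ∃ f, IsPolar E m.variation f ∧ m.variation.withDensityᵥ f = m := by
  have := h.1
  obtain ⟨f, hf, h1, he⟩ := exists_polar_density m
  refine ⟨f, ⟨h.1, hf, h1, fun φ hφ hc => ?_⟩, he⟩
  rw [h.2 φ hφ hc]
  conv_lhs => rw [← he]
  exact integral_withDensityVec hf h1 (hφ.continuous.integrable_of_hasCompactSupport hc)

/-- Two finite vector measures in polar form are equal on measurable sets where their integrals
against smooth functions with compact support in an open set agree. -/
lemma setIntegral_eq_of_integral_test_eq {μ μ' : Measure (Euc n)} [IsFiniteMeasure μ]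
    [IsFiniteMeasure μ'] {f f' : Euc n → Euc n}
    (hi : Integrable f μ) (hi' : Integrable f' μ') {U : Set (Euc n)} (hU : IsOpen U)
    (h : ∀ φ : Euc n → ℝ, ContDiff ℝ ∞ φ → HasCompactSupport φ → tsupport φ ⊆ U →
      ∫ x, φ x • f x ∂μ = ∫ x, φ x • f' x ∂μ') {s : Set (Euc n)} (hs : MeasurableSet s)
    (hsU : s ⊆ U) : ∫ x in s, f x ∂μ = ∫ x in s, f' x ∂μ' := by
  -- Both measures get densities with respect to the common measure `μ + μ'`, so that the
  -- fundamental lemma of the calculus of variations applies to one function.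
  obtain ⟨ρ, hρ⟩ : ∃ ρ, ρ = μ + μ' := ⟨_, rfl⟩
  have : IsFiniteMeasure ρ := by rw [hρ]; infer_instance
  have := Measure.haveLebesgueDecomposition_of_sigmaFinite μ ρ
  have := Measure.haveLebesgueDecomposition_of_sigmaFinite μ' ρ
  let a : Euc n → ℝ := fun x => (μ.rnDeriv ρ x).toReal
  let b : Euc n → ℝ := fun x => (μ'.rnDeriv ρ x).toReal
  have ha : μ ≪ ρ := Measure.absolutelyContinuous_of_le
    (hρ ▸ Measure.le_add_right le_rfl)
  have hb : μ' ≪ ρ := Measure.absolutelyContinuous_of_le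
    (hρ ▸ Measure.le_add_left le_rfl)
  have hai : Integrable (fun x => a x • f x) ρ := (integrable_rnDeriv_smul_iff ha).2 hi
  have hbi : Integrable (fun x => b x • f' x) ρ := (integrable_rnDeriv_smul_iff hb).2 hi'
  have key : ∀ᵐ x ∂ρ, x ∈ U → a x • f x - b x • f' x = 0 := by
    refine hU.ae_eq_zero_of_integral_contDiff_smul_eq_zero
      ((hai.sub hbi).locallyIntegrable.locallyIntegrableOn _) fun φ hφ hc hsub => ?_
    obtain ⟨C, hC⟩ := hc.exists_bound_of_continuous hφ.continuous
    have := h φ hφ hc hsub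
    rw [← integral_rnDeriv_smul ha, ← integral_rnDeriv_smul hb] at this
    simp only [smul_sub]
    rw [integral_sub, sub_eq_zero]
    · simp only [smul_comm (φ _)]; exact this
    · exact hai.bdd_smul C hφ.continuous.aestronglyMeasurable (Eventually.of_forall hC)
    · exact hbi.bdd_smul C hφ.continuous.aestronglyMeasurable (Eventually.of_forall hC)
  rw [← setIntegral_rnDeriv_smul ha hs, ← setIntegral_rnDeriv_smul hb hs]
  refine setIntegral_congr_ae hs ?_
  filter_upwards [key] with x hx hxs
  exact sub_eq_zero.1 (hx (hsU hxs))

lemma IsPolar.integrable {E : Set (Euc n)} {μ : Measure (Euc n)} {f : Euc n → Euc n}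
    (h : IsPolar E μ f) : Integrable f μ := by
  have := h.finite
  exact integrable_of_norm_eq_one h.measurable h.norm_eq_one

/-- Uniqueness of the Gauss-Green measure. -/
lemma IsPolar.withDensity_eq {E : Set (Euc n)} {μ μ' : Measure (Euc n)} {f f' : Euc n → Euc n}
    (h : IsPolar E μ f) (h' : IsPolar E μ' f') : μ.withDensityᵥ f = μ'.withDensityᵥ f' := by
  have := h.finite
  have := h'.finite
  ext1 s hs
  rw [withDensityᵥ_apply h.integrable hs, withDensityᵥ_apply h'.integrable hs]
  refine setIntegral_eq_of_integral_test_eq h.integrable h'.integrable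
    isOpen_univ (fun φ hφ hc _ => ?_) hs (subset_univ _)
  rw [← h.integral_gradient φ (hφ.of_le (by simp)) hc,
    h'.integral_gradient φ (hφ.of_le (by simp)) hc]

/-- `gaussGreen` is picked by choice; uniqueness lets any polar pair compute it. -/
lemma IsPolar.gaussGreen_eq {E : Set (Euc n)} {μ : Measure (Euc n)} {f : Euc n → Euc n}
    (h : IsPolar E μ f) : gaussGreen E = μ.withDensityᵥ f := by
  have hex : ∃ m, IsGaussGreen E m := ⟨_, h.isGaussGreen⟩
  have hg : IsGaussGreen E (gaussGreen E) := by
    rw [gaussGreen, dif_pos hex]; exact Classical.choose_spec hex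
  obtain ⟨f', hf', he⟩ := hg.exists_polar
  rw [← he]
  exact hf'.withDensity_eq h

lemma IsPolar.variation_eq {E : Set (Euc n)} {μ : Measure (Euc n)} {f : Euc n → Euc n}
    (h : IsPolar E μ f) : (gaussGreen E).variation = μ := by
  have := h.finite
  rw [h.gaussGreen_eq, variation_withDensity_of_norm_eq_one h.measurable h.norm_eq_one]

lemma HasFinitePerimeter.exists_polar {E : Set (Euc n)} (h : HasFinitePerimeter E) :
    ∃ f, IsPolar E (gaussGreen E).variation f := by
  obtain ⟨m, hm⟩ := h.2
  obtain ⟨f, hf, -⟩ := hm.exists_polar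
  refine ⟨f, ?_⟩
  rw [hf.variation_eq]
  exact hf

lemma IsPolar.normalRatio_eq {E : Set (Euc n)} {μ : Measure (Euc n)} {f : Euc n → Euc n}
    (h : IsPolar E μ f) (x : Euc n) (r : ℝ) :
    normalRatio E x r = (μ.real (Metric.ball x r))⁻¹ • ∫ y in Metric.ball x r, f y ∂μ := by
  rw [normalRatio, h.variation_eq, h.gaussGreen_eq,
    withDensityᵥ_apply h.integrable measurableSet_ball]
  rfl

/-! ### Mollification -/

section Mollify

open scoped Convolution

/-- Convolution of a locally integrable function with a smooth probability density. -/
noncomputable def mollify (b : ContDiffBump (0 : Euc n)) (g : Euc n → ℝ) (x : Euc n) : ℝ :=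
  ∫ y, b.normed volume (x - y) * g y

lemma mollify_eq_convolution (b : ContDiffBump (0 : Euc n)) (g : Euc n → ℝ) :
    mollify b g = (b.normed volume ⋆[ContinuousLinearMap.lsmul ℝ ℝ, volume] g) := by
  ext x
  rw [convolution_lsmul_swap]
  rfl

lemma contDiff_mollify (b : ContDiffBump (0 : Euc n)) {g : Euc n → ℝ}
    (hg : LocallyIntegrable g volume) : ContDiff ℝ ∞ (mollify b g) := by
  rw [mollify_eq_convolution]
  exact b.hasCompactSupport_normed.contDiff_convolution_left _ b.contDiff_normed hg

lemma contDiff_normed_sub (b : ContDiffBump (0 : Euc n)) (x : Euc n) :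
    ContDiff ℝ ∞ fun y => b.normed volume (x - y) :=
  b.contDiff_normed.comp (contDiff_const.sub contDiff_id)

lemma tsupport_normed_sub (b : ContDiffBump (0 : Euc n)) (x : Euc n) :
    tsupport (fun y => b.normed volume (x - y)) ⊆ Metric.closedBall x b.rOut := by
  refine closure_minimal (fun y hy => ?_) Metric.isClosed_closedBall
  have : x - y ∈ Function.support (b.normed volume) := hy
  rw [b.support_normed_eq] at this
  rw [Metric.mem_closedBall, dist_comm, dist_eq_norm]
  exact (mem_ball_zero_iff.1 this).le

lemma hasCompactSupport_normed_sub (b : ContDiffBump (0 : Euc n)) (x : Euc n) :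
    HasCompactSupport (fun y => b.normed volume (x - y)) :=
  IsCompact.of_isClosed_subset (isCompact_closedBall x b.rOut) (isClosed_tsupport _)
    (tsupport_normed_sub b x)

lemma gradient_normed_sub (b : ContDiffBump (0 : Euc n)) (x y : Euc n) :
    gradient (fun z => b.normed volume (x - z)) y = - gradient (b.normed volume) (x - y) := by
  have h : HasFDerivAt (fun z => b.normed volume (x - z))
      ((fderiv ℝ (b.normed volume) (x - y)).comp (-(ContinuousLinearMap.id ℝ (Euc n)))) y := by
    refine HasFDerivAt.comp y ((b.contDiff_normed (n := 1)).differentiable one_ne_zero _).hasFDerivAt ?_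
    exact (hasFDerivAt_id y).const_sub x
  simp only [gradient, h.fderiv]
  rw [← map_neg]
  congr 1
  ext v
  simp

lemma gradient_mollify (b : ContDiffBump (0 : Euc n)) {g : Euc n → ℝ}
    (hg : LocallyIntegrable g volume) (x : Euc n) :
    gradient (mollify b g) x =
      - ∫ y, g y • gradient (fun z => b.normed volume (x - z)) y := by
  have hd := (b.hasCompactSupport_normed (μ := volume)).hasFDerivAt_convolution_left (μ := volume)
    (ContinuousLinearMap.lsmul ℝ ℝ) (b.contDiff_normed (n := 1)) hg x
  rw [← mollify_eq_convolution] at hd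
  have hfc : Continuous (fderiv ℝ (b.normed (volume : Measure (Euc n)))) :=
    (b.contDiff_normed (n := 1)).continuous_fderiv one_ne_zero
  have hint : Integrable (fun y => (g y) • fderiv ℝ (b.normed (volume : Measure (Euc n))) (x - y)) := by
    have : Integrable (fun y => (fderiv ℝ (b.normed (volume : Measure (Euc n))) (x - y))
        |> fun A => (g y) • A) := by
      refine hg.integrable_smul_right_of_hasCompactSupport ?_ ?_
      · exact hfc.comp (continuous_const.sub continuous_id)
      · exact ((b.hasCompactSupport_normed (μ := volume)).fderiv ℝ).comp_homeomorph (Homeomorph.subLeft x)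
    exact this
  refine ext_inner_right ℝ fun v => ?_
  rw [inner_gradient_eq_fderiv, hd.fderiv, convolution_eq_swap]
  have e1 : ∀ y, ((ContinuousLinearMap.precompL (Euc n) (ContinuousLinearMap.lsmul ℝ ℝ))
      (fderiv ℝ (b.normed (volume : Measure (Euc n))) (x - y))) (g y)
      = g y • fderiv ℝ (b.normed (volume : Measure (Euc n))) (x - y) := by
    intro y; ext w
    simp [ContinuousLinearMap.precompL_apply, mul_comm]
  simp_rw [e1, gradient_normed_sub, smul_neg]
  rw [integral_neg, neg_neg, ContinuousLinearMap.integral_apply hint]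
  have hint2 : Integrable (fun y => g y • gradient (b.normed (volume : Measure (Euc n))) (x - y)) := by
    have := (InnerProductSpace.toDual ℝ (Euc n)).symm.toContinuousLinearEquiv.toContinuousLinearMap.integrable_comp hint
    simpa [gradient] using this
  rw [real_inner_comm, ← integral_inner hint2]
  refine integral_congr_ae (Eventually.of_forall fun y => ?_)
  simp only [inner_smul_right]
  rw [real_inner_comm, inner_gradient_eq_fderiv]
  rfl

end Mollify

/-! ### Translations of sets of finite perimeter -/

section Translation

/-- The indicator function of `E` with real values. -/
noncomputable def ind (E : Set (Euc n)) : Euc n → ℝ := E.indicator fun _ => 1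

lemma ind_nonneg (E : Set (Euc n)) (x : Euc n) : 0 ≤ ind E x :=
  indicator_nonneg (fun _ _ => zero_le_one) x

lemma ind_le_one (E : Set (Euc n)) (x : Euc n) : ind E x ≤ 1 :=
  indicator_le' (fun _ _ => le_rfl) (fun _ _ => zero_le_one) x

lemma aestronglyMeasurable_ind {E : Set (Euc n)} (hE : NullMeasurableSet E volume) :
    AEStronglyMeasurable (ind E) volume :=
  aestronglyMeasurable_const.indicator₀ hE

lemma locallyIntegrable_ind {E : Set (Euc n)} (hE : NullMeasurableSet E volume) :
    LocallyIntegrable (ind E) volume := by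
  refine (locallyIntegrable_const (1 : ℝ)).mono (aestronglyMeasurable_ind hE)
    (Eventually.of_forall fun x => ?_)
  rw [Real.norm_of_nonneg (ind_nonneg E x)]
  simpa using ind_le_one E x

lemma integral_ind_smul {V : Type*} [NormedAddCommGroup V] [NormedSpace ℝ V] {E : Set (Euc n)}
    (hE : NullMeasurableSet E volume) (g : Euc n → V) :
    ∫ y, ind E y • g y = ∫ y in E, g y := by
  rw [← integral_indicator₀ hE]
  congr 1 with y
  by_cases hy : y ∈ E <;> simp [ind, hy]

lemma gradient_mollify_ind {E : Set (Euc n)} (hE : NullMeasurableSet E volume)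
    (b : ContDiffBump (0 : Euc n)) (x : Euc n) :
    gradient (mollify b (ind E)) x
      = - ∫ y in E, gradient (fun z => b.normed volume (x - z)) y := by
  rw [gradient_mollify b (locallyIntegrable_ind hE), integral_ind_smul hE]

/-- The kernel `b(x - ·)` is itself an admissible test function, so the gradient of the mollified
indicator is, up to sign, the mollified Gauss-Green measure. -/
lemma IsPolar.enorm_gradient_mollify_le {E : Set (Euc n)} {μ : Measure (Euc n)}
    {f : Euc n → Euc n} (h : IsPolar E μ f) (hE : NullMeasurableSet E volume)
    (b : ContDiffBump (0 : Euc n)) (x : Euc n) :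
    ‖gradient (mollify b (ind E)) x‖ₑ ≤ ∫⁻ y, ENNReal.ofReal (b.normed volume (x - y)) ∂μ := by
  rw [gradient_mollify_ind hE, enorm_neg,
    h.integral_gradient _ ((contDiff_normed_sub b x).of_le (by simp))
      (hasCompactSupport_normed_sub b x)]
  refine (enorm_integral_le_lintegral_enorm _).trans (lintegral_mono_ae ?_)
  filter_upwards [h.norm_eq_one] with y hy
  rw [← ofReal_norm, norm_smul, hy, mul_one, Real.norm_of_nonneg (b.nonneg_normed _)]

lemma enorm_sub_le_lintegral_gradient {F : Euc n → ℝ} (hF : ContDiff ℝ 1 F) (z h : Euc n) :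
    ‖F (z + h) - F z‖ₑ ≤ ∫⁻ s in Ioc (0 : ℝ) 1, ‖h‖ₑ * ‖gradient F (z + s • h)‖ₑ := by
  have hd : ∀ s : ℝ, HasDerivAt (fun s : ℝ => F (z + s • h)) (fderiv ℝ F (z + s • h) h) s := by
    intro s
    have h1 : HasDerivAt (fun s : ℝ => z + s • h) h s := by
      simpa using ((hasDerivAt_id s).smul_const h).const_add z
    exact ((hF.differentiable one_ne_zero) _).hasFDerivAt.comp_hasDerivAt s h1
  have hc : Continuous fun s : ℝ => fderiv ℝ F (z + s • h) h := by
    have := hF.continuous_fderiv one_ne_zero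
    fun_prop
  have := intervalIntegral.integral_eq_sub_of_hasDerivAt (fun s _ => hd s)
    (hc.intervalIntegrable 0 1)
  simp only [one_smul, zero_smul, add_zero] at this
  rw [← this, intervalIntegral.integral_of_le zero_le_one]
  refine (enorm_integral_le_lintegral_enorm _).trans (lintegral_mono fun s => ?_)
  rw [← ofReal_norm, ← ofReal_norm, ← ofReal_norm, ← ENNReal.ofReal_mul (norm_nonneg _)]
  refine ENNReal.ofReal_le_ofReal ?_
  rw [norm_gradient, mul_comm]
  exact ContinuousLinearMap.le_opNorm _ _

lemma lintegral_normed_sub_le (b : ContDiffBump (0 : Euc n)) (y : Euc n) (S : Set (Euc n)) :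
    ∫⁻ w in S, ENNReal.ofReal (b.normed volume (w - y)) ≤ 1 := by
  refine (setLIntegral_le_lintegral _ _).trans ?_
  rw [lintegral_sub_right_eq_self (fun w => ENNReal.ofReal (b.normed volume w)),
    ← ofReal_integral_eq_lintegral_ofReal b.integrable_normed
      (Eventually.of_forall b.nonneg_normed), b.integral_normed]
  simp

lemma measurable_normed_sub (b : ContDiffBump (0 : Euc n)) :
    Measurable fun p : Euc n × Euc n => ENNReal.ofReal (b.normed volume (p.1 - p.2)) := by
  refine ENNReal.measurable_ofReal.comp (Continuous.measurable ?_)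
  have := (b.contDiff_normed (n := 0) (μ := (volume : Measure (Euc n)))).continuous
  fun_prop

/-- By Fubini each `y` contributes the mass of its kernel, at most one, and contributes nothing
unless it lies within `b.rOut` of the ball. -/
lemma lintegral_ball_normed_sub_le (b : ContDiffBump (0 : Euc n)) (μ : Measure (Euc n))
    [SFinite μ] (x : Euc n) {r R : ℝ} (hR : r + b.rOut ≤ R) :
    ∫⁻ w in Metric.ball x r, ∫⁻ y, ENNReal.ofReal (b.normed volume (w - y)) ∂μ
      ≤ μ (Metric.ball x R) := by
  rw [lintegral_lintegral_swap (measurable_normed_sub b).aemeasurable,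
    ← lintegral_indicator_one measurableSet_ball]
  refine lintegral_mono fun y => ?_
  by_cases hy : y ∈ Metric.ball x R
  · simpa [hy] using lintegral_normed_sub_le b y _
  · have h0 : ∀ w ∈ Metric.ball x r, ENNReal.ofReal (b.normed volume (w - y)) = 0 := by
      intro w hw
      have : w - y ∉ Function.support (b.normed volume) := by
        rw [b.support_normed_eq, mem_ball_zero_iff, not_lt]
        rw [Metric.mem_ball, not_lt] at hy
        rw [Metric.mem_ball] at hw
        have := dist_triangle y w x
        rw [dist_comm y w, dist_eq_norm w y] at this
        linarith
      rw [Function.notMem_support.1 this, ENNReal.ofReal_zero]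
    rw [setLIntegral_congr_fun measurableSet_ball h0]
    simp

lemma preimage_add_right_ball' (x h : Euc n) (r : ℝ) :
    (fun z => z + h) ⁻¹' Metric.ball (x + h) r = Metric.ball x r := by
  ext z; simp

lemma setLIntegral_ball_add (G : Euc n → ℝ≥0∞) (x h : Euc n) (r : ℝ) :
    ∫⁻ z in Metric.ball x r, G (z + h) = ∫⁻ w in Metric.ball (x + h) r, G w := by
  rw [← preimage_add_right_ball' x h r]
  exact (measurePreserving_add_right volume h).setLIntegral_comp_preimage_emb
    (MeasurableEquiv.addRight h).measurableEmbedding G _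

/-- Integrate the gradient along the segment from `z` to `z + h` and exchange the integrals; each
intermediate translate of the ball, enlarged by the kernel radius, stays inside `B_R(x)`. -/
lemma IsPolar.lintegral_mollify_translate_le {E : Set (Euc n)} {μ : Measure (Euc n)}
    {f : Euc n → Euc n} (hp : IsPolar E μ f) (hE : NullMeasurableSet E volume)
    (b : ContDiffBump (0 : Euc n)) (x h : Euc n) {r R : ℝ} (hR : r + ‖h‖ + b.rOut ≤ R) :
    ∫⁻ z in Metric.ball x r, ‖mollify b (ind E) (z + h) - mollify b (ind E) z‖ₑ
      ≤ ‖h‖ₑ * μ (Metric.ball x R) := by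
  have := hp.finite
  have hC : ContDiff ℝ 1 (mollify b (ind E)) :=
    (contDiff_mollify b (locallyIntegrable_ind hE)).of_le (by simp)
  have hcg : Continuous fun p : Euc n × ℝ => gradient (mollify b (ind E)) (p.1 + p.2 • h) :=
    (ContDiff.continuous_gradient hC).comp (by fun_prop)
  calc ∫⁻ z in Metric.ball x r, ‖mollify b (ind E) (z + h) - mollify b (ind E) z‖ₑ
      ≤ ∫⁻ z in Metric.ball x r, ∫⁻ s in Ioc (0 : ℝ) 1,
          ‖h‖ₑ * ‖gradient (mollify b (ind E)) (z + s • h)‖ₑ :=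
        lintegral_mono fun z => enorm_sub_le_lintegral_gradient hC z h
    _ = ∫⁻ s in Ioc (0 : ℝ) 1, ∫⁻ z in Metric.ball x r,
          ‖h‖ₑ * ‖gradient (mollify b (ind E)) (z + s • h)‖ₑ :=
        lintegral_lintegral_swap ((hcg.enorm.measurable.const_mul _).aemeasurable)
    _ ≤ ∫⁻ s in Ioc (0 : ℝ) 1, ‖h‖ₑ * μ (Metric.ball x R) := by
        refine setLIntegral_mono' measurableSet_Ioc fun s hs => ?_
        rw [lintegral_const_mul' _ _ enorm_ne_top]
        gcongr
        rw [setLIntegral_ball_add (fun w => ‖gradient (mollify b (ind E)) w‖ₑ)]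
        refine (lintegral_mono fun w => hp.enorm_gradient_mollify_le hE b w).trans ?_
        have hsub : Metric.ball (x + s • h) (r + b.rOut) ⊆ Metric.ball x R := by
          refine Metric.ball_subset_ball' ?_
          rw [dist_eq_norm, add_sub_cancel_left, norm_smul, Real.norm_of_nonneg hs.1.le]
          nlinarith [norm_nonneg h, hs.2]
        exact (lintegral_ball_normed_sub_le b μ (x + s • h) le_rfl).trans (measure_mono hsub)
    _ = ‖h‖ₑ * μ (Metric.ball x R) := by simp

/-- A smooth bump function with outer radius `δ / 2`. -/
noncomputable def smallBump (δ : ℝ) (hδ : 0 < δ) : ContDiffBump (0 : Euc n) where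
  rIn := δ / 4
  rOut := δ / 2
  rIn_pos := by positivity
  rIn_lt_rOut := by linarith

lemma ae_tendsto_mollify {g : Euc n → ℝ} (hg : LocallyIntegrable g volume) (b : ℕ → ContDiffBump (0 : Euc n))
    (hb : Tendsto (fun k => (b k).rOut) atTop (𝓝 0)) (hb' : ∀ k, (b k).rOut ≤ 2 * (b k).rIn) :
    ∀ᵐ x, Tendsto (fun k => mollify (b k) g x) atTop (𝓝 (g x)) := by
  simp_rw [mollify_eq_convolution]
  exact ContDiffBump.ae_convolution_tendsto_right_of_locallyIntegrable hb
    (Eventually.of_forall hb') hg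

/-- The `L¹` modulus of continuity of the indicator of `E` under translations is controlled by the
perimeter. -/
lemma IsPolar.lintegral_translate_le {E : Set (Euc n)} {μ : Measure (Euc n)}
    {f : Euc n → Euc n} (hp : IsPolar E μ f) (hE : NullMeasurableSet E volume)
    (x h : Euc n) {r R : ℝ} (hR : r + ‖h‖ < R) :
    ∫⁻ z in Metric.ball x r, ‖ind E (z + h) - ind E z‖ₑ ≤ ‖h‖ₑ * μ (Metric.ball x R) := by
  have hδ : ∀ k : ℕ, 0 < (R - r - ‖h‖) / (k + 1) := fun k => by
    have : 0 < R - r - ‖h‖ := by linarith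
    positivity
  -- The kernel radii tend to zero and always fit into the gap `R - r - ‖h‖`.
  let b : ℕ → ContDiffBump (0 : Euc n) := fun k => smallBump _ (hδ k)
  have hb : Tendsto (fun k => (b k).rOut) atTop (𝓝 0) := by
    have := (tendsto_const_div_atTop_nhds_zero_nat ((R - r - ‖h‖) / 2)).comp (tendsto_add_atTop_nat 1)
    refine this.congr fun k => ?_
    simp only [Function.comp, b, smallBump]
    push_cast
    ring
  have hlim := ae_tendsto_mollify (locallyIntegrable_ind hE) b hb
    (fun k => by simp only [b, smallBump]; linarith)
  have hlim' : ∀ᵐ z : Euc n, Tendsto (fun k => mollify (b k) (ind E) (z + h)) atTop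
      (𝓝 (ind E (z + h))) :=
    (measurePreserving_add_right volume h).quasiMeasurePreserving.ae hlim
  have hm : ∀ k, Measurable fun z => ‖mollify (b k) (ind E) (z + h) - mollify (b k) (ind E) z‖ₑ := by
    intro k
    have := (contDiff_mollify (b k) (locallyIntegrable_ind hE)).continuous
    exact Continuous.measurable (by fun_prop)
  -- Fatou's lemma along the mollified indicators, which converge almost everywhere.
  calc ∫⁻ z in Metric.ball x r, ‖ind E (z + h) - ind E z‖ₑ
      = ∫⁻ z in Metric.ball x r, liminf (fun k =>
          ‖mollify (b k) (ind E) (z + h) - mollify (b k) (ind E) z‖ₑ) atTop := by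
        refine lintegral_congr_ae (ae_restrict_of_ae ?_)
        filter_upwards [hlim, hlim'] with z h1 h2
        exact ((h2.sub h1).enorm.liminf_eq).symm
    _ ≤ liminf (fun k => ∫⁻ z in Metric.ball x r,
          ‖mollify (b k) (ind E) (z + h) - mollify (b k) (ind E) z‖ₑ) atTop :=
        lintegral_liminf_le hm
    _ ≤ ‖h‖ₑ * μ (Metric.ball x R) := by
        refine liminf_le_of_frequently_le' (Frequently.of_forall fun k => ?_)
        refine hp.lintegral_mollify_translate_le hE (b k) x h ?_
        simp only [b, smallBump]
        have h0 : 0 < R - r - ‖h‖ := by linarith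
        have : (R - r - ‖h‖) / (k + 1) ≤ R - r - ‖h‖ := div_le_self h0.le (by linarith [(Nat.cast_nonneg k : (0:ℝ) ≤ k)])
        linarith

end Translation

/-! ### Radial cutoff functions -/

section Cutoff

lemma exists_bound_deriv_smoothTransition : ∃ C : ℝ, 0 < C ∧
    ∀ t, |deriv Real.smoothTransition t| ≤ C := by
  have hsub : Function.support (deriv Real.smoothTransition) ⊆ Icc 0 1 := by
    intro t ht
    by_contra h
    apply ht
    rw [mem_Icc, not_and_or, not_le, not_le] at h
    rcases h with h | h
    · have : Real.smoothTransition =ᶠ[𝓝 t] fun _ => 0 := by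
        filter_upwards [Iio_mem_nhds h] with s hs
        exact Real.smoothTransition.zero_of_nonpos (le_of_lt hs)
      rw [this.deriv_eq]; simp
    · have : Real.smoothTransition =ᶠ[𝓝 t] fun _ => 1 := by
        filter_upwards [Ioi_mem_nhds h] with s hs
        exact Real.smoothTransition.one_of_one_le (le_of_lt hs)
      rw [this.deriv_eq]; simp
  have hc : HasCompactSupport (deriv Real.smoothTransition) :=
    HasCompactSupport.of_support_subset_isCompact isCompact_Icc hsub
  obtain ⟨C, hC⟩ := hc.exists_bound_of_continuous
    ((Real.smoothTransition.contDiff (n := 1)).continuous_deriv le_rfl)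
  exact ⟨|C| + 1, by positivity, fun t => (hC t).trans (by linarith [le_abs_self C])⟩

/-- A bound for the derivative of the smooth transition function. -/
noncomputable def transitionBound : ℝ := Classical.choose exists_bound_deriv_smoothTransition

lemma transitionBound_pos : 0 < transitionBound :=
  (Classical.choose_spec exists_bound_deriv_smoothTransition).1

lemma abs_deriv_smoothTransition_le (t : ℝ) : |deriv Real.smoothTransition t| ≤ transitionBound :=
  (Classical.choose_spec exists_bound_deriv_smoothTransition).2 t

/-- The profile of a radial cutoff function, as a function of the squared radius. -/
noncomputable def cutoffProfile (ρ R : ℝ) (s : ℝ) : ℝ :=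
  Real.smoothTransition ((R ^ 2 - s) / (R ^ 2 - ρ ^ 2))

/-- A smooth radial cutoff function between the balls of radii `ρ < R`. -/
noncomputable def cutoff (x : Euc n) (ρ R : ℝ) (y : Euc n) : ℝ := cutoffProfile ρ R (‖y - x‖ ^ 2)

variable {x : Euc n} {ρ R : ℝ}

lemma contDiff_cutoffProfile : ContDiff ℝ ∞ (cutoffProfile ρ R) :=
  Real.smoothTransition.contDiff.comp ((contDiff_const.sub contDiff_id).div_const _)

lemma contDiff_cutoff : ContDiff ℝ ∞ (cutoff x ρ R) :=
  contDiff_cutoffProfile.comp ((contDiff_norm_sq ℝ).comp (contDiff_id.sub contDiff_const))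

lemma cutoff_nonneg (y : Euc n) : 0 ≤ cutoff x ρ R y := Real.smoothTransition.nonneg _

lemma sq_sub_sq_pos (hρ : 0 ≤ ρ) (h : ρ < R) : 0 < R ^ 2 - ρ ^ 2 := by nlinarith

lemma cutoff_eq_one (hρ : 0 ≤ ρ) (h : ρ < R) {y : Euc n} (hy : ‖y - x‖ ≤ ρ) :
    cutoff x ρ R y = 1 := by
  refine Real.smoothTransition.one_of_one_le ?_
  rw [le_div_iff₀ (sq_sub_sq_pos hρ h)]
  nlinarith [norm_nonneg (y - x)]

lemma cutoffProfile_eq_zero (hρ : 0 ≤ ρ) (h : ρ < R) {s : ℝ} (hs : R ≤ s) :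
    cutoffProfile ρ R (s ^ 2) = 0 := by
  refine Real.smoothTransition.zero_of_nonpos ?_
  refine div_nonpos_of_nonpos_of_nonneg ?_ (sq_sub_sq_pos hρ h).le
  nlinarith

lemma cutoff_eq_zero (hρ : 0 ≤ ρ) (h : ρ < R) {y : Euc n} (hy : R ≤ ‖y - x‖) :
    cutoff x ρ R y = 0 := cutoffProfile_eq_zero hρ h hy

lemma tsupport_cutoff_subset (hρ : 0 ≤ ρ) (h : ρ < R) :
    tsupport (cutoff x ρ R) ⊆ Metric.closedBall x R := by
  refine closure_minimal (fun y hy => ?_) Metric.isClosed_closedBall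
  by_contra hy'
  rw [mem_closedBall_iff_norm, not_le] at hy'
  exact hy (cutoff_eq_zero hρ h hy'.le)

lemma hasCompactSupport_cutoff (hρ : 0 ≤ ρ) (h : ρ < R) : HasCompactSupport (cutoff x ρ R) :=
  IsCompact.of_isClosed_subset (isCompact_closedBall x R) (isClosed_tsupport _)
    (tsupport_cutoff_subset hρ h)

/-- The sphere `‖y - x‖ = R` is included, because a vanishing value is a minimum of the nonnegative
cutoff. -/
lemma gradient_cutoff_eq_zero (hρ : 0 ≤ ρ) (h : ρ < R) {y : Euc n} (hy : R ≤ ‖y - x‖) :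
    gradient (cutoff x ρ R) y = 0 := by
  have : IsLocalMin (cutoff x ρ R) y := Eventually.of_forall fun z => by
    rw [cutoff_eq_zero hρ h hy]; exact cutoff_nonneg z
  simp [gradient, this.fderiv_eq_zero]

lemma hasDerivAt_cutoffProfile (s : ℝ) : HasDerivAt (cutoffProfile ρ R)
    (deriv Real.smoothTransition ((R ^ 2 - s) / (R ^ 2 - ρ ^ 2)) * (-1 / (R ^ 2 - ρ ^ 2))) s := by
  refine HasDerivAt.comp s
    ((Real.smoothTransition.contDiff (n := 1)).differentiable one_ne_zero _).hasDerivAt ?_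
  exact ((hasDerivAt_id s).const_sub (R ^ 2)).div_const _

lemma norm_gradient_cutoff_le (hρ : 0 ≤ ρ) (h : ρ < R) (y : Euc n) :
    ‖gradient (cutoff x ρ R) y‖ ≤ 2 * transitionBound / (R - ρ) := by
  rcases le_or_gt R ‖y - x‖ with hy | hy
  · rw [gradient_cutoff_eq_zero hρ h hy, norm_zero]
    have := transitionBound_pos
    have : 0 < R - ρ := by linarith
    positivity
  have hd := sq_sub_sq_pos hρ h
  have h1 : HasFDerivAt (fun y : Euc n => ‖y - x‖ ^ 2) (2 • (innerSL ℝ (y - x))) y := by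
    have := (hasStrictFDerivAt_norm_sq (y - x)).hasFDerivAt.comp y ((hasFDerivAt_id y).sub_const x)
    rw [ContinuousLinearMap.comp_id] at this
    exact this
  have h2 := (hasDerivAt_cutoffProfile (ρ := ρ) (R := R) (‖y - x‖ ^ 2)).comp_hasFDerivAt y h1
  rw [norm_gradient, show cutoff x ρ R = cutoffProfile ρ R ∘ fun y : Euc n => ‖y - x‖ ^ 2 from rfl,
    h2.fderiv, norm_smul, norm_mul, Real.norm_eq_abs, Real.norm_eq_abs, abs_div, abs_neg, abs_one,
    abs_of_pos hd]
  have h3 : ‖(2 • innerSL ℝ (y - x) : Euc n →L[ℝ] ℝ)‖ ≤ 2 * R := by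
    rw [← Nat.cast_smul_eq_nsmul ℝ, norm_smul, innerSL_apply_norm]
    simp only [Nat.cast_ofNat, Real.norm_ofNat]
    linarith
  have hRR : (0 : ℝ) < R - ρ := by linarith
  calc _ ≤ transitionBound * (1 / (R ^ 2 - ρ ^ 2)) * (2 * R) := by
        gcongr
        · exact mul_nonneg transitionBound_pos.le (by positivity)
        · exact abs_deriv_smoothTransition_le _
    -- The profile depends on the squared radius; factoring `R² - ρ²` recovers the expected scale `R
    -- - ρ`.
    _ = (2 * transitionBound / (R - ρ)) * (R / (R + ρ)) := by
        have : R + ρ ≠ 0 := by linarith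
        have : R - ρ ≠ 0 := hRR.ne'
        rw [show R ^ 2 - ρ ^ 2 = (R - ρ) * (R + ρ) by ring]
        field_simp
    _ ≤ (2 * transitionBound / (R - ρ)) * 1 := by
        have := transitionBound_pos
        gcongr
        rw [div_le_one (by linarith)]; linarith
    _ = _ := mul_one _

/-- Layer cake: integrals of a function over centred balls control its integral against a radial
cutoff function. -/
lemma integral_cutoff_mul_nonneg (hρ : 0 ≤ ρ) (h : ρ < R) {μ : Measure (Euc n)} [IsFiniteMeasure μ]
    {w : Euc n → ℝ} (hw : Integrable w μ)
    (hpos : ∀ s, 0 < s → s ≤ R → 0 ≤ ∫ y in Metric.ball x s, w y ∂μ) :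
    0 ≤ ∫ y, cutoff x ρ R y * w y ∂μ := by
  set θ : ℝ → ℝ := fun s => cutoffProfile ρ R (s ^ 2) with hθ
  have hθd : ∀ s, HasDerivAt θ (deriv θ s) s := fun s => by
    have : ContDiff ℝ 1 θ := (contDiff_cutoffProfile.of_le (by simp)).comp (contDiff_id.pow 2)
    exact (this.differentiable one_ne_zero s).hasDerivAt
  have hθc : Continuous (deriv θ) := by
    have : ContDiff ℝ 1 θ := (contDiff_cutoffProfile.of_le (by simp)).comp (contDiff_id.pow 2)
    exact this.continuous_deriv le_rfl
  have hθneg : ∀ s, 0 < s → deriv θ s ≤ 0 := by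
    intro s hs
    have h1 := (hasDerivAt_cutoffProfile (ρ := ρ) (R := R) (s ^ 2)).comp s (hasDerivAt_pow 2 s)
    rw [show θ = cutoffProfile ρ R ∘ fun s => s ^ 2 from rfl, h1.deriv]
    have h2 : 0 ≤ deriv Real.smoothTransition ((R ^ 2 - s ^ 2) / (R ^ 2 - ρ ^ 2)) :=
      Real.smoothTransition.monotone.deriv_nonneg
    have h3 : -1 / (R ^ 2 - ρ ^ 2) ≤ 0 :=
      div_nonpos_of_nonpos_of_nonneg (by norm_num) (sq_sub_sq_pos hρ h).le
    have h4 : (0 : ℝ) ≤ ((2 : ℕ) : ℝ) * s ^ (2 - 1) := by positivity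
    nlinarith [mul_nonneg (mul_nonneg h2 (neg_nonneg.2 h3)) h4]
  -- The cutoff is a superposition of indicators of centred balls with weights `-θ' ≥ 0`, so
  -- nonnegativity of the integrals over balls is inherited.
  have hrep : ∀ y, cutoff x ρ R y
      = ∫ s in Ioc 0 R, (Metric.ball x s).indicator (fun _ => - deriv θ s) y := by
    intro y
    rcases le_or_gt R ‖y - x‖ with hy | hy
    · rw [cutoff_eq_zero hρ h hy]
      symm
      refine setIntegral_eq_zero_of_forall_eq_zero fun s hs => ?_
      refine indicator_of_notMem ?_ _
      rw [mem_ball_iff_norm, not_lt]; exact hs.2.trans hy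
    · have e1 : ∀ s, (Metric.ball x s).indicator (fun _ => - deriv θ s) y
          = (Ioi ‖y - x‖).indicator (fun s => - deriv θ s) s := fun s => by
        by_cases hs : ‖y - x‖ < s
        · rw [indicator_of_mem (mem_ball_iff_norm.2 hs), indicator_of_mem (mem_Ioi.2 hs)]
        · rw [indicator_of_notMem (fun H => hs (mem_ball_iff_norm.1 H)),
            indicator_of_notMem (fun H => hs (mem_Ioi.1 H))]
      simp_rw [e1]
      rw [setIntegral_indicator measurableSet_Ioi, integral_neg]
      have e2 : Ioc 0 R ∩ Ioi ‖y - x‖ = Ioc ‖y - x‖ R := by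
        ext s; simp only [mem_inter_iff, mem_Ioc, mem_Ioi]
        constructor
        · rintro ⟨⟨-, a⟩, b⟩; exact ⟨b, a⟩
        · rintro ⟨a, b⟩; exact ⟨⟨(norm_nonneg _).trans_lt a, b⟩, a⟩
      rw [e2, ← intervalIntegral.integral_of_le hy.le,
        intervalIntegral.integral_eq_sub_of_hasDerivAt (fun s _ => hθd s)
          (hθc.intervalIntegrable _ _)]
      simp only [hθ]
      rw [cutoffProfile_eq_zero hρ h le_rfl]
      simp [cutoff]
  have hms : MeasurableSet {p : Euc n × ℝ | p.1 ∈ Metric.ball x p.2} := by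
    simp only [mem_ball_iff_norm]
    exact measurableSet_lt (by fun_prop) measurable_snd
  have hprod : Integrable (fun p : Euc n × ℝ =>
      (Metric.ball x p.2).indicator (fun _ => - deriv θ p.2) p.1 * w p.1)
      (μ.prod (volume.restrict (Ioc 0 R))) := by
    have hb : Integrable (fun p : Euc n × ℝ => w p.1 * (- deriv θ p.2))
        (μ.prod (volume.restrict (Ioc 0 R))) := by
      refine hw.mul_prod (g := fun s => - deriv θ s) ?_
      exact (hθc.neg.integrableOn_Icc (a := 0) (b := R)).mono_set Ioc_subset_Icc_self
    have := hb.indicator hms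
    refine this.congr (Eventually.of_forall fun p => ?_)
    by_cases hp : p.1 ∈ Metric.ball x p.2
    · rw [indicator_of_mem (show p ∈ {p : Euc n × ℝ | p.1 ∈ Metric.ball x p.2} from hp)]
      simp only [indicator_of_mem hp]; ring
    · rw [indicator_of_notMem (show p ∉ {p : Euc n × ℝ | p.1 ∈ Metric.ball x p.2} from hp)]
      simp only [indicator_of_notMem hp]; ring
  calc (0 : ℝ) ≤ ∫ s in Ioc 0 R, ∫ y,
        (Metric.ball x s).indicator (fun _ => - deriv θ s) y * w y ∂μ := by
        refine setIntegral_nonneg measurableSet_Ioc fun s hs => ?_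
        have : ∀ y, (Metric.ball x s).indicator (fun _ => - deriv θ s) y * w y
            = (- deriv θ s) * (Metric.ball x s).indicator w y := fun y => by
          by_cases hy : y ∈ Metric.ball x s <;> simp [hy]
        simp_rw [this]
        rw [integral_const_mul, integral_indicator measurableSet_ball]
        exact mul_nonneg (neg_nonneg.2 (hθneg s hs.1)) (hpos s hs.1 hs.2)
    _ = ∫ y, (∫ s in Ioc 0 R, (Metric.ball x s).indicator (fun _ => - deriv θ s) y * w y) ∂μ :=
        (integral_integral_swap hprod).symm
    _ = ∫ y, cutoff x ρ R y * w y ∂μ := by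
        refine integral_congr_ae (Eventually.of_forall fun y => ?_)
        simp only
        rw [hrep y, integral_mul_const]

end Cutoff

/-! ### Complements -/

lemma integral_gradient_eq_zero {φ : Euc n → ℝ} (h : ContDiff ℝ 1 φ) (hc : HasCompactSupport φ) :
    ∫ x, gradient φ x = 0 := by
  refine ext_inner_left ℝ fun v => ?_
  rw [← integral_inner (integrable_gradient h hc _)]
  have hv : ∀ x, inner ℝ v (gradient φ x) = fderiv ℝ φ x v := fun x => by
    rw [real_inner_comm, inner_gradient_eq_fderiv]
  simp_rw [hv]
  have hi : Integrable fun x => fderiv ℝ φ x v := by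
    have := (integrable_gradient h hc (volume : Measure (Euc n))).inner_const (𝕜 := ℝ) v
    simpa only [inner_gradient_eq_fderiv] using this
  have := integral_mul_fderiv_eq_neg_fderiv_mul_of_integrable (𝕜 := ℝ)
    (μ := (volume : Measure (Euc n)))
    (f := fun _ => (1 : ℝ)) (g := φ) (v := v) (by simp) (by simpa using hi)
    (by simpa using h.continuous.integrable_of_hasCompactSupport hc)
    (fun _ _ => differentiableAt_const _) (fun x _ => h.differentiable one_ne_zero x)
  simpa using this

/-- Gradients of test functions have zero integral over the whole space, so passing to the
complement only reverses the normal. -/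
lemma IsPolar.compl {E : Set (Euc n)} {μ : Measure (Euc n)} {f : Euc n → Euc n}
    (h : IsPolar E μ f) (hE : NullMeasurableSet E volume) : IsPolar Eᶜ μ (fun x => - f x) where
  finite := h.finite
  measurable := h.measurable.neg
  norm_eq_one := by simpa using h.norm_eq_one
  integral_gradient φ hφ hc := by
    have := integral_add_compl₀ hE (integrable_gradient hφ hc volume)
    rw [integral_gradient_eq_zero hφ hc, h.integral_gradient φ hφ hc] at this
    simp only [smul_neg]
    rw [integral_neg]
    exact eq_neg_of_add_eq_zero_right this

/-! ### Density estimates -/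

section Density

/-- The volume of the unit ball. -/
noncomputable def unitVol (n : ℕ) : ℝ := volume.real (Metric.ball (0 : Euc n) 1)

lemma unitVol_pos : 0 < unitVol n :=
  ENNReal.toReal_pos (Metric.measure_ball_pos volume _ one_pos).ne' measure_ball_lt_top.ne

lemma volume_real_ball (x : Euc n) {r : ℝ} (hr : 0 < r) :
    volume.real (Metric.ball x r) = r ^ n * unitVol n := by
  rw [Measure.real, Measure.addHaar_ball_of_pos _ _ hr, ENNReal.toReal_mul,
    ENNReal.toReal_ofReal (by positivity), finrank_euclideanSpace_fin]
  rfl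

/-- The measure `μ` (with density `f`) looks like a multiple of `ν` on small balls around `x`. -/
structure IsGoodPoint (μ : Measure (Euc n)) (f : Euc n → Euc n) (x ν : Euc n) (r₀ : ℝ) : Prop where
  pos : 0 < r₀
  norm_eq_one : ‖ν‖ = 1
  half_le : ∀ r, 0 < r → r < r₀ →
    μ.real (Metric.ball x r) / 2 ≤ inner ℝ ν (∫ y in Metric.ball x r, f y ∂μ)
  measure_pos : ∀ r, 0 < r → r < r₀ → 0 < μ.real (Metric.ball x r)

lemma IsGoodPoint.neg {μ : Measure (Euc n)} {f : Euc n → Euc n} {x ν : Euc n} {r₀ : ℝ}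
    (h : IsGoodPoint μ f x ν r₀) : IsGoodPoint μ (fun y => - f y) x (-ν) r₀ where
  pos := h.pos
  norm_eq_one := by rw [norm_neg, h.norm_eq_one]
  half_le r h0 hr := by
    rw [integral_neg, inner_neg_neg]; exact h.half_le r h0 hr
  measure_pos := h.measure_pos

variable {E : Set (Euc n)} {μ : Measure (Euc n)} {f : Euc n → Euc n} {x ν : Euc n} {r₀ : ℝ}

/-- The normal ratio is zero wherever its denominator vanishes, so closeness to a unit vector also
forces small balls to have positive measure. -/
lemma IsPolar.exists_isGoodPoint (hp : IsPolar E μ f) (hν : ‖ν‖ = 1)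
    (ht : Tendsto (normalRatio E x) (𝓝[>] 0) (𝓝 ν)) : ∃ r₀, IsGoodPoint μ f x ν r₀ := by
  have := hp.finite
  have h1 : Tendsto (fun r => inner ℝ ν (normalRatio E x r)) (𝓝[>] 0) (𝓝 1) := by
    have := (tendsto_const_nhds (x := ν)).inner (𝕜 := ℝ) ht
    rwa [real_inner_self_eq_norm_sq, hν, one_pow] at this
  have h2 := h1.eventually (lt_mem_nhds (show (1 / 2 : ℝ) < 1 by norm_num))
  obtain ⟨r₀, hr₀, hr⟩ := mem_nhdsGT_iff_exists_Ioo_subset.1 h2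
  refine ⟨r₀, hr₀, hν, fun r h0 hlt => ?_, fun r h0 hlt => ?_⟩
  · have := hr ⟨h0, hlt⟩
    simp only [mem_ofPred_eq, hp.normalRatio_eq, inner_smul_right] at this
    have hm : 0 < μ.real (Metric.ball x r) := by
      rcases (measureReal_nonneg (μ := μ) (s := Metric.ball x r)).eq_or_lt with h | h
      · rw [← h, inv_zero, zero_mul] at this; norm_num at this
      · exact h
    rw [inv_mul_eq_div, lt_div_iff₀ hm] at this
    linarith
  · have := hr ⟨h0, hlt⟩
    simp only [mem_ofPred_eq, hp.normalRatio_eq, inner_smul_right] at this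
    rcases (measureReal_nonneg (μ := μ) (s := Metric.ball x r)).eq_or_lt with h | h
    · rw [← h, inv_zero, zero_mul] at this; norm_num at this
    · exact h

/-- Near a point of the reduced boundary the perimeter is controlled by the volume. -/
lemma IsPolar.measure_ball_le_volume (hp : IsPolar E μ f) (hE : NullMeasurableSet E volume)
    (hg : IsGoodPoint μ f x ν r₀) {ρ R : ℝ} (hρ : 0 < ρ) (h : ρ < R) (hR : R < r₀) :
    μ.real (Metric.ball x ρ)
      ≤ 4 * transitionBound / (R - ρ) * volume.real (E ∩ Metric.ball x R) := by
  have := hp.finite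
  have hfi := hp.integrable
  set χ := cutoff x ρ R
  have hχi : Integrable χ μ := contDiff_cutoff.continuous.integrable_of_hasCompactSupport
    (hasCompactSupport_cutoff hρ.le h)
  have hχf := hp.smul_integrable hχi
  -- At a good point the integral of `⟨ν, f⟩ - 1/2` over each small centred ball is nonnegative. The
  -- layer cake formula carries this over to the cutoff, against which Gauss-Green can be applied.
  have h1 : (0 : ℝ) ≤ ∫ y, χ y * (inner ℝ ν (f y) - 1 / 2) ∂μ := by
    refine integral_cutoff_mul_nonneg hρ.le h ((hfi.const_inner ν).sub (integrable_const _)) ?_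
    intro s hs hsR
    rw [integral_sub ((hfi.const_inner (𝕜 := ℝ) ν).restrict (s := Metric.ball x s)) (integrable_const _), integral_inner hfi.integrableOn]
    have := hg.half_le s hs (hsR.trans_lt hR)
    simp only [integral_const, measureReal_restrict_apply_univ, smul_eq_mul]
    linarith
  have h2 : ∫ y, χ y * (inner ℝ ν (f y) - 1 / 2) ∂μ
      = inner ℝ ν (∫ y, χ y • f y ∂μ) - (∫ y, χ y ∂μ) / 2 := by
    rw [← integral_inner hχf, ← integral_div, ← integral_sub (hχf.const_inner ν) (hχi.div_const _)]
    refine integral_congr_ae (Eventually.of_forall fun y => ?_)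
    simp only [inner_smul_right]
    ring
  have h3 : μ.real (Metric.ball x ρ) ≤ ∫ y, χ y ∂μ := by
    rw [← integral_indicator_one measurableSet_ball]
    refine integral_mono ((integrable_const (1 : ℝ)).indicator measurableSet_ball) hχi fun y => ?_
    by_cases hy : y ∈ Metric.ball x ρ
    · simp only [hy, indicator_of_mem, Pi.one_apply]
      exact (cutoff_eq_one hρ.le h (mem_ball_iff_norm.1 hy).le).ge
    · simp only [hy, not_false_eq_true, indicator_of_notMem]
      exact cutoff_nonneg y
  rw [← hp.integral_gradient χ (contDiff_cutoff.of_le (by simp)) (hasCompactSupport_cutoff hρ.le h)] at h2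
  have h4 : ‖∫ y in E, gradient χ y‖
      ≤ 2 * transitionBound / (R - ρ) * volume.real (E ∩ Metric.ball x R) := by
    have e : ∫ y in E, gradient χ y = ∫ y in E ∩ Metric.ball x R, gradient χ y := by
      refine setIntegral_eq_of_subset_of_ae_sdiff_eq_zero hE inter_subset_left ?_
      refine Eventually.of_forall fun y hy => gradient_cutoff_eq_zero hρ.le h ?_
      have : y ∉ Metric.ball x R := fun H => hy.2 ⟨hy.1, H⟩
      rwa [mem_ball_iff_norm, not_lt] at this
    rw [e]
    refine norm_setIntegral_le_of_norm_le_const ?_ fun y _ => norm_gradient_cutoff_le hρ.le h y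
    exact (measure_mono inter_subset_right).trans_lt measure_ball_lt_top
  have h5 : inner ℝ ν (∫ y in E, gradient χ y) ≤ ‖∫ y in E, gradient χ y‖ := by
    simpa [hg.norm_eq_one] using real_inner_le_norm ν (∫ y in E, gradient χ y)
  have h6 : 4 * transitionBound / (R - ρ) * volume.real (E ∩ Metric.ball x R)
    = 2 * (2 * transitionBound / (R - ρ) * volume.real (E ∩ Metric.ball x R)) := by ring
  rw [h6]
  linarith

/-- Averaged translation estimate. -/
lemma aemeasurable_enorm_ind_translate {E : Set (Euc n)} (hE : NullMeasurableSet E volume) :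
    AEMeasurable (fun p : Euc n × Euc n => ‖ind E (p.2 + p.1) - ind E p.2‖ₑ)
      (volume.prod volume) := by
  refine AEStronglyMeasurable.enorm (AEStronglyMeasurable.sub ?_ ?_)
  · have hq : Measure.QuasiMeasurePreserving (fun p : Euc n × Euc n => p.2 + p.1)
        (volume.prod volume) volume := by
      have := (Measure.quasiMeasurePreserving_snd (μ := (volume : Measure (Euc n)))
        (ν := (volume : Measure (Euc n)))).comp
        (measurePreserving_prod_add (volume : Measure (Euc n)) volume).quasiMeasurePreserving
      have h2 := this
      refine (funext fun p => ?_ : (Prod.snd ∘ fun z : Euc n × Euc n => (z.1, z.1 + z.2))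
        = fun p : Euc n × Euc n => p.2 + p.1) ▸ h2
      simp [add_comm]
    exact (aestronglyMeasurable_ind hE).comp_quasiMeasurePreserving hq
  · exact (aestronglyMeasurable_ind hE).comp_snd

lemma IsPolar.lintegral_lintegral_translate_le (hp : IsPolar E μ f)
    (hE : NullMeasurableSet E volume) (x : Euc n) (ρ s : ℝ) :
    ∫⁻ h in Metric.ball (0 : Euc n) s, ∫⁻ z in Metric.ball x ρ, ‖ind E (z + h) - ind E z‖ₑ
      ≤ ENNReal.ofReal s * μ (Metric.ball x (ρ + s)) * volume (Metric.ball (0 : Euc n) s) := by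
  calc _ ≤ ∫⁻ h in Metric.ball (0 : Euc n) s, ENNReal.ofReal s * μ (Metric.ball x (ρ + s)) := by
        refine setLIntegral_mono' measurableSet_ball fun h hh => ?_
        have hh' := mem_ball_zero_iff.1 hh
        refine (hp.lintegral_translate_le hE x h (R := ρ + s) (by linarith)).trans ?_
        gcongr
        rw [← ofReal_norm]
        exact ENNReal.ofReal_le_ofReal hh'.le
    _ = _ := by simp

/-- For `z ∈ E`, every displacement `h` with `z + h ∉ E` contributes one to the inner integral, and
these displacements fill a translate of `B_s(z) \ E`. -/
lemma lintegral_lintegral_translate_ge (hE : NullMeasurableSet E volume) (x : Euc n) (ρ s : ℝ)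
    {S : Set (Euc n)} (hS : S ⊆ Metric.ball x ρ) (hSm : NullMeasurableSet S volume) (hSE : S ⊆ E)
    {c : ℝ≥0∞} (hc : ∀ z ∈ S, c ≤ volume (Metric.ball z s \ E)) :
    c * volume S ≤
      ∫⁻ h in Metric.ball (0 : Euc n) s, ∫⁻ z in Metric.ball x ρ, ‖ind E (z + h) - ind E z‖ₑ := by
  have hmeas : AEMeasurable (fun p : Euc n × Euc n => ‖ind E (p.2 + p.1) - ind E p.2‖ₑ)
      ((volume.restrict (Metric.ball 0 s)).prod (volume.restrict (Metric.ball x ρ))) := by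
    rw [Measure.prod_restrict]
    refine AEMeasurable.restrict ?_
    exact aemeasurable_enorm_ind_translate hE
  rw [lintegral_lintegral_swap hmeas]
  calc c * volume S = ∫⁻ z in S, c := by simp
    _ ≤ ∫⁻ z in S, ∫⁻ h in Metric.ball (0 : Euc n) s, ‖ind E (z + h) - ind E z‖ₑ := by
        refine lintegral_mono_ae ?_
        filter_upwards [ae_restrict_mem₀ hSm] with z hz
        refine (hc z hz).trans ?_
        have hpre : (fun h => z + h) ⁻¹' (Metric.ball z s \ E)
            = Metric.ball 0 s \ ((fun h => z + h) ⁻¹' E) := by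
          ext h; simp
        rw [← measure_preimage_add volume z, hpre]
        have hm : NullMeasurableSet ((fun h => z + h) ⁻¹' E) volume :=
          hE.preimage (measurePreserving_add_left volume z).quasiMeasurePreserving
        rw [← lintegral_indicator_one₀ (measurableSet_ball.nullMeasurableSet.diff hm),
          ← lintegral_indicator measurableSet_ball]
        refine lintegral_mono fun h => ?_
        by_cases hh : h ∈ Metric.ball (0 : Euc n) s
        · by_cases hE' : z + h ∈ E
          · rw [indicator_of_notMem (fun H => H.2 hE')]; exact zero_le
          · rw [indicator_of_mem (show h ∈ Metric.ball 0 s \ ((fun h => z + h) ⁻¹' E) from ⟨hh, hE'⟩),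
              indicator_of_mem hh]
            simp [ind, hE', hSE hz]
        · rw [indicator_of_notMem (fun H => hh H.1)]; exact zero_le
    _ ≤ _ := lintegral_mono_set hS

end Density

/-! ### Isoperimetric inequalities and density estimates -/

section Density

variable {E : Set (Euc n)} {μ : Measure (Euc n)} {f : Euc n → Euc n} {x ν : Euc n} {r₀ : ℝ}

/-- Local isoperimetric inequality at the scale determined by the volume. -/
lemma IsPolar.volume_ball_le (hp : IsPolar E μ f) (hE : NullMeasurableSet E volume) (x : Euc n)
    {ρ s : ℝ} (hs : 0 < s)
    (hsmall : volume.real (E ∩ Metric.ball x (ρ + s)) ≤ volume.real (Metric.ball (0 : Euc n) s) / 2) :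
    volume.real (E ∩ Metric.ball x ρ) ≤ 2 * s * μ.real (Metric.ball x (ρ + s)) := by
  have := hp.finite
  have hVpos : 0 < volume.real (Metric.ball (0 : Euc n) s) := by
    rw [volume_real_ball _ hs]; have := unitVol_pos (n := n); positivity
  have hSfin : volume (E ∩ Metric.ball x ρ) ≠ ⊤ :=
    ((measure_mono inter_subset_right).trans_lt measure_ball_lt_top).ne
  -- Around each point of `E ∩ B_ρ`, the set `E` fills at most half of the ball of radius `s`; the
  -- other half serves as the constant `c`.
  have h1 := lintegral_lintegral_translate_ge hE x ρ s (S := E ∩ Metric.ball x ρ) inter_subset_right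
    (hE.inter measurableSet_ball.nullMeasurableSet) inter_subset_left
    (c := ENNReal.ofReal (volume.real (Metric.ball (0 : Euc n) s) / 2)) (fun z hz => by
      have hsub : Metric.ball z s ⊆ Metric.ball x (ρ + s) :=
        Metric.ball_subset_ball' (by have := Metric.mem_ball.1 hz.2; linarith)
      have hd : Metric.ball z s \ E = Metric.ball z s \ (E ∩ Metric.ball x (ρ + s)) := by
        ext w
        constructor
        · exact fun hw => ⟨hw.1, fun H => hw.2 H.1⟩
        · exact fun hw => ⟨hw.1, fun H => hw.2 ⟨H, hsub hw.1⟩⟩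
      rw [hd]
      refine le_trans ?_ (le_measure_sdiff)
      have hfin : volume (E ∩ Metric.ball x (ρ + s)) ≠ ⊤ :=
        ((measure_mono inter_subset_right).trans_lt measure_ball_lt_top).ne
      have hb : volume (Metric.ball z s) = ENNReal.ofReal (volume.real (Metric.ball (0 : Euc n) s)) := by
        rw [ofReal_measureReal measure_ball_lt_top.ne, Measure.addHaar_ball_center]
      rw [hb, ← ofReal_measureReal hfin, ← ENNReal.ofReal_sub _ measureReal_nonneg]
      refine ENNReal.ofReal_le_ofReal ?_
      linarith)
  have h2 := h1.trans (hp.lintegral_lintegral_translate_le hE x ρ s)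
  have h3 := ENNReal.toReal_mono (by finiteness) h2
  simp only [ENNReal.toReal_mul] at h3
  rw [ENNReal.toReal_ofReal (by positivity), ENNReal.toReal_ofReal hs.le] at h3
  change volume.real (Metric.ball (0 : Euc n) s) / 2 * volume.real (E ∩ Metric.ball x ρ) ≤
    s * μ.real (Metric.ball x (ρ + s)) * volume.real (Metric.ball (0 : Euc n) s) at h3
  nlinarith

/-- Relative isoperimetric (Poincaré) inequality in a ball. -/
lemma IsPolar.volume_mul_volume_le (hp : IsPolar E μ f) (hE : NullMeasurableSet E volume)
    (x : Euc n) {r : ℝ} (hr : 0 < r) :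
    volume.real (Metric.ball x r \ E) * volume.real (E ∩ Metric.ball x r)
      ≤ 2 * r * μ.real (Metric.ball x (3 * r)) * volume.real (Metric.ball (0 : Euc n) (2 * r)) := by
  have := hp.finite
  -- Displacements of length below `2r` lead from any point of `B_r(x)` to every other one.
  have h1 := lintegral_lintegral_translate_ge hE x r (2 * r) (S := E ∩ Metric.ball x r)
    inter_subset_right
    (hE.inter measurableSet_ball.nullMeasurableSet) inter_subset_left
    (c := volume (Metric.ball x r \ E)) (fun z hz => by
      refine measure_mono (sdiff_subset_sdiff_left (Metric.ball_subset_ball' ?_))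
      have := Metric.mem_ball.1 hz.2
      rw [dist_comm] at this
      linarith)
  have h2 := h1.trans (hp.lintegral_lintegral_translate_le hE x r (2 * r))
  rw [show r + 2 * r = 3 * r by ring] at h2
  have h3 := ENNReal.toReal_mono (by finiteness) h2
  simp only [ENNReal.toReal_mul] at h3
  rwa [ENNReal.toReal_ofReal (by positivity)] at h3

/-- A De Giorgi type iteration. When `y` halves between `r` and `ρ`, the hypothesis gives `r - ρ ≤
2ⁿ C y(r)`. Along successive halvings these lengths form a geometric series of sum `2ⁿ⁺¹ C y(R)`. If
`R` were larger, `y` would vanish at a positive radius. -/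
lemma le_mul_of_halving {y : ℝ → ℝ} {R C : ℝ} (hR : 0 < R) (hC : 0 < C)
    (hcont : ContinuousOn y (Icc 0 R)) (hmono : MonotoneOn y (Icc 0 R)) (h0 : y 0 = 0)
    (hpos : ∀ r, 0 < r → r ≤ R → 0 < y r)
    (h : ∀ ρ r, 0 < ρ → ρ < r → r ≤ R → y ρ ^ n * (r - ρ) ≤ C * y r ^ (n + 1)) :
    R ≤ 2 ^ (n + 1) * C * y R := by
  by_contra hcon
  push Not at hcon
  set D := 2 ^ (n + 1) * C with hD
  -- Since `D / 2 = 2ⁿ C`, the length bound reads `r - ρ ≤ D (y r - y ρ)`: the quantity `r - D y(r)`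
  -- never decreases along the halvings.
  have step : ∀ k : ℕ, ∃ ρ, 0 < ρ ∧ ρ ≤ R ∧ y ρ = y R / 2 ^ k ∧ R - D * y R ≤ ρ - D * y ρ := by
    intro k
    induction k with
    | zero => exact ⟨R, hR, le_rfl, by simp, le_rfl⟩
    | succ k ih =>
      obtain ⟨r, hr0, hrR, hyr, hg⟩ := ih
      have hyp := hpos r hr0 hrR
      have hmem : y r / 2 ∈ Icc (y 0) (y r) := by
        rw [h0]; exact ⟨by positivity, by linarith⟩
      obtain ⟨ρ, hρ, hyρ⟩ := intermediate_value_Icc hr0.le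
        (hcont.mono (Icc_subset_Icc_right hrR)) hmem
      have hρ0 : 0 < ρ := by
        rcases hρ.1.eq_or_lt with e | e
        · rw [← e, h0] at hyρ; linarith
        · exact e
      have hρr : ρ < r := by
        rcases hρ.2.eq_or_lt with e | e
        · rw [e] at hyρ; linarith
        · exact e
      refine ⟨ρ, hρ0, hρr.le.trans hrR, by rw [hyρ, hyr, pow_succ]; field_simp, ?_⟩
      have h1 := h ρ r hρ0 hρr hrR
      rw [hyρ, div_pow, pow_succ] at h1
      have hyn : 0 < y r ^ n := by positivity
      have h2 : r - ρ ≤ 2 ^ n * C * y r := by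
        have : y r ^ n / 2 ^ n * (r - ρ) ≤ y r ^ n / 2 ^ n * (2 ^ n * C * y r) := by
          calc _ ≤ _ := h1
            _ = _ := by field_simp
        exact le_of_mul_le_mul_left this (by positivity)
      have h3 : D = 2 * (2 ^ n * C) := by rw [hD, pow_succ]; ring
      rw [hyρ]
      nlinarith
  -- All radii of the sequence stay above `a > 0`, so monotonicity bounds `y a` by `y R / 2ᵏ` for
  -- every `k`.
  set a := R - D * y R with ha
  have ha0 : 0 < a := by linarith
  have hDpos : 0 < D := by positivity
  have haR : a ≤ R := by have := hpos R hR le_rfl; nlinarith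
  have hya := hpos a ha0 haR
  have hle : ∀ k : ℕ, y a ≤ y R * (1 / 2) ^ k := by
    intro k
    obtain ⟨ρ, hρ0, hρR, hyρ, hg⟩ := step k
    have hyρ0 := hpos ρ hρ0 hρR
    have : a ≤ ρ := by nlinarith
    calc y a ≤ y ρ := hmono ⟨ha0.le, haR⟩ ⟨hρ0.le, hρR⟩ this
      _ = _ := by rw [hyρ, one_div, inv_pow]; rfl
  have hlim : Tendsto (fun k : ℕ => y R * (1 / 2 : ℝ) ^ k) atTop (𝓝 (y R * 0)) :=
    (tendsto_pow_atTop_nhds_zero_of_lt_one (by norm_num) (by norm_num)).const_mul _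
  rw [mul_zero] at hlim
  have := ge_of_tendsto' hlim hle
  linarith

/-- Increments are dominated by those of the full ball volume `ω rⁿ`; `n ≠ 0` makes this formula
valid at radius zero too. -/
lemma continuousOn_volume_inter_ball (E : Set (Euc n)) (x : Euc n) (R : ℝ) (hn : n ≠ 0) :
    ContinuousOn (fun r => volume.real (E ∩ Metric.ball x r)) (Icc 0 R) := by
  have hball : ∀ r, 0 ≤ r → volume.real (Metric.ball x r) = r ^ n * unitVol n := by
    intro r hr
    rcases hr.eq_or_lt with rfl | hr
    · simp [hn]
    · exact volume_real_ball x hr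
  have key : ∀ ρ r, 0 ≤ ρ → ρ ≤ r → |volume.real (E ∩ Metric.ball x r) -
      volume.real (E ∩ Metric.ball x ρ)| ≤ |r ^ n * unitVol n - ρ ^ n * unitVol n| := by
    intro ρ r h0 h
    have hsub : Metric.ball x ρ ⊆ Metric.ball x r := Metric.ball_subset_ball h
    have hfin : volume (E ∩ Metric.ball x r) ≠ ⊤ :=
      ((measure_mono inter_subset_right).trans_lt measure_ball_lt_top).ne
    have h1 : volume.real (E ∩ Metric.ball x ρ) ≤ volume.real (E ∩ Metric.ball x r) :=
      measureReal_mono (inter_subset_inter_right _ hsub) hfin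
    have h2 : volume.real (E ∩ Metric.ball x r) ≤ volume.real (E ∩ Metric.ball x ρ)
        + volume.real (Metric.ball x r \ Metric.ball x ρ) := by
      refine (measureReal_mono ?_ ?_).trans (measureReal_union_le _ _)
      · intro z hz
        by_cases hz' : z ∈ Metric.ball x ρ
        · exact Or.inl ⟨hz.1, hz'⟩
        · exact Or.inr ⟨hz.2, hz'⟩
      · exact ((measure_mono (union_subset (inter_subset_right.trans hsub)
          sdiff_subset)).trans_lt measure_ball_lt_top).ne
    rw [measureReal_sdiff hsub measurableSet_ball measure_ball_lt_top.ne, hball r (h0.trans h),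
      hball ρ h0] at h2
    rw [abs_of_nonneg (by linarith)]
    refine le_trans ?_ (le_abs_self _)
    linarith
  have hu : Continuous fun r : ℝ => r ^ n * unitVol n := by fun_prop
  rw [Metric.continuousOn_iff]
  intro r hr ε hε
  obtain ⟨δ, hδ, h⟩ := Metric.continuous_iff.1 hu r ε hε
  refine ⟨δ, hδ, fun ρ hρ hd => (le_trans ?_ (h ρ hd).le).lt_of_ne ?_⟩
  · rw [Real.dist_eq, Real.dist_eq]
    rcases le_total ρ r with hle | hle
    · rw [abs_sub_comm, abs_sub_comm (ρ ^ n * unitVol n)]; exact key ρ r hρ.1 hle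
    · exact key r ρ hr.1 hle
  · refine (lt_of_le_of_lt ?_ (h ρ hd)).ne
    rw [Real.dist_eq, Real.dist_eq]
    rcases le_total ρ r with hle | hle
    · rw [abs_sub_comm, abs_sub_comm (ρ ^ n * unitVol n)]; exact key ρ r hρ.1 hle
    · exact key r ρ hr.1 hle

/-- `(2 / ω)^{1/n}`. -/
noncomputable def isoConst (n : ℕ) : ℝ := (2 / unitVol n) ^ ((n : ℝ)⁻¹)

lemma isoConst_pos : 0 < isoConst n := Real.rpow_pos_of_pos (div_pos two_pos unitVol_pos) _

/-- The constant in the lower volume density estimate. -/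
noncomputable def densConst (n : ℕ) : ℝ :=
  2 ^ (n + 1) * ((16 * transitionBound + 2) * isoConst n)

lemma densConst_pos : 0 < densConst n := by
  have := transitionBound_pos
  have := isoConst_pos (n := n)
  unfold densConst
  positivity

/-- Lower volume density at points of the reduced boundary. -/
lemma IsPolar.pow_le_volume (hn : n ≠ 0) (hp : IsPolar E μ f) (hE : NullMeasurableSet E volume)
    (hg : IsGoodPoint μ f x ν r₀) {R : ℝ} (hR0 : 0 < R) (hR : R < r₀) :
    R ^ n ≤ densConst n ^ n * volume.real (E ∩ Metric.ball x R) := by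
  have := hp.finite
  set m : ℝ → ℝ := fun r => volume.real (E ∩ Metric.ball x r) with hm
  have hm0 : ∀ r, 0 ≤ m r := fun r => measureReal_nonneg
  -- The `n`-th root of the volume scales like a length, which is the form the halving argument
  -- needs.
  set y : ℝ → ℝ := fun r => m r ^ ((n : ℝ)⁻¹) with hy
  have hyn : ∀ r, y r ^ n = m r := fun r => Real.rpow_inv_natCast_pow (hm0 r) hn
  have hy0 : ∀ r, 0 ≤ y r := fun r => Real.rpow_nonneg (hm0 r) _
  have hmmono : Monotone m := fun a b hab => by
    refine measureReal_mono (inter_subset_inter_right _ (Metric.ball_subset_ball hab)) ?_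
    exact ((measure_mono inter_subset_right).trans_lt measure_ball_lt_top).ne
  have hT := transitionBound_pos
  have hκ := isoConst_pos (n := n)
  -- The half ball carries positive perimeter, and this is bounded by a multiple of the volume of
  -- `E` in the ball.
  have hmpos : ∀ r, 0 < r → r ≤ R → 0 < m r := by
    intro r h0 hr
    have h1 := hp.measure_ball_le_volume hE hg (half_pos h0) (half_lt_self h0) (hr.trans_lt hR)
    have h2 := hg.measure_pos (r / 2) (half_pos h0) (by linarith)
    by_contra hcon
    have : m r = 0 := le_antisymm (not_lt.1 hcon) (hm0 r)
    rw [show volume.real (E ∩ Metric.ball x r) = m r from rfl, this, mul_zero] at h1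
    linarith
  have key : R ≤ 2 ^ (n + 1) * ((16 * transitionBound + 2) * isoConst n) * y R := by
    refine le_mul_of_halving (n := n) hR0 (by positivity) ?_ ?_ ?_ ?_ ?_
    · exact (continuousOn_volume_inter_ball E x R hn).rpow_const fun _ _ => Or.inr (by positivity)
    · exact fun a _ b _ hab => Real.rpow_le_rpow (hm0 a) (hmmono hab) (by positivity)
    · simp only [hy, hm, Metric.ball_zero, inter_empty, measureReal_empty]
      exact Real.zero_rpow (by simpa using hn)
    · exact fun r h0 hr => Real.rpow_pos_of_pos (hmpos r h0 hr) _
    · intro ρ r hρ hρr hr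
      -- Chosen so that `|B_s| = 2 m(r)`, the threshold at which `IsPolar.volume_ball_le` applies.
      set s := isoConst n * y r with hs
      have hyr : 0 < y r := Real.rpow_pos_of_pos (hmpos r (hρ.trans hρr) hr) _
      have hspos : 0 < s := by positivity
      have hV : volume.real (Metric.ball (0 : Euc n) s) / 2 = m r := by
        rw [volume_real_ball _ hspos, hs, mul_pow, hyn, isoConst,
          Real.rpow_inv_natCast_pow (div_pos two_pos unitVol_pos).le hn]
        have := (unitVol_pos (n := n)).ne'
        field_simp
      rw [hyn]
      have hle : m ρ ≤ m r := hmmono hρr.le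
      have e1 : (16 * transitionBound + 2) * isoConst n * y r ^ (n + 1)
          = (16 * transitionBound + 2) * s * m r := by
        rw [pow_succ, hyn, hs]; ring
      rw [e1]
      -- If `s` fits into half the gap, that half is spent on the isoperimetric inequality and the
      -- other half on bounding perimeter by volume, which gives `16 * transitionBound`. Otherwise
      -- `r - ρ < 2s` and monotonicity of `m` suffices, which gives the `2`.
      rcases le_or_gt s ((r - ρ) / 2) with hcase | hcase
      · have hsub : m (ρ + s) ≤ m r := hmmono (by linarith)
        have h1 := hp.volume_ball_le hE x (ρ := ρ) hspos (by rw [hV]; exact hsub)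
        have h2 : μ.real (Metric.ball x (ρ + s)) ≤ μ.real (Metric.ball x ((ρ + r) / 2)) :=
          measureReal_mono (Metric.ball_subset_ball (by linarith))
        have h3 := hp.measure_ball_le_volume hE hg (ρ := (ρ + r) / 2) (R := r) (by linarith)
          (by linarith) (by linarith)
        have h4 : m ρ ≤ 2 * s * (4 * transitionBound / (r - (ρ + r) / 2) * m r) := by
          refine h1.trans ?_
          gcongr
          exact h2.trans h3
        have h5 : r - (ρ + r) / 2 = (r - ρ) / 2 := by ring
        rw [h5] at h4
        have hd : 0 < r - ρ := by linarith
        calc m ρ * (r - ρ) ≤ 2 * s * (4 * transitionBound / ((r - ρ) / 2) * m r) * (r - ρ) := by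
              gcongr
          _ = 16 * transitionBound * s * m r := by field_simp; ring
          _ ≤ _ := by
            have := mul_nonneg hspos.le (hm0 r)
            nlinarith
      · have hd : 0 < r - ρ := by linarith
        calc m ρ * (r - ρ) ≤ m r * (2 * s) := by
              have := hm0 r
              gcongr
              linarith
          _ ≤ _ := by
            have := mul_nonneg hspos.le (hm0 r)
            nlinarith
  calc R ^ n ≤ (densConst n * y R) ^ n := by
        gcongr
        exact key
    _ = _ := by rw [mul_pow, hyn]

/-- Upper density of the perimeter at points of the reduced boundary. -/
lemma IsPolar.measure_ball_le_pow (hp : IsPolar E μ f) (hE : NullMeasurableSet E volume)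
    (hg : IsGoodPoint μ f x ν r₀) {r : ℝ} (hr0 : 0 < r) (hr : 2 * r < r₀) :
    r * μ.real (Metric.ball x r) ≤ 4 * transitionBound * 2 ^ n * unitVol n * r ^ n := by
  have h1 := hp.measure_ball_le_volume hE hg hr0 (show r < 2 * r by linarith) hr
  have h2 : volume.real (E ∩ Metric.ball x (2 * r)) ≤ (2 * r) ^ n * unitVol n := by
    rw [← volume_real_ball x (by linarith)]
    exact measureReal_mono inter_subset_right measure_ball_lt_top.ne
  rw [show 2 * r - r = r by ring] at h1
  have hT := transitionBound_pos
  calc r * μ.real (Metric.ball x r)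
      ≤ r * (4 * transitionBound / r * ((2 * r) ^ n * unitVol n)) := by
        gcongr
        exact h1.trans (by gcongr)
    _ = _ := by rw [mul_pow]; field_simp

/-- The constant in the lower density estimate for the perimeter. -/
noncomputable def lowerConst (n : ℕ) : ℝ := 2 * 2 ^ n * unitVol n * densConst n ^ (2 * n) * 3 ^ n

lemma lowerConst_pos : 0 < lowerConst n := by
  have := densConst_pos (n := n)
  have := unitVol_pos (n := n)
  unfold lowerConst
  positivity

/-- Lower density of the perimeter at points of the reduced boundary. -/
lemma IsPolar.pow_le_measure_ball (hn : n ≠ 0) (hp : IsPolar E μ f)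
    (hE : NullMeasurableSet E volume)
    (hg : IsGoodPoint μ f x ν r₀) {r : ℝ} (hr0 : 0 < r) (hr : r < r₀) :
    r ^ n ≤ lowerConst n * (r * μ.real (Metric.ball x r)) := by
  -- The relative isoperimetric inequality on a ball sees the perimeter in a ball three times as
  -- large.
  set s := r / 3 with hs
  have hs0 : 0 < s := by positivity
  have hsr : s < r₀ := by linarith
  have h1 := hp.pow_le_volume hn hE hg hs0 hsr
  -- The complement has the opposite normal at the same good point, so both `E` and its complement
  -- have positive volume density.
  have h2 := (hp.compl hE).pow_le_volume hn hE.compl hg.neg hs0 hsr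
  have h3 := hp.volume_mul_volume_le hE x hs0
  rw [show (3 * s) = r by rw [hs]; ring, volume_real_ball _ (by positivity)] at h3
  rw [show Eᶜ ∩ Metric.ball x s = Metric.ball x s \ E by ext; simp [and_comm]] at h2
  have hD := densConst_pos (n := n)
  have hm0 : 0 ≤ μ.real (Metric.ball x r) := measureReal_nonneg
  have h4 : s ^ n * s ^ n ≤ (densConst n ^ n) ^ 2 * (2 * s * μ.real (Metric.ball x r) * ((2 * s) ^ n * unitVol n)) := by
    calc s ^ n * s ^ n ≤ (densConst n ^ n * volume.real (Metric.ball x s \ E)) *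
          (densConst n ^ n * volume.real (E ∩ Metric.ball x s)) := by gcongr
      _ = (densConst n ^ n) ^ 2 * (volume.real (Metric.ball x s \ E) * volume.real (E ∩ Metric.ball x s)) := by ring
      _ ≤ _ := by gcongr
  have h5 : s ^ n ≤ (densConst n ^ n) ^ 2 * (2 * s * μ.real (Metric.ball x r) * (2 ^ n * unitVol n)) := by
    have hsn : 0 < s ^ n := by positivity
    refine le_of_mul_le_mul_left (h4.trans_eq ?_) hsn
    rw [mul_pow]; ring
  have hω := unitVol_pos (n := n)
  have h6 : r ^ n = 3 ^ n * s ^ n := by rw [← mul_pow, hs]; congr 1; ring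
  rw [h6]
  calc 3 ^ n * s ^ n ≤ 3 ^ n * ((densConst n ^ n) ^ 2 * (2 * s * μ.real (Metric.ball x r) * (2 ^ n * unitVol n))) := by gcongr
    _ = lowerConst n * (s * μ.real (Metric.ball x r)) := by unfold lowerConst; ring
    _ ≤ _ := by
      have := (lowerConst_pos (n := n)).le
      gcongr
      rw [hs]; linarith

end Density

/-! ### Oscillation of the normal, doubling, and concentration on the reduced boundary -/

section ReducedBoundary

variable {E : Set (Euc n)} {μ : Measure (Euc n)} {f : Euc n → Euc n} {x ν : Euc n} {r₀ : ℝ}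

lemma outerNormal_eq (ht : Tendsto (normalRatio E x) (𝓝[>] 0) (𝓝 ν)) : outerNormal E x = ν :=
  ht.limUnder_eq

/-- Near a point of the reduced boundary the density is close to the normal in mean. -/
lemma IsPolar.eventually_integral_norm_sub_le (hp : IsPolar E μ f) (hν : ‖ν‖ = 1)
    (ht : Tendsto (normalRatio E x) (𝓝[>] 0) (𝓝 ν)) {ε : ℝ} (hε : 0 < ε) :
    ∀ᶠ r in 𝓝[>] (0 : ℝ), ∫ y in Metric.ball x r, ‖f y - ν‖ ∂μ ≤ ε * μ.real (Metric.ball x r) := by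
  have := hp.finite
  have hfi := hp.integrable
  obtain ⟨r₀, hg⟩ := hp.exists_isGoodPoint hν ht
  have h1 : Tendsto (fun r => inner ℝ ν (normalRatio E x r)) (𝓝[>] 0) (𝓝 1) := by
    have := (tendsto_const_nhds (x := ν)).inner (𝕜 := ℝ) ht
    rwa [real_inner_self_eq_norm_sq, hν, one_pow] at this
  have h2 := h1.eventually (lt_mem_nhds (show 1 - ε ^ 2 / 2 < 1 by have := pow_pos hε 2; linarith))
  filter_upwards [h2, Ioo_mem_nhdsGT hg.pos] with r hr hr0
  have hm := hg.measure_pos r hr0.1 hr0.2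
  simp only [hp.normalRatio_eq, inner_smul_right] at hr
  rw [inv_mul_eq_div, lt_div_iff₀ hm] at hr
  have hfi' : Integrable f (μ.restrict (Metric.ball x r)) := hfi.restrict
  -- For unit vectors `‖f - ν‖² = 2(1 - ⟨ν, f⟩)`. Young's inequality with weight `ε` turns the
  -- square root into a linear expression, whose mean is controlled by the normal ratio.
  have h3 : ∫ y in Metric.ball x r, ‖f y - ν‖ ∂μ
      ≤ ∫ y in Metric.ball x r, (ε / 2 + (1 - inner ℝ ν (f y)) / ε) ∂μ := by
    refine integral_mono_ae (hfi'.sub (integrable_const ν)).norm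
      ((integrable_const _).add (((integrable_const _).sub (hfi'.const_inner ν)).div_const _)) ?_
    filter_upwards [ae_restrict_of_ae hp.norm_eq_one] with y hy
    have e : ‖f y - ν‖ ^ 2 = 2 * (1 - inner ℝ ν (f y)) := by
      rw [@norm_sub_sq_real, hy, hν, real_inner_comm]; ring
    have : ε * ‖f y - ν‖ ≤ ε * (ε / 2 + (1 - inner ℝ ν (f y)) / ε) := by
      rw [mul_add, mul_div_cancel₀ _ hε.ne']
      nlinarith [sq_nonneg (‖f y - ν‖ - ε)]
    exact le_of_mul_le_mul_left this hε
  refine h3.trans ?_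
  rw [integral_add (integrable_const _) (((integrable_const _).sub (hfi'.const_inner ν)).div_const _),
    integral_div, integral_div, integral_sub (integrable_const _) (hfi'.const_inner ν), integral_inner hfi']
  simp only [integral_const, measureReal_restrict_apply_univ, smul_eq_mul, mul_one]
  set M := μ.real (Metric.ball x r)
  set I := inner ℝ ν (∫ y in Metric.ball x r, f y ∂μ)
  have h4 : (M - I) / ε ≤ ε / 2 * M := by
    rw [div_le_iff₀ hε]; nlinarith
  linarith

/-- Doubling at points of the reduced boundary. -/
lemma IsPolar.exists_doubling (hn : n ≠ 0) (hp : IsPolar E μ f) (hE : NullMeasurableSet E volume)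
    (hν : ‖ν‖ = 1) (ht : Tendsto (normalRatio E x) (𝓝[>] 0) (𝓝 ν)) :
    ∃ C > 0, ∀ᶠ r in 𝓝[>] (0 : ℝ),
      μ.real (Metric.ball x (2 * r)) ≤ C * μ.real (Metric.ball x (r / 2)) := by
  obtain ⟨r₀, hg⟩ := hp.exists_isGoodPoint hν ht
  have hT := transitionBound_pos
  have hω := unitVol_pos (n := n)
  have hL := lowerConst_pos (n := n)
  refine ⟨4 * transitionBound * 2 ^ n * unitVol n * (4 ^ n * lowerConst n), by positivity, ?_⟩
  have hpos : 0 < r₀ / 4 := by have := hg.pos; positivity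
  filter_upwards [Ioo_mem_nhdsGT hpos] with r hr
  have h0 := hr.1
  have h1 := hp.measure_ball_le_pow hE hg (r := 2 * r) (by linarith) (by linarith [hr.2])
  have h2 := hp.pow_le_measure_ball hn hE hg (r := r / 2) (by linarith) (by linarith [hr.2])
  have h3 : (2 * r) ^ n = 4 ^ n * (r / 2) ^ n := by rw [← mul_pow]; congr 1; ring
  rw [h3] at h1
  have h4 : 2 * r * μ.real (Metric.ball x (2 * r)) ≤ 2 * r *
      (4 * transitionBound * 2 ^ n * unitVol n * (4 ^ n * lowerConst n)
        * μ.real (Metric.ball x (r / 2))) := by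
    have hm : 0 ≤ μ.real (Metric.ball x (r / 2)) := measureReal_nonneg
    calc _ ≤ 4 * transitionBound * 2 ^ n * unitVol n * (4 ^ n *
          (lowerConst n * (r / 2 * μ.real (Metric.ball x (r / 2))))) := h1.trans (by gcongr)
      _ = (r / 2) * (4 * transitionBound * 2 ^ n * unitVol n * (4 ^ n * lowerConst n)
        * μ.real (Metric.ball x (r / 2))) := by ring
      _ ≤ _ := by gcongr; linarith
  exact le_of_mul_le_mul_left h4 (by linarith)

/-- An open ball is exhausted by concentric balls of smaller radii, open or closed. This serves both
to pass from closed to open balls and to restrict to rational radii. -/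
lemma tendsto_setIntegral_ball_left {V : Type*} [NormedAddCommGroup V] [NormedSpace ℝ V]
    {μ : Measure (Euc n)} [IsFiniteMeasure μ] {g : Euc n → V} (hg : Integrable g μ) (x : Euc n)
    {r : ℝ} {u : ℕ → ℝ} (hu : Tendsto u atTop (𝓝 r)) (hlt : ∀ k, u k < r) (S : ℝ → Set (Euc n))
    (hS : ∀ s, MeasurableSet (S s)) (hS1 : ∀ s, Metric.ball x s ⊆ S s)
    (hS2 : ∀ s, S s ⊆ Metric.closedBall x s) :
    Tendsto (fun k => ∫ y in S (u k), g y ∂μ) atTop (𝓝 (∫ y in Metric.ball x r, g y ∂μ)) := by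
  simp_rw [← integral_indicator (hS _), ← integral_indicator (measurableSet_ball (x := x) (ε := r))]
  refine tendsto_integral_of_dominated_convergence (fun y => ‖g y‖)
    (fun k => (hg.indicator (hS _)).aestronglyMeasurable) hg.norm
    (fun k => Eventually.of_forall fun y => norm_indicator_le_norm_self _ _)
    (Eventually.of_forall fun y => ?_)
  by_cases hy : y ∈ Metric.ball x r
  · refine tendsto_const_nhds.congr' ?_
    filter_upwards [hu.eventually (lt_mem_nhds (Metric.mem_ball.1 hy))] with k hk
    rw [indicator_of_mem hy, indicator_of_mem (hS1 _ (Metric.mem_ball.2 hk))]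
  · refine tendsto_const_nhds.congr fun k => ?_
    rw [indicator_of_notMem hy, indicator_of_notMem]
    exact fun H => hy (Metric.closedBall_subset_ball (hlt k) (hS2 _ H))

lemma setIntegral_one_eq {μ : Measure (Euc n)} (S : Set (Euc n)) :
    ∫ _ in S, (1 : ℝ) ∂μ = μ.real S := by simp

/-- Almost every point with respect to the perimeter measure is in the reduced boundary. -/
lemma IsPolar.ae_mem_reducedBoundary (hp : IsPolar E μ f) : ∀ᵐ x ∂μ, x ∈ reducedBoundary E := by
  have := hp.finite
  have hfi := hp.integrable
  filter_upwards [(Besicovitch.vitaliFamily μ).ae_tendsto_average hfi.locallyIntegrable,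
    hp.norm_eq_one] with x hx hx1
  refine ⟨f x, hx1, ?_⟩
  have h1 := hx.comp (Besicovitch.tendsto_filterAt μ x)
  rw [Metric.tendsto_nhds]
  intro ε hε
  -- The average over a set of zero mass is zero, at distance one from `f x`; the tolerance `1/2`
  -- therefore guarantees positive mass.
  have h2 := (Metric.tendsto_nhds.1 h1) (min (ε / 2) (1 / 2)) (by positivity)
  obtain ⟨δ, hδ, hδ'⟩ := mem_nhdsGT_iff_exists_Ioo_subset.1 h2
  filter_upwards [Ioo_mem_nhdsGT hδ] with r hr
  have hcb : ∀ s ∈ Ioo (0 : ℝ) δ, 0 < μ.real (Metric.closedBall x s) ∧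
      ‖(∫ y in Metric.closedBall x s, f y ∂μ) - μ.real (Metric.closedBall x s) • f x‖
        ≤ ε / 2 * μ.real (Metric.closedBall x s) := by
    intro s hs
    have h3 := hδ' hs
    simp only [mem_ofPred_eq, Function.comp, dist_eq_norm] at h3
    rw [setAverage_eq] at h3
    have hpos : 0 < μ.real (Metric.closedBall x s) := by
      rcases (measureReal_nonneg (μ := μ) (s := Metric.closedBall x s)).eq_or_lt with h | h
      · rw [← h, inv_zero, zero_smul, zero_sub, norm_neg, hx1] at h3
        have := h3.trans_le (min_le_right _ _)
        norm_num at this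
      · exact h
    refine ⟨hpos, ?_⟩
    have e : (∫ y in Metric.closedBall x s, f y ∂μ) - μ.real (Metric.closedBall x s) • f x
        = μ.real (Metric.closedBall x s) • ((μ.real (Metric.closedBall x s))⁻¹ •
          (∫ y in Metric.closedBall x s, f y ∂μ) - f x) := by
      rw [smul_sub, smul_inv_smul₀ hpos.ne']
    rw [e, norm_smul, Real.norm_of_nonneg hpos.le, mul_comm]
    gcongr
    exact (h3.trans_le (min_le_left _ _)).le
  -- Besicovitch differentiation gives averages over closed balls, the reduced boundary is defined
  -- with open ones. The latter are reached through closed balls of radii increasing to `r`.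
  have hu : Tendsto (fun k : ℕ => r - r / 2 / (k + 1)) atTop (𝓝 r) := by
    have := (tendsto_const_div_atTop_nhds_zero_nat (r / 2)).comp (tendsto_add_atTop_nat 1)
    have h4 := this.const_sub r
    rw [sub_zero] at h4
    refine h4.congr fun k => ?_
    simp
  have hr0 := hr.1
  have hlt : ∀ k : ℕ, r - r / 2 / (k + 1) < r := fun k => by
    have : 0 < r / 2 / ((k : ℝ) + 1) := by positivity
    linarith
  have hmem : ∀ k : ℕ, r - r / 2 / (k + 1) ∈ Ioo 0 δ := fun k => by
    have h5 : r / 2 / ((k : ℝ) + 1) ≤ r / 2 :=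
      div_le_self (by positivity) (by linarith [(Nat.cast_nonneg k : (0 : ℝ) ≤ k)])
    exact ⟨by linarith, (hlt k).trans hr.2⟩
  have hl1 := tendsto_setIntegral_ball_left hfi x hu hlt (Metric.closedBall x)
    (fun _ => measurableSet_closedBall) (fun _ => Metric.ball_subset_closedBall) (fun _ => le_rfl)
  have hl2 := tendsto_setIntegral_ball_left (integrable_const (μ := μ) (1 : ℝ)) x hu hlt
    (Metric.closedBall x)
    (fun _ => measurableSet_closedBall) (fun _ => Metric.ball_subset_closedBall) (fun _ => le_rfl)
  simp only [setIntegral_one_eq] at hl2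
  have hlim := le_of_tendsto_of_tendsto' (hl1.sub (hl2.smul_const (f x))).norm
    (hl2.const_mul (ε / 2)) (fun k => (hcb _ (hmem k)).2)
  have hpos : 0 < μ.real (Metric.ball x r) :=
    (hcb (r / 2) ⟨by positivity, by linarith [hr.2]⟩).1.trans_le
      (measureReal_mono (Metric.closedBall_subset_ball (by linarith)))
  rw [hp.normalRatio_eq, dist_eq_norm]
  have e : (μ.real (Metric.ball x r))⁻¹ • (∫ y in Metric.ball x r, f y ∂μ) - f x
      = (μ.real (Metric.ball x r))⁻¹ • ((∫ y in Metric.ball x r, f y ∂μ)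
        - μ.real (Metric.ball x r) • f x) := by
    rw [smul_sub, inv_smul_smul₀ hpos.ne']
  rw [e, norm_smul, norm_inv, Real.norm_of_nonneg hpos.le, inv_mul_eq_div, div_lt_iff₀ hpos]
  refine hlim.trans_lt ?_
  nlinarith

end ReducedBoundary

/-! ### Measurability of the reduced boundary -/

section Measurability

variable {E : Set (Euc n)} {μ : Measure (Euc n)} {f : Euc n → Euc n} {x ν : Euc n}

lemma measurable_setIntegral_ball {V : Type*} [NormedAddCommGroup V] [NormedSpace ℝ V]
    [MeasurableSpace V] [BorelSpace V]
    {μ : Measure (Euc n)} [IsFiniteMeasure μ] {g : Euc n → V} (hg : StronglyMeasurable g) (r : ℝ) :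
    Measurable fun x => ∫ y in Metric.ball x r, g y ∂μ := by
  simp_rw [← integral_indicator (measurableSet_ball (ε := r))]
  refine StronglyMeasurable.measurable ?_
  have hs : MeasurableSet {p : Euc n × Euc n | p.2 ∈ Metric.ball p.1 r} := by
    simp only [Metric.mem_ball]
    exact measurableSet_lt (by fun_prop) measurable_const
  have := ((hg.comp_measurable (measurable_snd (α := Euc n) (β := Euc n))).indicator hs)
  exact this.integral_prod_right' (ν := μ)

lemma IsPolar.measurable_normalRatio (hp : IsPolar E μ f) (r : ℝ) :
    Measurable fun x => normalRatio E x r := by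
  have := hp.finite
  simp_rw [hp.normalRatio_eq]
  have h := measurable_setIntegral_ball (μ := μ) (g := fun _ : Euc n => (1 : ℝ))
    stronglyMeasurable_const r
  simp only [setIntegral_one_eq] at h
  exact h.inv.smul (measurable_setIntegral_ball hp.measurable.stronglyMeasurable r)

lemma IsPolar.normalRatio_tendsto_left (hp : IsPolar E μ f) (x : Euc n) {r : ℝ} {u : ℕ → ℝ}
    (hu : Tendsto u atTop (𝓝 r)) (hlt : ∀ k, u k < r) :
    Tendsto (fun k => normalRatio E x (u k)) atTop (𝓝 (normalRatio E x r)) := by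
  have := hp.finite
  simp_rw [hp.normalRatio_eq]
  have hl1 := tendsto_setIntegral_ball_left hp.integrable x hu hlt (Metric.ball x)
    (fun _ => measurableSet_ball) (fun _ => le_rfl) (fun _ => Metric.ball_subset_closedBall)
  have hl2 := tendsto_setIntegral_ball_left (integrable_const (μ := μ) (1 : ℝ)) x hu hlt
    (Metric.ball x)
    (fun _ => measurableSet_ball) (fun _ => le_rfl) (fun _ => Metric.ball_subset_closedBall)
  simp only [setIntegral_one_eq] at hl2
  rcases eq_or_ne (μ.real (Metric.ball x r)) 0 with h | h
  · have hz : ∀ k, μ.real (Metric.ball x (u k)) = 0 := fun k =>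
      le_antisymm ((measureReal_mono (Metric.ball_subset_ball (hlt k).le)).trans h.le)
        measureReal_nonneg
    simp [h, hz]
  · exact (hl2.inv₀ h).smul hl1

/-- Limits of the normal ratio can be computed along rational radii. -/
lemma IsPolar.tendsto_normalRatio_iff (hp : IsPolar E μ f) (x ν : Euc n) :
    Tendsto (normalRatio E x) (𝓝[>] 0) (𝓝 ν) ↔
      Tendsto (fun q : ℚ => normalRatio E x q) (comap (fun q : ℚ => (q : ℝ)) (𝓝[>] 0)) (𝓝 ν) := by
  refine ⟨fun h => h.comp tendsto_comap, fun h => ?_⟩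
  rw [Metric.tendsto_nhds] at h ⊢
  intro ε hε
  have h1 := h (ε / 2) (half_pos hε)
  rw [eventually_comap] at h1
  obtain ⟨δ, hδ, hδ'⟩ := mem_nhdsGT_iff_exists_Ioo_subset.1 h1
  filter_upwards [Ioo_mem_nhdsGT hδ] with r hr
  obtain ⟨u, -, hu1, hu2⟩ := Real.exists_seq_rat_strictMono_tendsto r
  have hl := hp.normalRatio_tendsto_left x hu2 hu1
  have hev : ∀ᶠ k in atTop, dist (normalRatio E x (u k)) ν ≤ ε / 2 := by
    filter_upwards [hu2.eventually (lt_mem_nhds hr.1)] with k hk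
    exact (hδ' (show (u k : ℝ) ∈ Ioo 0 δ from ⟨hk, (hu1 k).trans hr.2⟩) (u k) rfl).le
  exact (le_of_tendsto (hl.dist tendsto_const_nhds) hev).trans_lt (half_lt_self hε)

/-- The normal ratio is left continuous in the radius, so its limit may be taken along the countable
set of rational radii, where existence of a limit is a measurable condition. -/
lemma IsPolar.measurableSet_reducedBoundary (hp : IsPolar E μ f) :
    MeasurableSet (reducedBoundary E) := by
  set l : Filter ℚ := comap (fun q : ℚ => (q : ℝ)) (𝓝[>] 0) with hl
  have hne : l.NeBot := by
    rw [hl, comap_neBot_iff]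
    intro t ht
    obtain ⟨δ, hδ, hδ'⟩ := mem_nhdsGT_iff_exists_Ioo_subset.1 ht
    obtain ⟨q, hq⟩ := exists_rat_btwn (show (0 : ℝ) < δ from hδ)
    exact ⟨q, hδ' ⟨hq.1, hq.2⟩⟩
  have e : reducedBoundary E
      = {x | ∃ c, Tendsto (fun q : ℚ => normalRatio E x q) l (𝓝 c)} ∩
        {x | Tendsto (fun q : ℚ => ‖normalRatio E x q‖) l (𝓝 1)} := by
    ext x
    constructor
    · rintro ⟨ν, hν, ht⟩
      rw [hp.tendsto_normalRatio_iff] at ht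
      exact ⟨⟨ν, ht⟩, by simpa [hν] using ht.norm⟩
    · rintro ⟨⟨ν, ht⟩, h1⟩
      exact ⟨ν, tendsto_nhds_unique ht.norm h1, (hp.tendsto_normalRatio_iff x ν).2 ht⟩
  rw [e]
  refine MeasurableSet.inter ?_ ?_
  · exact measurableSet_exists_tendsto fun q => hp.measurable_normalRatio q
  · exact measurableSet_tendsto (l := l) (𝓝 (1 : ℝ)) fun q => (hp.measurable_normalRatio q).norm

end Measurability

/-! ### Comparison of the perimeter with the Hausdorff measure -/

section Hausdorff

variable {E : Set (Euc n)} {μ : Measure (Euc n)} {f : Euc n → Euc n}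

/-- A measure with bounded upper `s`-density on `S` is controlled by the Hausdorff measure. -/
lemma measure_le_hausdorffMeasure_of_density {X : Type*} [MetricSpace X] [MeasurableSpace X]
    [BorelSpace X] (μ : Measure X) {s C : ℝ} (hs : 0 ≤ s) (hC : 0 < C) {S : Set X}
    (h : ∀ x ∈ S, ∃ δ > 0, ∀ r, 0 < r → r < δ →
      μ (Metric.ball x r) ≤ ENNReal.ofReal (C * r ^ s)) :
    μ S ≤ ENNReal.ofReal C * Measure.hausdorffMeasure s S := by
  -- Stratification by the scale below which the density bound holds. The strata increase, so
  -- continuity of the measure along the union needs no measurability.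
  set T : ℕ → Set X := fun k => {x ∈ S | ∀ r, 0 < r → r < 1 / ((k : ℝ) + 1) →
    μ (Metric.ball x r) ≤ ENNReal.ofReal (C * r ^ s)} with hT
  have hTmono : Monotone T := by
    intro k l hkl x hx
    refine ⟨hx.1, fun r h0 hr => hx.2 r h0 (hr.trans_le ?_)⟩
    gcongr
  have hTS : S = ⋃ k, T k := by
    ext x
    simp only [mem_iUnion]
    refine ⟨fun hx => ?_, fun ⟨k, hk⟩ => hk.1⟩
    obtain ⟨δ, hδ, hd⟩ := h x hx
    obtain ⟨k, hk⟩ := exists_nat_one_div_lt hδ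
    exact ⟨k, hx, fun r h0 hr => hd r h0 (hr.trans hk)⟩
  have hCne : ENNReal.ofReal C ≠ 0 := by simpa using hC
  have key : ∀ k, μ (T k) ≤ ENNReal.ofReal C * Measure.hausdorffMeasure s S := by
    intro k
    -- The bound passes to closed balls by decreasing the radius; radius zero is included and
    -- handles covering sets of zero diameter.
    have hcl : ∀ x ∈ T k, ∀ r, 0 ≤ r → r < 1 / ((k : ℝ) + 1) →
        μ (Metric.closedBall x r) ≤ ENNReal.ofReal (C * r ^ s) := by
      intro x hx r h0 hr
      have hlim : Tendsto (fun t : ℝ => ENNReal.ofReal (C * t ^ s)) (𝓝[>] r)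
          (𝓝 (ENNReal.ofReal (C * r ^ s))) := by
        refine ENNReal.tendsto_ofReal (Tendsto.const_mul _ ?_)
        exact ((Real.continuous_rpow_const hs).tendsto r).mono_left nhdsWithin_le_nhds
      refine ge_of_tendsto hlim ?_
      filter_upwards [Ioo_mem_nhdsGT hr] with t ht
      exact (measure_mono (Metric.closedBall_subset_ball ht.1)).trans
        (hx.2 t (h0.trans_lt ht.1) ht.2)
    have hle : (ENNReal.ofReal C)⁻¹ • OuterMeasure.restrict (T k) μ.toOuterMeasure
        ≤ OuterMeasure.mkMetric fun r => r ^ s := by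
      -- The scale `1 / (k + 2)` is strictly below `1 / (k + 1)`, so a set of this diameter fits
      -- into a closed ball to which the bound applies.
      refine OuterMeasure.le_mkMetric _ _ (ENNReal.ofReal (1 / ((k : ℝ) + 2)))
        (by simp only [ENNReal.ofReal_pos]; positivity) fun t ht => ?_
      rw [smul_apply, OuterMeasure.restrict_apply, smul_eq_mul,
        mul_comm, ← div_eq_mul_inv]
      refine ENNReal.div_le_of_le_mul ?_
      rcases (t ∩ T k).eq_empty_or_nonempty with he | ⟨x, hxt, hxT⟩
      · rw [he]; simp
      have hfin : Metric.ediam t ≠ ⊤ := (ht.trans_lt ENNReal.ofReal_lt_top).ne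
      set r := (Metric.ediam t).toReal with hr
      have hr0 : 0 ≤ r := ENNReal.toReal_nonneg
      have hrk : r < 1 / ((k : ℝ) + 1) := by
        have h1 : r ≤ 1 / ((k : ℝ) + 2) := ENNReal.toReal_le_of_le_ofReal (by positivity) ht
        refine h1.trans_lt ?_
        gcongr
        norm_num
      have hsub : t ∩ T k ⊆ Metric.closedBall x r := by
        intro y hy
        rw [Metric.mem_closedBall, dist_edist]
        exact ENNReal.toReal_mono hfin (Metric.edist_le_ediam_of_mem hy.1 hxt)
      refine (measure_mono hsub).trans ((hcl x hxT r hr0 hrk).trans_eq ?_)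
      rw [ENNReal.ofReal_mul hC.le, ← ENNReal.ofReal_rpow_of_nonneg hr0 hs, hr,
        ENNReal.ofReal_toReal hfin, mul_comm]
    have h2 := hle (T k)
    rw [smul_apply, OuterMeasure.restrict_apply, inter_self, smul_eq_mul,
      OuterMeasure.coe_mkMetric] at h2
    have h3 : μ (T k) ≤ ENNReal.ofReal C * Measure.mkMetric (fun r => r ^ s) (T k) := by
      calc μ (T k) = ENNReal.ofReal C * ((ENNReal.ofReal C)⁻¹ * μ (T k)) := by
            rw [← mul_assoc, ENNReal.mul_inv_cancel hCne ENNReal.ofReal_ne_top, one_mul]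
        _ ≤ _ := by gcongr; exact h2
    have h4 : Measure.mkMetric (fun r => r ^ s) (T k) ≤ Measure.hausdorffMeasure s S :=
      measure_mono (μ := Measure.hausdorffMeasure s) (fun x hx => hx.1)
    exact h3.trans (mul_le_mul' le_rfl h4)
  rw [hTS, hTmono.measure_iUnion]
  refine iSup_le fun k => (key k).trans ?_
  rw [← hTS]

/-- The constant comparing the perimeter measure with the surface measure. -/
noncomputable def perimConst (n : ℕ) : ℝ := 4 * transitionBound * 2 ^ n * unitVol n

lemma perimConst_pos : 0 < perimConst n := by
  have := transitionBound_pos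
  have := unitVol_pos (n := n)
  unfold perimConst
  positivity

/-- The perimeter measure is controlled by the Hausdorff measure on the reduced boundary. -/
lemma IsPolar.measure_le_hausdorffMeasure (hn : n ≠ 0) (hp : IsPolar E μ f)
    (hE : NullMeasurableSet E volume) {S : Set (Euc n)} (hS : S ⊆ reducedBoundary E) :
    μ S ≤ ENNReal.ofReal (perimConst n) * Measure.hausdorffMeasure ((n : ℝ) - 1) S := by
  have := hp.finite
  have h1n : (1 : ℝ) ≤ n := by exact_mod_cast Nat.one_le_iff_ne_zero.2 hn
  refine measure_le_hausdorffMeasure_of_density μ (by linarith) perimConst_pos fun x hx => ?_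
  obtain ⟨ν, hν, ht⟩ := hS hx
  obtain ⟨r₀, hg⟩ := hp.exists_isGoodPoint hν ht
  refine ⟨r₀ / 2, half_pos hg.pos, fun r h0 hr => ?_⟩
  have h1 := hp.measure_ball_le_pow hE hg h0 (by linarith)
  rw [← ofReal_measureReal (measure_ne_top _ _)]
  refine ENNReal.ofReal_le_ofReal ?_
  refine le_of_mul_le_mul_left ?_ h0
  have e : r * (perimConst n * r ^ ((n : ℝ) - 1)) = perimConst n * r ^ n := by
    rw [Real.rpow_sub_one h0.ne', Real.rpow_natCast]; field_simp
  rw [e]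
  exact h1

lemma surfaceMeasure_const_ne_zero :
    (volume (Metric.ball (0 : Euc (n - 1)) 1)) / 2 ^ (n - 1) ≠ (0 : ℝ≥0∞) := by
  refine (ENNReal.div_pos (Metric.measure_ball_pos volume _ one_pos).ne' ?_).ne'
  finiteness

lemma surfaceMeasure_const_ne_top :
    (volume (Metric.ball (0 : Euc (n - 1)) 1)) / 2 ^ (n - 1) ≠ (⊤ : ℝ≥0∞) :=
  ENNReal.div_ne_top measure_ball_lt_top.ne (by simp)

/-- The perimeter in `G` is controlled by the anisotropic perimeter, with a constant independent of
the set. -/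
lemma exists_measure_le_anisoPerimeter (hn : n ≠ 0) {G : Set (Euc n)} (hG : MeasurableSet G)
    {A : Euc n → Matrix (Fin n) (Fin n) ℝ} {lam Lam : ℝ} (hlam : 0 < lam)
    (hell : UniformlyElliptic G A lam Lam) :
    ∃ C : ℝ≥0∞, C ≠ ⊤ ∧ ∀ (E : Set (Euc n)) (μ : Measure (Euc n)) (f : Euc n → Euc n),
      NullMeasurableSet E volume → IsPolar E μ f → μ G ≤ C * anisoPerimeter A E G := by
  set c : ℝ≥0∞ := (volume (Metric.ball (0 : Euc (n - 1)) 1)) / 2 ^ (n - 1) with hc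
  have hc0 : c ≠ 0 := surfaceMeasure_const_ne_zero
  have hct : c ≠ ⊤ := surfaceMeasure_const_ne_top
  set k : ℝ≥0∞ := ENNReal.ofReal (Real.sqrt lam) with hk
  have hk0 : k ≠ 0 := by simpa [hk] using hlam
  have hkt : k ≠ ⊤ := ENNReal.ofReal_ne_top
  refine ⟨ENNReal.ofReal (perimConst n) * (c⁻¹ * k⁻¹), by finiteness, fun E μ f hE hp => ?_⟩
  have hmeas := hp.measurableSet_reducedBoundary
  have h1 : μ G ≤ μ (G ∩ reducedBoundary E) := by
    refine measure_mono_ae ?_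
    filter_upwards [hp.ae_mem_reducedBoundary] with x hx hxG
    exact ⟨hxG, hx⟩
  have h2 := hp.measure_le_hausdorffMeasure hn hE (S := G ∩ reducedBoundary E) inter_subset_right
  -- At a unit normal the integrand is at least `√lam`.
  have h3 : k * (c * Measure.hausdorffMeasure ((n : ℝ) - 1) (G ∩ reducedBoundary E))
      ≤ anisoPerimeter A E G := by
    have e : c * Measure.hausdorffMeasure ((n : ℝ) - 1) (G ∩ reducedBoundary E)
        = surfaceMeasure n (G ∩ reducedBoundary E) := by
      rw [surfaceMeasure, Measure.smul_apply, smul_eq_mul]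
    rw [e, anisoPerimeter, ← setLIntegral_const]
    refine setLIntegral_mono' (hG.inter hmeas) fun x hx => ?_
    obtain ⟨ν, hν, ht⟩ := hx.2
    refine ENNReal.ofReal_le_ofReal (Real.sqrt_le_sqrt ?_)
    rw [outerNormal_eq ht]
    simpa [hν] using (hell x hx.1 ν).1
  calc μ G ≤ ENNReal.ofReal (perimConst n) *
        Measure.hausdorffMeasure ((n : ℝ) - 1) (G ∩ reducedBoundary E) := h1.trans h2
    _ = ENNReal.ofReal (perimConst n) * (c⁻¹ * k⁻¹) *
        (k * (c * Measure.hausdorffMeasure ((n : ℝ) - 1) (G ∩ reducedBoundary E))) := by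
        rw [mul_assoc, mul_assoc c⁻¹, ← mul_assoc k⁻¹, ENNReal.inv_mul_cancel hk0 hkt, one_mul,
          ← mul_assoc c⁻¹, ENNReal.inv_mul_cancel hc0 hct, one_mul]
    _ ≤ _ := by gcongr

end Hausdorff

/-! ### Shear diffeomorphisms -/

/-- The data of a diffeomorphism `x ↦ x + t φ(x) e` close to the identity. -/
structure Shear (n : ℕ) where
  /-- the profile -/
  φ : Euc n → ℝ
  /-- the direction -/
  e : Euc n
  /-- the size -/
  t : ℝ
  smooth : ContDiff ℝ ∞ φ
  compact : HasCompactSupport φ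
  abs_le : ∀ x, |φ x| ≤ 1
  norm_gradient_le : ∀ x, ‖gradient φ x‖ ≤ 1
  norm_e : ‖e‖ = 1
  abs_t : |t| ≤ 1 / 4

namespace Shear

variable (S : Shear n)

/-- The map `x ↦ x + t φ(x) e`. -/
def fn (x : Euc n) : Euc n := x + (S.t * S.φ x) • S.e

lemma contDiff_fn : ContDiff ℝ ∞ S.fn :=
  contDiff_id.add ((contDiff_const.mul S.smooth).smul contDiff_const)

lemma abs_sub_le (x y : Euc n) : |S.φ x - S.φ y| ≤ ‖x - y‖ := by
  have h := Convex.norm_image_sub_le_of_norm_fderiv_le (𝕜 := ℝ) (f := S.φ) (C := 1) (s := univ)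
    (x := y) (y := x)
    (fun z _ => S.smooth.differentiable (by simp) z)
    (fun z _ => by rw [← norm_gradient]; exact S.norm_gradient_le z) convex_univ
    (mem_univ _) (mem_univ _)
  simpa using h

lemma norm_fn_sub_sub_le (x y : Euc n) : ‖S.fn x - S.fn y - (x - y)‖ ≤ |S.t| * ‖x - y‖ := by
  have : S.fn x - S.fn y - (x - y) = (S.t * (S.φ x - S.φ y)) • S.e := by
    simp only [fn]; rw [mul_sub, sub_smul]; abel
  rw [this, norm_smul, S.norm_e, mul_one, Real.norm_eq_abs, abs_mul]
  gcongr
  exact S.abs_sub_le x y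

lemma norm_fn_sub_le (x y : Euc n) : ‖S.fn x - S.fn y‖ ≤ (1 + |S.t|) * ‖x - y‖ := by
  have := norm_le_norm_add_norm_sub' (S.fn x - S.fn y) (x - y)
  have := S.norm_fn_sub_sub_le x y
  linarith

lemma norm_sub_le_norm_fn_sub (x y : Euc n) : ‖x - y‖ ≤ 2 * ‖S.fn x - S.fn y‖ := by
  have h1 := norm_le_norm_add_norm_sub (S.fn x - S.fn y) (x - y)
  have h2 := S.norm_fn_sub_sub_le x y
  have h3 : |S.t| * ‖x - y‖ ≤ 1 / 4 * ‖x - y‖ := by gcongr; exact S.abs_t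
  linarith [norm_nonneg (S.fn x - S.fn y)]

lemma norm_fn_sub_self_le (x : Euc n) : ‖S.fn x - x‖ ≤ |S.t| := by
  simp only [fn, add_sub_cancel_left]
  rw [norm_smul, S.norm_e, mul_one, Real.norm_eq_abs, abs_mul]
  have := S.abs_le x
  nlinarith [abs_nonneg S.t]

lemma approximatesLinearOn : ApproximatesLinearOn S.fn
    ((ContinuousLinearEquiv.refl ℝ (Euc n) : Euc n ≃L[ℝ] Euc n) : Euc n →L[ℝ] Euc n) univ (1 / 4) := by
  intro x _ y _
  refine (S.norm_fn_sub_sub_le x y).trans ?_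
  have := S.abs_t
  push_cast
  gcongr

/-- The shear as a homeomorphism. -/
noncomputable def homeo : Euc n ≃ₜ Euc n :=
  S.approximatesLinearOn.toHomeomorph S.fn (by
    rcases subsingleton_or_nontrivial (Euc n) with h | h
    · exact Or.inl h
    · right
      have : ‖(((ContinuousLinearEquiv.refl ℝ (Euc n)).symm : Euc n ≃L[ℝ] Euc n) :
          Euc n →L[ℝ] Euc n)‖₊ = 1 := by
        ext1
        exact ContinuousLinearMap.norm_id
      rw [this]
      rw [inv_one]
      rw [div_lt_one (by norm_num)]
      norm_num)

/-- The inverse of a shear. -/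
noncomputable def inv : Euc n → Euc n := S.homeo.symm

@[simp] lemma fn_inv (y : Euc n) : S.fn (S.inv y) = y := S.homeo.apply_symm_apply y

@[simp] lemma inv_fn (x : Euc n) : S.inv (S.fn x) = x := S.homeo.symm_apply_apply x

lemma injective_fn : Function.Injective S.fn := S.homeo.injective

lemma continuous_fn : Continuous S.fn := S.homeo.continuous

lemma continuous_inv : Continuous S.inv := S.homeo.symm.continuous

lemma norm_inv_sub_le (x y : Euc n) : ‖S.inv x - S.inv y‖ ≤ 2 * ‖x - y‖ := by
  simpa using S.norm_sub_le_norm_fn_sub (S.inv x) (S.inv y)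

lemma image_fn (s : Set (Euc n)) : S.fn '' s = S.inv ⁻¹' s :=
  S.homeo.toEquiv.image_eq_preimage_symm s

/-- The derivative of a shear. -/
noncomputable def deriv (x : Euc n) : Euc n →L[ℝ] Euc n :=
  ContinuousLinearMap.id ℝ (Euc n) + (S.t • fderiv ℝ S.φ x).smulRight S.e

lemma hasFDerivAt_fn (x : Euc n) : HasFDerivAt S.fn (S.deriv x) x := by
  have h := ((S.smooth.differentiable (by simp) x).hasFDerivAt.const_mul S.t).smul_const S.e
  exact (hasFDerivAt_id x).add h

/-- The Jacobian determinant of a shear. -/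
noncomputable def jac (x : Euc n) : ℝ := 1 + S.t * fderiv ℝ S.φ x S.e

/-- The derivative is the identity plus a rank-one map, that is a transvection. Its determinant is
affine in `t`, which makes the volume of the image affine in `t` as well. -/
lemma det_deriv (x : Euc n) : (S.deriv x).det = S.jac x := by
  have := LinearMap.transvection.det (R := ℝ) ((S.t • fderiv ℝ S.φ x : Euc n →L[ℝ] ℝ) : Euc n →ₗ[ℝ] ℝ) S.e
  rw [ContinuousLinearMap.det]
  refine Eq.trans ?_ (this.trans ?_)
  · congr 1
  · simp [jac]

lemma abs_fderiv_le (x v : Euc n) : |fderiv ℝ S.φ x v| ≤ ‖v‖ := by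
  rw [← inner_gradient_eq_fderiv]
  refine (abs_real_inner_le_norm _ _).trans ?_
  have := S.norm_gradient_le x
  nlinarith [norm_nonneg v]

lemma abs_jac_sub_one_le (x : Euc n) : |S.jac x - 1| ≤ |S.t| := by
  simp only [jac, add_sub_cancel_left, abs_mul]
  have := S.abs_fderiv_le x S.e
  rw [S.norm_e] at this
  nlinarith [abs_nonneg S.t]

lemma jac_bounds (x : Euc n) : 3 / 4 ≤ S.jac x ∧ S.jac x ≤ 5 / 4 := by
  have h := (S.abs_jac_sub_one_le x).trans S.abs_t
  rw [_root_.abs_le] at h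
  constructor <;> linarith

lemma jac_pos (x : Euc n) : 0 < S.jac x := by linarith [(S.jac_bounds x).1]

lemma contDiff_jac : ContDiff ℝ ∞ S.jac := by
  have : ContDiff ℝ ∞ (fderiv ℝ S.φ) := S.smooth.fderiv_right (by simp)
  exact contDiff_const.add (contDiff_const.mul (this.clm_apply contDiff_const))

lemma contDiff_inv : ContDiff ℝ ∞ S.inv := by
  refine S.homeo.contDiff_symm (f₀' := fun x => (S.deriv x).toContinuousLinearEquivOfDetNeZero
    (by rw [S.det_deriv]; exact (S.jac_pos x).ne')) (fun x => ?_) S.contDiff_fn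
  rw [ContinuousLinearMap.coe_toContinuousLinearEquivOfDetNeZero]
  exact S.hasFDerivAt_fn x

lemma lintegral_comp (g : Euc n → ℝ≥0∞) (s : Set (Euc n)) (hs : MeasurableSet s) :
    ∫⁻ y in S.fn '' s, g y = ∫⁻ x in s, ENNReal.ofReal (S.jac x) * g (S.fn x) := by
  rw [lintegral_image_eq_lintegral_abs_det_fderiv_mul volume hs
    (fun x _ => (S.hasFDerivAt_fn x).hasFDerivWithinAt) S.injective_fn.injOn]
  simp_rw [S.det_deriv, abs_of_pos (S.jac_pos _)]

lemma integral_comp {V : Type*} [NormedAddCommGroup V] [NormedSpace ℝ V] (g : Euc n → V)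
    (s : Set (Euc n)) (hs : MeasurableSet s) :
    ∫ y in S.fn '' s, g y = ∫ x in s, S.jac x • g (S.fn x) := by
  rw [integral_image_eq_integral_abs_det_fderiv_smul volume hs
    (fun x _ => (S.hasFDerivAt_fn x).hasFDerivWithinAt) S.injective_fn.injOn]
  simp_rw [S.det_deriv, abs_of_pos (S.jac_pos _)]

lemma image_univ : S.fn '' univ = univ := by rw [S.image_fn, preimage_univ]

lemma quasiMeasurePreserving_inv : Measure.QuasiMeasurePreserving S.inv volume volume := by
  refine ⟨S.continuous_inv.measurable, Measure.AbsolutelyContinuous.mk fun s hs h => ?_⟩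
  rw [Measure.map_apply S.continuous_inv.measurable hs, ← S.image_fn]
  exact addHaar_image_eq_zero_of_differentiableOn_of_addHaar_eq_zero volume
    (fun x _ => (S.hasFDerivAt_fn x).differentiableAt.differentiableWithinAt) h

lemma nullMeasurableSet_image {E : Set (Euc n)} (hE : NullMeasurableSet E volume) :
    NullMeasurableSet (S.fn '' E) volume := by
  rw [S.image_fn]
  exact hE.preimage S.quasiMeasurePreserving_inv

lemma integral_image {V : Type*} [NormedAddCommGroup V] [NormedSpace ℝ V] (g : Euc n → V)
    {E : Set (Euc n)} (hE : NullMeasurableSet E volume) :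
    ∫ y in S.fn '' E, g y = ∫ x in E, S.jac x • g (S.fn x) := by
  rw [← integral_indicator₀ (S.nullMeasurableSet_image hE), ← integral_indicator₀ hE,
    ← setIntegral_univ, ← S.image_univ, S.integral_comp _ univ MeasurableSet.univ, setIntegral_univ]
  congr 1 with x
  by_cases hx : x ∈ E
  · rw [indicator_of_mem (mem_image_of_mem _ hx), indicator_of_mem hx]
  · rw [indicator_of_notMem (fun H => hx (S.injective_fn.mem_set_image.1 H)),
      indicator_of_notMem hx, smul_zero]

/-- The volume of the image of a set under a shear is affine in the size of the shear. -/
lemma volume_real_image {E : Set (Euc n)} (hE : NullMeasurableSet E volume)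
    (hfin : volume E ≠ ⊤) :
    volume.real (S.fn '' E) = volume.real E + S.t * ∫ x in E, fderiv ℝ S.φ x S.e := by
  have h := S.integral_image (fun _ => (1 : ℝ)) hE
  simp only [integral_const, measureReal_restrict_apply_univ, smul_eq_mul, mul_one, jac] at h
  have hi : Integrable (fun x => fderiv ℝ S.φ x S.e) (volume.restrict E) := by
    have := ((integrable_gradient (S.smooth.of_le (by simp)) S.compact
      (volume : Measure (Euc n))).restrict (s := E)).inner_const (𝕜 := ℝ) S.e
    simpa only [inner_gradient_eq_fderiv] using this
  have hc : Integrable (fun _ : Euc n => (1 : ℝ)) (volume.restrict E) := by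
    have : IsFiniteMeasure (volume.restrict E) := ⟨by simpa using hfin.lt_top⟩
    exact integrable_const _
  rw [integral_add hc (hi.const_mul _), integral_const_mul] at h
  simpa using h

lemma fn_eq_self {x : Euc n} (hx : x ∉ tsupport S.φ) : S.fn x = x := by
  simp [fn, image_eq_zero_of_notMem_tsupport hx]

lemma inv_eq_self {x : Euc n} (hx : x ∉ tsupport S.φ) : S.inv x = x := by
  conv_lhs => rw [← S.fn_eq_self hx]
  exact S.inv_fn x

lemma fn_mem_tsupport {x : Euc n} (hx : x ∈ tsupport S.φ) : S.fn x ∈ tsupport S.φ := by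
  by_contra h
  have h1 := S.inv_eq_self h
  rw [S.inv_fn] at h1
  rw [← h1] at h
  exact h hx

lemma inv_mem_tsupport {x : Euc n} (hx : x ∈ tsupport S.φ) : S.inv x ∈ tsupport S.φ := by
  by_contra h
  have h1 := S.fn_eq_self h
  rw [S.fn_inv] at h1
  rw [← h1] at h
  exact h hx

/-- Points off the support of `φ` are fixed, and both the shear and its inverse map the support into
itself. -/
lemma image_eq_of_tsupport_subset {Ω : Set (Euc n)} (h : tsupport S.φ ⊆ Ω) :
    S.fn '' Ω = Ω := by
  ext y
  constructor
  · rintro ⟨x, hx, rfl⟩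
    by_cases hxs : x ∈ tsupport S.φ
    · exact h (S.fn_mem_tsupport hxs)
    · rwa [S.fn_eq_self hxs]
  · intro hy
    refine ⟨S.inv y, ?_, S.fn_inv y⟩
    by_cases hys : y ∈ tsupport S.φ
    · exact h (S.inv_mem_tsupport hys)
    · rwa [S.inv_eq_self hys]

/-- The cofactor matrix of a shear. -/
noncomputable def cof (x v : Euc n) : Euc n :=
  S.jac x • v - (S.t * inner ℝ S.e v) • gradient S.φ x

lemma inner_cof (x v w : Euc n) :
    inner ℝ (S.cof x v) w = S.jac x * inner ℝ v w - S.t * inner ℝ S.e v * fderiv ℝ S.φ x w := by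
  rw [cof, inner_sub_left, real_inner_smul_left, real_inner_smul_left, inner_gradient_eq_fderiv]

lemma norm_cof_sub_le (x v : Euc n) : ‖S.cof x v - v‖ ≤ 2 * |S.t| * ‖v‖ := by
  have e : S.cof x v - v = (S.jac x - 1) • v - (S.t * inner ℝ S.e v) • gradient S.φ x := by
    rw [cof, sub_smul, one_smul]; abel
  rw [e]
  refine (norm_sub_le _ _).trans ?_
  rw [norm_smul, norm_smul, Real.norm_eq_abs, Real.norm_eq_abs, abs_mul]
  have h1 := S.abs_jac_sub_one_le x
  have h2 : |inner ℝ S.e v| ≤ ‖v‖ := by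
    simpa [S.norm_e] using abs_real_inner_le_norm S.e v
  have h3 := S.norm_gradient_le x
  calc |S.jac x - 1| * ‖v‖ + |S.t| * |inner ℝ S.e v| * ‖gradient S.φ x‖
      ≤ |S.t| * ‖v‖ + |S.t| * ‖v‖ * 1 := by gcongr
    _ = _ := by ring

lemma norm_cof_bounds (x v : Euc n) : ‖v‖ / 2 ≤ ‖S.cof x v‖ ∧ ‖S.cof x v‖ ≤ 2 * ‖v‖ := by
  have h1 := S.norm_cof_sub_le x v
  have h2 : 2 * |S.t| * ‖v‖ ≤ 1 / 2 * ‖v‖ := by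
    have := S.abs_t
    gcongr
    linarith
  have h3 := norm_le_norm_add_norm_sub (S.cof x v) v
  have h4 := norm_le_norm_add_norm_sub' (S.cof x v) v
  constructor <;> nlinarith [norm_nonneg v]

lemma continuous_cof : Continuous fun p : Euc n × Euc n => S.cof p.1 p.2 := by
  have h1 := S.contDiff_jac.continuous
  have h2 := ContDiff.continuous_gradient (S.smooth.of_le (by simp))
  unfold cof
  fun_prop

/-- The Piola identity for a shear. -/
lemma inner_jac_smul_gradient {ψ : Euc n → ℝ} (hψ : ContDiff ℝ 1 ψ) (x v : Euc n) :
    inner ℝ (S.jac x • gradient ψ (S.fn x)) v =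
      inner ℝ (gradient (fun z => S.jac z * ψ (S.fn z)) x) v
        - S.t * inner ℝ S.e (gradient (fun z => ψ (S.fn z) * fderiv ℝ S.φ z v) x) := by
  have hη : HasFDerivAt (fun z => ψ (S.fn z)) ((fderiv ℝ ψ (S.fn x)).comp (S.deriv x)) x :=
    (hψ.differentiable one_ne_zero _).hasFDerivAt.comp x (S.hasFDerivAt_fn x)
  have hφ2 : DifferentiableAt ℝ (fderiv ℝ S.φ) x :=
    by
    have : ContDiff ℝ ∞ (fderiv ℝ S.φ) := S.smooth.fderiv_right (by simp)
    exact this.differentiable (by simp) x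
  -- Second derivatives of `φ` enter both terms on the right; they cancel by symmetry.
  have hsymm : ∀ a b, fderiv ℝ (fderiv ℝ S.φ) x a b = fderiv ℝ (fderiv ℝ S.φ) x b a := by
    have : IsSymmSndFDerivAt ℝ S.φ x := S.smooth.contDiffAt.isSymmSndFDerivAt (by
      simp only [minSmoothness_of_isRCLikeNormedField]
      exact WithTop.coe_le_coe.2 (le_top : (2 : ℕ∞) ≤ ⊤))
    exact fun a b => this a b
  have hv : ∀ v, HasFDerivAt (fun z => fderiv ℝ S.φ z v)
      ((fderiv ℝ (fderiv ℝ S.φ) x).flip v) x := fun v => by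
    have := hφ2.hasFDerivAt.clm_apply (hasFDerivAt_const v x)
    simpa using this
  have hjac : HasFDerivAt S.jac (S.t • ((fderiv ℝ (fderiv ℝ S.φ) x).flip S.e)) x :=
    ((hv S.e).const_mul S.t).const_add 1
  have e1 : fderiv ℝ (fun z => S.jac z * ψ (S.fn z)) x = _ := (hjac.mul hη).fderiv
  have e2 : fderiv ℝ (fun z => ψ (S.fn z) * fderiv ℝ S.φ z v) x = _ := (hη.mul (hv v)).fderiv
  rw [real_inner_comm _ S.e, real_inner_smul_left, inner_gradient_eq_fderiv,
    inner_gradient_eq_fderiv, inner_gradient_eq_fderiv, e1, e2]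
  simp only [deriv, add_apply, smul_apply,
    ContinuousLinearMap.comp_apply, ContinuousLinearMap.id_apply, ContinuousLinearMap.smulRight_apply,
    ContinuousLinearMap.flip_apply, map_add, map_smul, smul_eq_mul, jac]
  rw [hsymm v S.e]
  ring

end Shear

/-! ### Transport of the normal ratio by bi-Lipschitz maps -/

lemma measurable_uncurry_comp {c : Euc n → Euc n → Euc n} {f : Euc n → Euc n}
    (hc : Continuous fun p : Euc n × Euc n => c p.1 p.2) (hf : Measurable f) :
    Measurable fun x => c x (f x) :=
  hc.measurable.comp (measurable_id.prodMk hf)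

/-- Transport of the reduced boundary by a bi-Lipschitz homeomorphism. -/
lemma IsPolar.tendsto_normalRatio_of_transport (hn : n ≠ 0) {E F : Set (Euc n)}
    {μ μ' : Measure (Euc n)} {f f' : Euc n → Euc n} (hp : IsPolar E μ f)
    (hE : NullMeasurableSet E volume) (hp' : IsPolar F μ' f') (Φ : Euc n ≃ₜ Euc n)
    (h1 : ∀ x y, ‖Φ x - Φ y‖ ≤ 2 * ‖x - y‖) (h2 : ∀ x y, ‖x - y‖ ≤ 2 * ‖Φ x - Φ y‖)
    {c : Euc n → Euc n → Euc n} (hc : Continuous fun p : Euc n × Euc n => c p.1 p.2)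
    (hlip : ∀ x v w, ‖c x v - c x w‖ ≤ 4 * ‖v - w‖) (hc0 : ∀ x, c x 0 = 0)
    (hmeas : ∀ s, MeasurableSet s → μ'.real s = ∫ z in Φ ⁻¹' s, ‖c z (f z)‖ ∂μ)
    (hint : ∀ s, MeasurableSet s → ∫ y in s, f' y ∂μ' = ∫ z in Φ ⁻¹' s, c z (f z) ∂μ)
    {x ν : Euc n} (hν : ‖ν‖ = 1) (hcν : c x ν ≠ 0)
    (ht : Tendsto (normalRatio E x) (𝓝[>] 0) (𝓝 ν)) :
    Tendsto (normalRatio F (Φ x)) (𝓝[>] 0) (𝓝 (‖c x ν‖⁻¹ • c x ν)) := by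
  have := hp.finite
  obtain ⟨C, hC, hdoub⟩ := hp.exists_doubling hn hE hν ht
  obtain ⟨r₀, hg⟩ := hp.exists_isGoodPoint hν ht
  have hmp := hg.measure_pos
  -- The preimages of balls are not balls but lie between `B_{r/2}(x)` and `B_{2r}(x)`. Doubling
  -- makes the masses of these comparable.
  set D : ℝ → Set (Euc n) := fun r => Φ ⁻¹' Metric.ball (Φ x) r
  have hDm : ∀ r, MeasurableSet (D r) := fun r => Φ.continuous.measurable measurableSet_ball
  have hD1 : ∀ r, Metric.ball x (r / 2) ⊆ D r := fun r z hz => by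
    rw [Metric.mem_ball, dist_eq_norm] at hz
    change Φ z ∈ Metric.ball (Φ x) r
    rw [Metric.mem_ball, dist_eq_norm]
    linarith [h1 z x]
  have hD2 : ∀ r, D r ⊆ Metric.ball x (2 * r) := fun r z hz => by
    change Φ z ∈ Metric.ball (Φ x) r at hz
    rw [Metric.mem_ball, dist_eq_norm] at hz ⊢
    linarith [h2 z x]
  set w := c x ν
  have hgi : Integrable (fun z => c z (f z)) μ := by
    refine Integrable.of_bound (hc.measurable.comp
      (measurable_id.prodMk hp.measurable)).aestronglyMeasurable 4 ?_
    filter_upwards [hp.norm_eq_one] with z hz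
    simpa [hz, hc0] using hlip z (f z) 0
  have hfi := hp.integrable
  have key : ∀ ε > 0, ∀ᶠ r in 𝓝[>] (0 : ℝ), 0 < μ.real (D r) ∧
      ∫ z in D r, ‖c z (f z) - w‖ ∂μ ≤ ε * μ.real (D r) := by
    intro ε hε
    have hcx : ∀ᶠ z in 𝓝 x, ‖c z ν - w‖ < ε / 2 := by
      have hco : Continuous fun z => ‖c z ν - w‖ :=
        ((hc.comp (continuous_id.prodMk continuous_const)).sub continuous_const).norm
      have : Tendsto (fun z => ‖c z ν - w‖) (𝓝 x) (𝓝 0) := by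
        have := hco.tendsto x
        simpa [w] using this
      exact this.eventually (gt_mem_nhds (by positivity))
    obtain ⟨ρ, hρ, hball⟩ := Metric.eventually_nhds_iff_ball.1 hcx
    -- The Lipschitz constant `4` of `c` and the doubling constant `C` turn this into `ε / 2`;
    -- continuity of `c` in the base point pays for the other half.
    have hε' : 0 < ε / (8 * C) := by positivity
    have e1 := hp.eventually_integral_norm_sub_le hν ht hε'
    have hmul : Tendsto (fun r : ℝ => 2 * r) (𝓝[>] 0) (𝓝[>] 0) := by
      refine tendsto_nhdsWithin_iff.2 ⟨?_, ?_⟩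
      · have : Tendsto (fun r : ℝ => 2 * r) (𝓝 0) (𝓝 (2 * 0)) := (continuous_const.mul continuous_id).tendsto 0
        rw [mul_zero] at this
        exact this.mono_left nhdsWithin_le_nhds
      · filter_upwards [self_mem_nhdsWithin] with r hr
        simpa using hr
    filter_upwards [hmul.eventually e1, hdoub, Ioo_mem_nhdsGT (show 0 < ρ / 2 by positivity),
      Ioo_mem_nhdsGT hg.pos] with r hr1 hr2 hr3 hr4
    have hpos : 0 < μ.real (Metric.ball x (r / 2)) := hmp (r / 2) (by linarith [hr4.1]) (by linarith [hr4.1, hr4.2])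
    have hle : μ.real (Metric.ball x (r / 2)) ≤ μ.real (D r) := measureReal_mono (hD1 r)
    refine ⟨hpos.trans_le hle, ?_⟩
    have hi1 : Integrable (fun z => ‖f z - ν‖) μ := (hfi.sub (integrable_const ν)).norm
    calc ∫ z in D r, ‖c z (f z) - w‖ ∂μ ≤ ∫ z in D r, (4 * ‖f z - ν‖ + ε / 2) ∂μ := by
          refine setIntegral_mono_on (hgi.sub (integrable_const w)).norm.integrableOn
            ((hi1.const_mul 4).add (integrable_const _)).integrableOn (hDm r) fun z hz => ?_
          have a1 := norm_sub_le_norm_sub_add_norm_sub (c z (f z)) (c z ν) w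
          have a2 := hlip z (f z) ν
          have a3 := hball z (Metric.ball_subset_ball (by linarith [hr3.2]) (hD2 r hz))
          linarith
      _ = 4 * ∫ z in D r, ‖f z - ν‖ ∂μ + ε / 2 * μ.real (D r) := by
          rw [integral_add (hi1.const_mul 4).integrableOn (integrable_const _), integral_const_mul]
          simp [mul_comm]
      _ ≤ 4 * ∫ z in Metric.ball x (2 * r), ‖f z - ν‖ ∂μ + ε / 2 * μ.real (D r) := by
          have := setIntegral_mono_set hi1.integrableOn (ae_of_all _ fun z => norm_nonneg _)
            (hD2 r).eventuallyLE
          linarith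
      _ ≤ 4 * (ε / (8 * C) * (C * μ.real (D r))) + ε / 2 * μ.real (D r) := by
          gcongr
          exact hr1.trans (by gcongr; exact hr2.trans (by gcongr))
      _ = ε * μ.real (D r) := by field_simp; ring
  have hA : Tendsto (fun r => (μ.real (D r))⁻¹ • ∫ z in D r, c z (f z) ∂μ) (𝓝[>] 0) (𝓝 w) := by
    rw [Metric.tendsto_nhds]
    intro ε hε
    filter_upwards [key (ε / 2) (by positivity)] with r hr
    have e : (μ.real (D r))⁻¹ • ∫ z in D r, c z (f z) ∂μ - w
        = (μ.real (D r))⁻¹ • ∫ z in D r, (c z (f z) - w) ∂μ := by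
      rw [integral_sub hgi.integrableOn (integrable_const _), smul_sub]
      simp [smul_smul, inv_mul_cancel₀ hr.1.ne']
    rw [dist_eq_norm, e, norm_smul, norm_inv, Real.norm_of_nonneg hr.1.le, inv_mul_eq_div,
      div_lt_iff₀ hr.1]
    have := (norm_integral_le_integral_norm (μ := μ.restrict (D r)) (fun z => c z (f z) - w)).trans hr.2
    nlinarith [hr.1]
  have hB : Tendsto (fun r => (μ.real (D r))⁻¹ * ∫ z in D r, ‖c z (f z)‖ ∂μ) (𝓝[>] 0) (𝓝 ‖w‖) := by
    rw [Metric.tendsto_nhds]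
    intro ε hε
    filter_upwards [key (ε / 2) (by positivity)] with r hr
    have e : (μ.real (D r))⁻¹ * ∫ z in D r, ‖c z (f z)‖ ∂μ - ‖w‖
        = (μ.real (D r))⁻¹ * ∫ z in D r, (‖c z (f z)‖ - ‖w‖) ∂μ := by
      rw [integral_sub hgi.norm.integrableOn (integrable_const _), mul_sub]
      simp [← mul_assoc, inv_mul_cancel₀ hr.1.ne']
    rw [dist_eq_norm, e, norm_mul, norm_inv, Real.norm_of_nonneg hr.1.le, inv_mul_eq_div,
      div_lt_iff₀ hr.1]
    have h3 : ‖∫ z in D r, (‖c z (f z)‖ - ‖w‖) ∂μ‖ ≤ ∫ z in D r, ‖c z (f z) - w‖ ∂μ := by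
      refine norm_integral_le_of_norm_le (hgi.sub (integrable_const w)).norm.integrableOn
        (ae_of_all _ fun z => abs_norm_sub_norm_le _ _)
    nlinarith [hr.1]
  have hw : ‖w‖ ≠ 0 := norm_ne_zero_iff.2 hcν
  -- The normal ratio of `F` is the quotient of the two averages over `D r`, in which the
  -- normalizing mass cancels.
  refine ((hB.inv₀ hw).smul hA).congr' ?_
  filter_upwards [key 1 one_pos] with r hr
  rw [hp'.normalRatio_eq, hmeas _ measurableSet_ball, hint _ measurableSet_ball, mul_inv, inv_inv,
    smul_smul]
  have hD : Φ ⁻¹' Metric.ball (Φ x) r = D r := rfl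
  have := hr.1.ne'
  rw [hD]
  congr 1
  field_simp

/-! ### Reduced boundaries of sheared sets -/

namespace Shear

variable (S : Shear n) {E : Set (Euc n)} {μ : Measure (Euc n)} {f : Euc n → Euc n}

lemma cof_sub (x v w : Euc n) : S.cof x (v - w) = S.cof x v - S.cof x w := by
  simp only [cof, inner_sub_right, mul_sub, smul_sub, sub_smul]; abel

lemma cof_smul (x v : Euc n) (a : ℝ) : S.cof x (a • v) = a • S.cof x v := by
  simp only [cof, inner_smul_right, smul_sub, smul_smul]
  ring_nf

lemma cof_ne_zero (x : Euc n) {v : Euc n} (hv : v ≠ 0) : S.cof x v ≠ 0 := by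
  have := (S.norm_cof_bounds x v).1
  have := norm_pos_iff.2 hv
  exact norm_pos_iff.1 (by linarith)

/-- The inverse of the cofactor matrix. -/
noncomputable def cofInv (x w : Euc n) : Euc n :=
  (S.jac x)⁻¹ • (w + (S.t * inner ℝ S.e w) • gradient S.φ x)

/-- The cofactor map preserves the component along `e`, which permits solving for `v` explicitly. -/
lemma cofInv_cof (x v : Euc n) : S.cofInv x (S.cof x v) = v := by
  have hj := (S.jac_pos x).ne'
  have e : inner ℝ S.e (S.cof x v) = inner ℝ S.e v := by
    rw [real_inner_comm, inner_cof, real_inner_comm, jac]; ring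
  rw [cofInv, e, cof, sub_add_cancel, smul_smul, inv_mul_cancel₀ hj, one_smul]

lemma cof_cofInv (x w : Euc n) : S.cof x (S.cofInv x w) = w := by
  have hj := (S.jac_pos x).ne'
  have e : inner ℝ S.e (S.cofInv x w) = inner ℝ S.e w := by
    rw [cofInv, inner_smul_right, inner_add_right, inner_smul_right, real_inner_comm (gradient _ _),
      inner_gradient_eq_fderiv]
    have : inner ℝ S.e w + S.t * inner ℝ S.e w * fderiv ℝ S.φ x S.e = S.jac x * inner ℝ S.e w := by
      rw [jac]; ring
    rw [this, inv_mul_cancel_left₀ hj]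
  rw [cof, e, cofInv, smul_smul, mul_inv_cancel₀ hj, one_smul, add_sub_cancel_right]

lemma continuous_cofInv : Continuous fun p : Euc n × Euc n => S.cofInv p.1 p.2 := by
  have h1 := S.contDiff_jac.continuous
  have h2 := ContDiff.continuous_gradient (S.smooth.of_le (by simp))
  have h3 : ∀ p : Euc n × Euc n, S.jac p.1 ≠ 0 := fun p => (S.jac_pos _).ne'
  unfold cofInv
  fun_prop (disch := assumption)

lemma norm_cofInv_sub_le (x v w : Euc n) : ‖S.cofInv x v - S.cofInv x w‖ ≤ 4 * ‖v - w‖ := by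
  have h := (S.norm_cof_bounds x (S.cofInv x v - S.cofInv x w)).1
  rw [cof_sub, cof_cofInv, cof_cofInv] at h
  linarith [norm_nonneg (v - w)]

lemma norm_cof_sub_cof_le (x v w : Euc n) : ‖S.cof x v - S.cof x w‖ ≤ 4 * ‖v - w‖ := by
  have h := (S.norm_cof_bounds x (v - w)).2
  rw [cof_sub] at h
  linarith [norm_nonneg (v - w)]

/-- The total variation of the Gauss-Green measure of the image of a set under a shear. -/
noncomputable def imageMeasure (μ : Measure (Euc n)) (f : Euc n → Euc n) : Measure (Euc n) :=
  (μ.withDensity fun x => ‖S.cof x (f x)‖ₑ).map S.fn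

/-- The normal of the image of a set under a shear. -/
noncomputable def imageNormal (f : Euc n → Euc n) (y : Euc n) : Euc n :=
  ‖S.cof (S.inv y) (f (S.inv y))‖⁻¹ • S.cof (S.inv y) (f (S.inv y))

lemma measurable_cof (hf : Measurable f) : Measurable fun x => S.cof x (f x) :=
  measurable_uncurry_comp (c := S.cof) S.continuous_cof hf

lemma measurableEmbedding_fn : MeasurableEmbedding S.fn :=
  S.homeo.measurableEmbedding

lemma setIntegral_imageMeasure {V : Type*} [NormedAddCommGroup V] [NormedSpace ℝ V]
    (hf : Measurable f) (g : Euc n → V) (s : Set (Euc n)) (hs : MeasurableSet s) :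
    ∫ y in s, g y ∂S.imageMeasure μ f
      = ∫ x in S.fn ⁻¹' s, ‖S.cof x (f x)‖ • g (S.fn x) ∂μ := by
  have e : (fun x => ‖S.cof x (f x)‖ₑ) = fun x => ((‖S.cof x (f x)‖₊ : ℝ≥0) : ℝ≥0∞) := rfl
  rw [imageMeasure, S.measurableEmbedding_fn.setIntegral_map, e,
    setIntegral_withDensity_eq_setIntegral_smul (S.measurable_cof hf).nnnorm _
      (S.continuous_fn.measurable hs)]
  rfl

set_option maxHeartbeats 1000000 in
-- After the change of variables, the Piola identity writes `J ∇ψ(S x)` as a combination of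
-- gradients of compactly supported functions. Gauss-Green on `E` applies to each of them, and the
-- terms recombine into the cofactor map acting on the normal of `E`.
lemma isPolar_image (hp : IsPolar E μ f) (hE : NullMeasurableSet E volume) :
    IsPolar (S.fn '' E) (S.imageMeasure μ f) (S.imageNormal f) := by
  have := hp.finite
  have hcm := S.measurable_cof hp.measurable
  have hci : Integrable (fun x => S.cof x (f x)) μ := by
    refine Integrable.of_bound hcm.aestronglyMeasurable 2 ?_
    filter_upwards [hp.norm_eq_one] with x hx
    simpa [hx] using (S.norm_cof_bounds x (f x)).2
  refine ⟨?_, ?_, ?_, fun ψ hψ hc => ?_⟩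
  · have : IsFiniteMeasure (μ.withDensity fun x => ‖S.cof x (f x)‖ₑ) :=
      isFiniteMeasure_withDensity hci.2.ne
    unfold imageMeasure
    infer_instance
  · have : Measurable fun y => S.cof (S.inv y) (f (S.inv y)) := hcm.comp S.continuous_inv.measurable
    exact this.norm.inv.smul this
  · rw [imageMeasure, S.measurableEmbedding_fn.ae_map_iff]
    refine (withDensity_absolutelyContinuous _ _).ae_le ?_
    filter_upwards [hp.norm_eq_one] with x hx
    have h0 : f x ≠ 0 := by rw [← norm_pos_iff, hx]; exact one_pos
    have := norm_pos_iff.2 (S.cof_ne_zero x h0)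
    rw [imageNormal, S.inv_fn, norm_smul, norm_inv, norm_norm, inv_mul_cancel₀ this.ne']
  · have e1 : ∫ y, ψ y • S.imageNormal f y ∂S.imageMeasure μ f
        = ∫ x, ψ (S.fn x) • S.cof x (f x) ∂μ := by
      rw [← setIntegral_univ, S.setIntegral_imageMeasure hp.measurable _ _ MeasurableSet.univ,
        preimage_univ, setIntegral_univ]
      refine integral_congr_ae ?_
      filter_upwards [hp.norm_eq_one] with x hx
      have h0 : f x ≠ 0 := by rw [← norm_pos_iff, hx]; exact one_pos
      have := norm_pos_iff.2 (S.cof_ne_zero x h0)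
      simp only [imageNormal, S.inv_fn]
      rw [smul_comm (ψ (S.fn x)), smul_smul, mul_inv_cancel₀ this.ne', one_smul]
    rw [e1, S.integral_image _ hE]
    have hη : ContDiff ℝ 1 fun x => ψ (S.fn x) := hψ.comp (S.contDiff_fn.of_le (by simp))
    have hηc : HasCompactSupport fun x => ψ (S.fn x) := hc.comp_homeomorph S.homeo
    have hJη : ContDiff ℝ 1 fun x => S.jac x * ψ (S.fn x) := (S.contDiff_jac.of_le (by simp)).mul hη
    have hJηc : HasCompactSupport fun x => S.jac x * ψ (S.fn x) := hηc.mul_left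
    refine ext_inner_right ℝ fun v => ?_
    have hfd : ContDiff ℝ ∞ (fderiv ℝ S.φ) := S.smooth.fderiv_right (by simp)
    have hv : ContDiff ℝ 1 fun x => fderiv ℝ S.φ x v :=
      (hfd.clm_apply contDiff_const).of_le (by simp)
    have hηv : ContDiff ℝ 1 fun x => ψ (S.fn x) * fderiv ℝ S.φ x v := hη.mul hv
    have hηvc : HasCompactSupport fun x => ψ (S.fn x) * fderiv ℝ S.φ x v := hηc.mul_right
    have i1 : Integrable (gradient fun x => S.jac x * ψ (S.fn x)) (volume.restrict E) :=
      (integrable_gradient hJη hJηc volume).restrict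
    have i2 : Integrable (gradient fun x => ψ (S.fn x) * fderiv ℝ S.φ x v) (volume.restrict E) :=
      (integrable_gradient hηv hηvc volume).restrict
    have iJ : Integrable (fun x => S.jac x • gradient ψ (S.fn x)) (volume.restrict E) := by
      have hcont : Continuous fun x => S.jac x • gradient ψ (S.fn x) := by
        have a1 := S.contDiff_jac.continuous
        have a2 : Continuous fun x => gradient ψ (S.fn x) :=
          (ContDiff.continuous_gradient hψ).comp S.continuous_fn
        exact a1.smul a2
      have hcs : HasCompactSupport fun x => S.jac x • gradient ψ (S.fn x) :=
by
        have b1 : HasCompactSupport fun x => gradient ψ (S.fn x) :=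
          (HasCompactSupport.gradient hc).comp_homeomorph S.homeo
        exact HasCompactSupport.smul_left (f := S.jac) b1
      exact (hcont.integrable_of_hasCompactSupport hcs).restrict
    have j1 := hp.smul_integrable (hJη.continuous.integrable_of_hasCompactSupport hJηc (μ := μ))
    have j2 := hp.smul_integrable (hηv.continuous.integrable_of_hasCompactSupport hηvc (μ := μ))
    have j3 : Integrable (fun x => ψ (S.fn x) • S.cof x (f x)) μ := by
      obtain ⟨K, hK⟩ := hηc.exists_bound_of_continuous hη.continuous
      exact hci.bdd_smul K hη.continuous.aestronglyMeasurable (ae_of_all _ hK)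
    have hI : ∀ {m : Measure (Euc n)} {g : Euc n → Euc n}, Integrable g m →
        ∫ x, inner ℝ (g x) v ∂m = inner ℝ (∫ x, g x ∂m) v := fun {m g} hg => by
      simp_rw [real_inner_comm v]
      exact integral_inner hg v
    calc inner ℝ (∫ x in E, S.jac x • gradient ψ (S.fn x)) v
        = ∫ x in E, inner ℝ (S.jac x • gradient ψ (S.fn x)) v := (hI iJ).symm
      _ = ∫ x in E, (inner ℝ (gradient (fun z => S.jac z * ψ (S.fn z)) x) v
          - S.t * inner ℝ S.e (gradient (fun z => ψ (S.fn z) * fderiv ℝ S.φ z v) x)) :=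
        integral_congr_ae (ae_of_all _ fun x => S.inner_jac_smul_gradient hψ x v)
      _ = inner ℝ (∫ x in E, gradient (fun z => S.jac z * ψ (S.fn z)) x) v
          - S.t * inner ℝ S.e (∫ x in E, gradient (fun z => ψ (S.fn z) * fderiv ℝ S.φ z v) x) := by
        rw [integral_sub (i1.inner_const (𝕜 := ℝ) v) ((i2.const_inner (𝕜 := ℝ) S.e).const_mul S.t),
          integral_const_mul, hI i1, integral_inner i2]
      _ = inner ℝ (∫ x, (S.jac x * ψ (S.fn x)) • f x ∂μ) v
          - S.t * inner ℝ S.e (∫ x, (ψ (S.fn x) * fderiv ℝ S.φ x v) • f x ∂μ) := by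
        rw [hp.integral_gradient _ hJη hJηc, hp.integral_gradient _ hηv hηvc]
      _ = ∫ x, (inner ℝ ((S.jac x * ψ (S.fn x)) • f x) v
          - S.t * inner ℝ S.e ((ψ (S.fn x) * fderiv ℝ S.φ x v) • f x)) ∂μ := by
        rw [integral_sub (j1.inner_const (𝕜 := ℝ) v) ((j2.const_inner (𝕜 := ℝ) S.e).const_mul S.t),
          integral_const_mul, hI j1, integral_inner j2]
      _ = ∫ x, inner ℝ (ψ (S.fn x) • S.cof x (f x)) v ∂μ := by
        refine integral_congr_ae (ae_of_all _ fun x => ?_)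
        simp only [real_inner_smul_left, inner_smul_right, inner_cof]
        ring
      _ = inner ℝ (∫ x, ψ (S.fn x) • S.cof x (f x) ∂μ) v := hI j3

lemma real_imageMeasure (hp : IsPolar E μ f) (s : Set (Euc n)) (hs : MeasurableSet s) :
    (S.imageMeasure μ f).real s = ∫ x in S.fn ⁻¹' s, ‖S.cof x (f x)‖ ∂μ := by
  have h := S.setIntegral_imageMeasure (μ := μ) hp.measurable (fun _ => (1 : ℝ)) s hs
  simpa using h

lemma setIntegral_imageNormal (hp : IsPolar E μ f) (s : Set (Euc n)) (hs : MeasurableSet s) :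
    ∫ y in s, S.imageNormal f y ∂S.imageMeasure μ f = ∫ x in S.fn ⁻¹' s, S.cof x (f x) ∂μ := by
  rw [S.setIntegral_imageMeasure hp.measurable _ s hs]
  refine integral_congr_ae (ae_restrict_of_ae ?_)
  filter_upwards [hp.norm_eq_one] with x hx
  have h0 : f x ≠ 0 := by rw [← norm_pos_iff, hx]; exact one_pos
  have := norm_pos_iff.2 (S.cof_ne_zero x h0)
  simp only [imageNormal, S.inv_fn]
  rw [smul_smul, mul_inv_cancel₀ this.ne', one_smul]

/-- Image of a point of the reduced boundary under a shear. -/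
lemma tendsto_normalRatio_image (hn : n ≠ 0) (hp : IsPolar E μ f)
    (hE : NullMeasurableSet E volume) {x ν : Euc n} (hν : ‖ν‖ = 1)
    (ht : Tendsto (normalRatio E x) (𝓝[>] 0) (𝓝 ν)) :
    Tendsto (normalRatio (S.fn '' E) (S.fn x)) (𝓝[>] 0) (𝓝 (‖S.cof x ν‖⁻¹ • S.cof x ν)) := by
  refine hp.tendsto_normalRatio_of_transport hn hE (S.isPolar_image hp hE) S.homeo
    (fun x y => (S.norm_fn_sub_le x y).trans ?_) S.norm_sub_le_norm_fn_sub S.continuous_cof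
    S.norm_cof_sub_cof_le (fun x => ?_) (S.real_imageMeasure hp) (S.setIntegral_imageNormal hp)
    hν (S.cof_ne_zero x (by rw [← norm_pos_iff, hν]; exact one_pos)) ht
  · have := S.abs_t
    gcongr
    linarith
  · simpa using S.cof_smul x 0 0

/-- Preimage of a point of the reduced boundary of the image of a set under a shear. -/
lemma inv_mem_reducedBoundary (hn : n ≠ 0) (hp : IsPolar E μ f)
    (hE : NullMeasurableSet E volume) {y : Euc n} (hy : y ∈ reducedBoundary (S.fn '' E)) :
    S.inv y ∈ reducedBoundary E := by
  obtain ⟨ν, hν, ht⟩ := hy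
  have hν0 : ν ≠ 0 := by rw [← norm_pos_iff, hν]; exact one_pos
  have hcν : S.cofInv (S.inv y) ν ≠ 0 := fun h => hν0 (by
    have := S.cof_cofInv (S.inv y) ν
    rw [h] at this
    rw [← this]
    simpa using S.cof_smul (S.inv y) 0 0)
  have hcv : ∀ x, f x ≠ 0 → ‖S.cof x (f x)‖ ≠ 0 := fun x h => norm_ne_zero_iff.2 (S.cof_ne_zero x h)
  have hsm : ∀ x w, ∀ a : ℝ, S.cofInv x (a • w) = a • S.cofInv x w := fun x w a => by
    rw [cofInv, cofInv, inner_smul_right]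
    module
  have hkey : ∀ x, f x ≠ 0 → ‖S.cof x (f x)‖ • S.cofInv (S.inv (S.fn x)) (S.imageNormal f (S.fn x)) = f x := by
    intro x hx
    rw [S.inv_fn, imageNormal, S.inv_fn, hsm, S.cofInv_cof, smul_smul, mul_inv_cancel₀ (hcv x hx),
      one_smul]
  have hpre : ∀ s : Set (Euc n), S.fn ⁻¹' (S.homeo.symm ⁻¹' s) = s := fun s => by
    ext x; change S.inv (S.fn x) ∈ s ↔ _; rw [S.inv_fn]
  -- The same transport argument runs backwards along the inverse shear, with the inverse cofactor
  -- map; the image now plays the part of the original set.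
  refine ⟨_, ?_, (S.isPolar_image hp hE).tendsto_normalRatio_of_transport hn
    (S.nullMeasurableSet_image hE) hp S.homeo.symm
    (fun x y => S.norm_inv_sub_le x y) (fun x y => ?_) (c := fun y w => S.cofInv (S.inv y) w)
    (S.continuous_cofInv.comp ((S.continuous_inv.comp continuous_fst).prodMk continuous_snd))
    (fun x v w => S.norm_cofInv_sub_le _ v w) (fun x => by simpa using hsm (S.inv x) 0 0)
    (fun s hs => ?_) (fun s hs => ?_) hν hcν ht⟩
  · rw [norm_smul, norm_inv, norm_norm, inv_mul_cancel₀ (norm_ne_zero_iff.2 hcν)]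
  · have := S.norm_fn_sub_le (S.inv x) (S.inv y)
    rw [S.fn_inv, S.fn_inv] at this
    refine this.trans ?_
    have h4 := S.abs_t
    change _ ≤ 2 * ‖S.inv x - S.inv y‖
    gcongr
    linarith
  · have := hp.finite
    rw [S.setIntegral_imageMeasure hp.measurable _ _ (S.homeo.symm.continuous.measurable hs), hpre]
    have : ∫ x in s, (1 : ℝ) ∂μ = μ.real s := by simp
    rw [← this]
    refine integral_congr_ae (ae_restrict_of_ae ?_)
    filter_upwards [hp.norm_eq_one] with x hx
    have h0 : f x ≠ 0 := by rw [← norm_pos_iff, hx]; exact one_pos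
    have h := congrArg norm (hkey x h0)
    rw [norm_smul, norm_norm, hx] at h
    exact h.symm
  · rw [S.setIntegral_imageMeasure hp.measurable _ _ (S.homeo.symm.continuous.measurable hs), hpre]
    refine integral_congr_ae (ae_restrict_of_ae ?_)
    filter_upwards [hp.norm_eq_one] with x hx
    have h0 : f x ≠ 0 := by rw [← norm_pos_iff, hx]; exact one_pos
    exact (hkey x h0).symm

end Shear

/-! ### Stability of the anisotropic perimeter under shears -/

lemma HolderMatrix.exists_bound {Ω : Set (Euc n)} (hΩb : Bornology.IsBounded Ω)
    {A : Euc n → Matrix (Fin n) (Fin n) ℝ} {γ : ℝ} (hγ0 : 0 < γ) (hA : HolderMatrix Ω A γ) :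
    ∃ M, 0 ≤ M ∧ ∀ x ∈ Ω, ‖Matrix.toEuclideanCLM (𝕜 := ℝ) (A x)‖ ≤ M := by
  obtain ⟨C, hC⟩ := hA
  rcases Ω.eq_empty_or_nonempty with rfl | ⟨x₀, hx₀⟩
  · exact ⟨0, le_rfl, by simp⟩
  obtain ⟨R, hR⟩ := hΩb.exists_norm_le
  have hR0 : 0 ≤ R := (norm_nonneg _).trans (hR x₀ hx₀)
  refine ⟨‖Matrix.toEuclideanCLM (𝕜 := ℝ) (A x₀)‖ + |C| * (2 * R) ^ γ, by positivity, fun x hx => ?_⟩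
  have h := hC x hx x₀ hx₀
  rw [map_sub] at h
  have h1 := norm_le_norm_add_norm_sub' (Matrix.toEuclideanCLM (𝕜 := ℝ) (A x))
    (Matrix.toEuclideanCLM (𝕜 := ℝ) (A x₀))
  have h2 : C * ‖x - x₀‖ ^ γ ≤ |C| * (2 * R) ^ γ := by
    have : ‖x - x₀‖ ≤ 2 * R := (norm_sub_le _ _).trans (by linarith [hR x hx, hR x₀ hx₀])
    gcongr
    exact le_abs_self C
  linarith

lemma quadForm_sub_le (M N : Matrix (Fin n) (Fin n) ℝ) (v w : Euc n) (hv : ‖v‖ = 1) (hw : ‖w‖ = 1) :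
    quadForm M v - quadForm N w ≤ ‖Matrix.toEuclideanCLM (𝕜 := ℝ) (M - N)‖
      + 2 * ‖Matrix.toEuclideanCLM (𝕜 := ℝ) N‖ * ‖v - w‖ := by
  set a := Matrix.toEuclideanCLM (𝕜 := ℝ) M
  set b := Matrix.toEuclideanCLM (𝕜 := ℝ) N
  have e : quadForm M v - quadForm N w
      = inner ℝ ((a - b) v) v + inner ℝ (b v) (v - w) + inner ℝ (b (v - w)) w := by
    simp only [quadForm, sub_apply, map_sub, inner_sub_left, inner_sub_right]
    ring
  have hs : Matrix.toEuclideanCLM (𝕜 := ℝ) (M - N) = a - b := map_sub _ _ _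
  rw [e, hs]
  have h1 : inner ℝ ((a - b) v) v ≤ ‖a - b‖ := by
    refine (real_inner_le_norm _ _).trans ?_
    have := (a - b).le_opNorm v
    rw [hv, mul_one] at this ⊢
    exact this
  have h2 : inner ℝ (b v) (v - w) ≤ ‖b‖ * ‖v - w‖ := by
    refine (real_inner_le_norm _ _).trans ?_
    have := b.le_opNorm v
    rw [hv, mul_one] at this
    gcongr
  have h3 : inner ℝ (b (v - w)) w ≤ ‖b‖ * ‖v - w‖ := by
    refine (real_inner_le_norm _ _).trans ?_
    rw [hw, mul_one]
    exact b.le_opNorm _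
  linarith

lemma norm_normalize_sub_le {w ν : Euc n} (hν : ‖ν‖ = 1) (hw : w ≠ 0) :
    ‖‖w‖⁻¹ • w - ν‖ ≤ 2 * ‖w - ν‖ := by
  have hw' := norm_pos_iff.2 hw
  have h1 : ‖‖w‖⁻¹ • w - w‖ = |‖ν‖ - ‖w‖| := by
    have : ‖w‖⁻¹ • w - w = (‖w‖⁻¹ - 1) • w := by rw [sub_smul, one_smul]
    rw [this, norm_smul, Real.norm_eq_abs, ← abs_of_pos hw', ← abs_mul, abs_of_pos hw', hν]
    congr 1
    field_simp
  have h2 := abs_norm_sub_norm_le ν w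
  rw [norm_sub_rev ν w] at h2
  linarith [norm_sub_le_norm_sub_add_norm_sub (‖w‖⁻¹ • w) w ν]

lemma one_add_pow_le_one_add_mul (m : ℕ) {s : ℝ} (h0 : 0 ≤ s) (h1 : s ≤ 1 / 4) :
    (1 + s) ^ m ≤ 1 + 3 ^ m * s := by
  induction m with
  | zero => simp [h0]
  | succ k ih =>
    have h3 : (1 : ℝ) ≤ 3 ^ k := one_le_pow₀ (by norm_num)
    calc (1 + s) ^ (k + 1) = (1 + s) ^ k * (1 + s) := pow_succ _ _
      _ ≤ (1 + 3 ^ k * s) * (1 + s) := by gcongr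
      _ = 1 + (1 + 3 ^ k + 3 ^ k * s) * s := by ring
      _ ≤ 1 + (3 * 3 ^ k) * s := by
        gcongr
        nlinarith
      _ = _ := by rw [pow_succ]; ring

namespace Shear

variable (S : Shear n)

/-- An inequality between measures is enough, so the area formula is replaced by the behaviour of
Hausdorff measure under maps of Lipschitz constant `1 + |t|`. The exponent `n - 1` is relaxed to
`n`. -/
lemma setLIntegral_image_le (hn : 1 ≤ n) (h : Euc n → ℝ≥0∞) {T : Set (Euc n)} :
    ∫⁻ y in S.fn '' T, h y ∂surfaceMeasure n
      ≤ ENNReal.ofReal ((1 + |S.t|) ^ n) * ∫⁻ x in T, h (S.fn x) ∂surfaceMeasure n := by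
  set K : ℝ≥0 := ⟨1 + |S.t|, by positivity⟩ with hK
  have hn' : (0 : ℝ) ≤ (n : ℝ) - 1 := by
    have : (1 : ℝ) ≤ n := by exact_mod_cast hn
    linarith
  have hKn : (K : ℝ≥0∞) ^ ((n : ℝ) - 1) ≤ ENNReal.ofReal ((1 + |S.t|) ^ n) := by
    have h1 : (1 : ℝ≥0∞) ≤ K := by
      rw [ENNReal.one_le_coe_iff]
      change (1 : ℝ) ≤ 1 + |S.t|
      linarith [abs_nonneg S.t]
    refine (ENNReal.rpow_le_rpow_of_exponent_le h1 (show (n : ℝ) - 1 ≤ n by linarith)).trans ?_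
    rw [ENNReal.rpow_natCast, ENNReal.ofReal_pow (by positivity)]
    gcongr
    rw [ENNReal.ofReal, Real.toNNReal_of_nonneg (by positivity)]
    exact le_rfl
  have hmeas : (surfaceMeasure n).restrict (S.fn '' T)
      ≤ ENNReal.ofReal ((1 + |S.t|) ^ n) • ((surfaceMeasure n).restrict T).map S.fn := by
    refine Measure.le_iff.2 fun B hB => ?_
    rw [Measure.restrict_apply hB, Measure.smul_apply, smul_eq_mul,
      Measure.map_apply S.continuous_fn.measurable hB,
      Measure.restrict_apply (S.continuous_fn.measurable hB)]
    have e : B ∩ S.fn '' T = S.fn '' (S.fn ⁻¹' B ∩ T) := by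
      rw [inter_comm, inter_comm (S.fn ⁻¹' B), image_inter_preimage]
    have hl : LipschitzOnWith K S.fn (S.fn ⁻¹' B ∩ T) :=
      (LipschitzWith.of_dist_le_mul fun x y => by
        rw [dist_eq_norm, dist_eq_norm]; exact S.norm_fn_sub_le x y).lipschitzOnWith
    rw [e, surfaceMeasure, Measure.smul_apply, Measure.smul_apply, smul_eq_mul, smul_eq_mul]
    calc _ ≤ _ * ((K : ℝ≥0∞) ^ ((n : ℝ) - 1) * Measure.hausdorffMeasure ((n : ℝ) - 1) (S.fn ⁻¹' B ∩ T)) :=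
          mul_le_mul' le_rfl (hl.hausdorffMeasure_image_le hn')
      _ ≤ _ * (ENNReal.ofReal ((1 + |S.t|) ^ n) * Measure.hausdorffMeasure ((n : ℝ) - 1) (S.fn ⁻¹' B ∩ T)) :=
          mul_le_mul' le_rfl (mul_le_mul' hKn le_rfl)
      _ = _ := by ring
  refine (lintegral_mono' hmeas le_rfl).trans ?_
  rw [lintegral_smul_measure, S.measurableEmbedding_fn.lintegral_map, smul_eq_mul]

end Shear

/-- The anisotropic perimeter is Hölder stable under shears. -/
lemma exists_anisoPerimeter_image_le (hn : 1 ≤ n) {Ω : Set (Euc n)} (hΩo : IsOpen Ω)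
    (hΩb : Bornology.IsBounded Ω) {A : Euc n → Matrix (Fin n) (Fin n) ℝ} {lam Lam γ : ℝ}
    (hlam : 0 < lam) (hell : UniformlyElliptic Ω A lam Lam) (hγ0 : 0 < γ) (hγ1 : γ ≤ 1)
    (hA : HolderMatrix Ω A γ) :
    ∃ C : ℝ, 0 ≤ C ∧ ∀ S : Shear n, tsupport S.φ ⊆ Ω → ∀ E, HasFinitePerimeter E →
      anisoPerimeter A (S.fn '' E) Ω
        ≤ ENNReal.ofReal (1 + C * |S.t| ^ γ) * anisoPerimeter A E Ω := by
  obtain ⟨M, hM0, hM⟩ := hA.exists_bound hΩb hγ0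
  obtain ⟨H, hH⟩ := hA
  -- `|H|` accounts for moving the base point of `A`, `8 M` for turning the normal by at most
  -- `4|t|`. Division by `lam` makes the additive error relative.
  set K : ℝ := (|H| + 8 * M) / lam with hK
  have hK0 : 0 ≤ K := by positivity
  refine ⟨3 ^ n + K + 3 ^ n * K, by positivity, fun S hS E hE => ?_⟩
  obtain ⟨f, hp⟩ := hE.exists_polar
  set a : ℝ := |S.t| ^ γ
  have ha0 : 0 ≤ a := by positivity
  have ht1 : |S.t| ≤ 1 := S.abs_t.trans (by norm_num)
  have ha1 : a ≤ 1 := Real.rpow_le_one (abs_nonneg _) ht1 hγ0.le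
  -- Since `|t| ≤ 1` and `γ ≤ 1`, Lipschitz errors are absorbed into the Hölder one.
  have hta : |S.t| ≤ a := by
    rcases (abs_nonneg S.t).eq_or_lt with h | h
    · rw [← h]; exact ha0
    · simpa using Real.rpow_le_rpow_of_exponent_ge h ht1 hγ1
  have hΩS := S.image_eq_of_tsupport_subset hS
  set T := Ω ∩ reducedBoundary E
  have hT : MeasurableSet T := hΩo.measurableSet.inter hp.measurableSet_reducedBoundary
  -- For an upper bound only this inclusion is needed, not equality.
  have hsub : Ω ∩ reducedBoundary (S.fn '' E) ⊆ S.fn '' T := by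
    rintro y ⟨hy, hyr⟩
    refine ⟨S.inv y, ⟨?_, S.inv_mem_reducedBoundary (by omega) hp hE.1 hyr⟩, S.fn_inv y⟩
    rw [← hΩS] at hy
    obtain ⟨x, hx, rfl⟩ := hy
    rwa [S.inv_fn]
  have hpt : ∀ x ∈ T, ENNReal.ofReal (Real.sqrt (quadForm (A (S.fn x))
      (outerNormal (S.fn '' E) (S.fn x)))) ≤
      ENNReal.ofReal (1 + K * a) * ENNReal.ofReal (Real.sqrt (quadForm (A x) (outerNormal E x))) := by
    rintro x ⟨hx, ν, hν, ht⟩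
    have hν0 : ν ≠ 0 := by rw [← norm_pos_iff, hν]; exact one_pos
    have hc0 := S.cof_ne_zero x hν0
    have hy : S.fn x ∈ Ω := by rw [← hΩS]; exact mem_image_of_mem _ hx
    rw [outerNormal_eq ht, outerNormal_eq (S.tendsto_normalRatio_image (by omega) hp hE.1 hν ht),
      ← ENNReal.ofReal_mul (by positivity)]
    refine ENNReal.ofReal_le_ofReal ?_
    set ν' := ‖S.cof x ν‖⁻¹ • S.cof x ν
    have hν' : ‖ν'‖ = 1 := by
      rw [norm_smul, norm_inv, norm_norm, inv_mul_cancel₀ (norm_ne_zero_iff.2 hc0)]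
    have hd : ‖ν' - ν‖ ≤ 4 * |S.t| := by
      have h1 := norm_normalize_sub_le hν hc0
      have h2 := S.norm_cof_sub_le x ν
      rw [hν] at h2
      linarith
    have hq := quadForm_sub_le (A (S.fn x)) (A x) ν' ν hν' hν
    have h1 : ‖Matrix.toEuclideanCLM (𝕜 := ℝ) (A (S.fn x) - A x)‖ ≤ |H| * a := by
      refine (hH _ hy _ hx).trans ?_
      have := S.norm_fn_sub_self_le x
      gcongr
      · exact le_abs_self H
      · exact Real.rpow_le_rpow (norm_nonneg _) this hγ0.le
    have h2 : 2 * ‖Matrix.toEuclideanCLM (𝕜 := ℝ) (A x)‖ * ‖ν' - ν‖ ≤ 8 * M * a := by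
      calc _ ≤ 2 * M * (4 * a) := by
            gcongr
            · exact hM x hx
            · linarith
        _ = _ := by ring
    have hqlow : lam ≤ quadForm (A x) ν := by simpa [hν] using (hell x hx ν).1
    have h3 : quadForm (A (S.fn x)) ν' ≤ (1 + K * a) ^ 2 * quadForm (A x) ν := by
      have e : K * lam = |H| + 8 * M := by rw [hK]; field_simp
      have h4 : quadForm (A (S.fn x)) ν' ≤ quadForm (A x) ν + K * a * lam := by
        have : K * a * lam = (|H| + 8 * M) * a := by rw [← e]; ring
        rw [this]; linarith
      have h5 : K * a * lam ≤ K * a * quadForm (A x) ν := by gcongr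
      have h6 : 0 ≤ K * a * (1 + K * a) * quadForm (A x) ν := by
        have : 0 ≤ quadForm (A x) ν := hlam.le.trans hqlow
        positivity
      nlinarith
    calc Real.sqrt (quadForm (A (S.fn x)) ν') ≤ Real.sqrt ((1 + K * a) ^ 2 * quadForm (A x) ν) :=
          Real.sqrt_le_sqrt h3
      _ = _ := by rw [Real.sqrt_mul (by positivity), Real.sqrt_sq (by positivity)]
  calc anisoPerimeter A (S.fn '' E) Ω
      ≤ ∫⁻ y in S.fn '' T, ENNReal.ofReal (Real.sqrt (quadForm (A y)
        (outerNormal (S.fn '' E) y))) ∂surfaceMeasure n := lintegral_mono_set hsub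
    _ ≤ ENNReal.ofReal ((1 + |S.t|) ^ n) * ∫⁻ x in T, ENNReal.ofReal (Real.sqrt
        (quadForm (A (S.fn x)) (outerNormal (S.fn '' E) (S.fn x)))) ∂surfaceMeasure n :=
      S.setLIntegral_image_le hn _
    _ ≤ ENNReal.ofReal ((1 + |S.t|) ^ n) * ∫⁻ x in T, ENNReal.ofReal (1 + K * a) *
        ENNReal.ofReal (Real.sqrt (quadForm (A x) (outerNormal E x))) ∂surfaceMeasure n :=
      mul_le_mul' le_rfl (setLIntegral_mono' hT hpt)
    _ = ENNReal.ofReal ((1 + |S.t|) ^ n) * ENNReal.ofReal (1 + K * a) * anisoPerimeter A E Ω := by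
      rw [lintegral_const_mul' _ _ ENNReal.ofReal_ne_top, mul_assoc]
      rfl
    _ ≤ _ := by
      refine mul_le_mul' ?_ le_rfl
      rw [← ENNReal.ofReal_mul (by positivity)]
      refine ENNReal.ofReal_le_ofReal ?_
      have h1 := one_add_pow_le_one_add_mul n (abs_nonneg S.t) S.abs_t
      have h2 : (1 + |S.t|) ^ n ≤ 1 + 3 ^ n * a := h1.trans (by gcongr)
      calc (1 + |S.t|) ^ n * (1 + K * a) ≤ (1 + 3 ^ n * a) * (1 + K * a) := by gcongr
        _ = 1 + (3 ^ n + K + 3 ^ n * K * a) * a := by ring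
        _ ≤ 1 + (3 ^ n + K + 3 ^ n * K * 1) * a := by gcongr
        _ = _ := by ring

/-! ### Mollification in `L²` -/

section MollifyLp

variable {F : Type*} [NormedAddCommGroup F] [NormedSpace ℝ F]

/-- Mollification of a vector-valued function. -/
noncomputable def vmollify (b : ContDiffBump (0 : Euc n)) (g : Euc n → F) (x : Euc n) : F :=
  ∫ y, b.normed volume (x - y) • g y

lemma vmollify_eq_convolution (b : ContDiffBump (0 : Euc n)) (g : Euc n → F) :
    vmollify b g = convolution (b.normed volume) g (ContinuousLinearMap.lsmul ℝ ℝ) volume := by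
  ext x
  rw [convolution_lsmul_swap]
  rfl

lemma lintegral_enorm_normed_sub_left (b : ContDiffBump (0 : Euc n)) (x : Euc n) :
    ∫⁻ y, ‖b.normed volume (x - y)‖ₑ = 1 := by
  rw [lintegral_sub_left_eq_self (fun y => ‖b.normed volume y‖ₑ) x]
  simp_rw [Real.enorm_of_nonneg (b.nonneg_normed _)]
  rw [← ofReal_integral_eq_lintegral_ofReal b.integrable_normed (ae_of_all _ fun y => b.nonneg_normed _),
    b.integral_normed, ENNReal.ofReal_one]

lemma lintegral_enorm_normed_sub_right (b : ContDiffBump (0 : Euc n)) (y : Euc n) :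
    ∫⁻ x, ‖b.normed volume (x - y)‖ₑ = 1 := by
  have h := lintegral_enorm_normed_sub_left b 0
  rw [lintegral_sub_left_eq_self (fun y => ‖b.normed volume y‖ₑ) 0] at h
  rw [lintegral_sub_right_eq_self (fun y => ‖b.normed volume y‖ₑ) y, h]

/-- Jensen's inequality for the probability density `b(x - ·)`, in the guise of the inclusion of
`L²` in `L¹`. -/
lemma enorm_vmollify_sq_le (b : ContDiffBump (0 : Euc n)) {g : Euc n → F}
    (hg : AEStronglyMeasurable g volume) (x : Euc n) :
    ‖vmollify b g x‖ₑ ^ 2 ≤ ∫⁻ y, ‖b.normed volume (x - y)‖ₑ * ‖g y‖ₑ ^ 2 := by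
  set ρ : Euc n → ℝ≥0∞ := fun y => ‖b.normed volume (x - y)‖ₑ with hρ
  have hρm : Measurable ρ := ((b.continuous_normed).comp
    (continuous_const.sub continuous_id)).enorm.measurable
  have hprob : IsProbabilityMeasure (volume.withDensity ρ) :=
    ⟨by rw [withDensity_apply _ MeasurableSet.univ, setLIntegral_univ, lintegral_enorm_normed_sub_left b x]⟩
  have hg' : AEStronglyMeasurable g (volume.withDensity ρ) :=
    hg.mono_ac (withDensity_absolutelyContinuous _ _)
  have h1 := eLpNorm_le_eLpNorm_of_exponent_le (μ := volume.withDensity ρ) (p := 1) (q := 2)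
    one_le_two hg'
  rw [eLpNorm_one_eq_lintegral_enorm, eLpNorm_eq_lintegral_rpow_enorm_toReal two_ne_zero
    ENNReal.ofNat_ne_top, lintegral_withDensity_eq_lintegral_mul₀ hρm.aemeasurable hg.enorm,
    lintegral_withDensity_eq_lintegral_mul₀ hρm.aemeasurable (hg.enorm.pow_const _)] at h1
  have h2 : ‖vmollify b g x‖ₑ ≤ ∫⁻ y, (ρ * fun y => ‖g y‖ₑ) y := by
    refine (enorm_integral_le_lintegral_enorm _).trans (lintegral_mono fun y => ?_)
    rw [enorm_smul]; rfl
  calc ‖vmollify b g x‖ₑ ^ 2 ≤ ((∫⁻ y, (ρ * fun y => ‖g y‖ₑ ^ (2 : ℝ≥0∞).toReal) y)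
        ^ (1 / (2 : ℝ≥0∞).toReal)) ^ 2 := by gcongr; exact h2.trans h1
    _ = ∫⁻ y, (ρ * fun y => ‖g y‖ₑ ^ (2 : ℝ≥0∞).toReal) y := by
        rw [← ENNReal.rpow_natCast, ← ENNReal.rpow_mul]
        norm_num
    _ = _ := by
        refine lintegral_congr fun y => ?_
        simp [hρ]

lemma eLpNorm_vmollify_le (b : ContDiffBump (0 : Euc n)) {g : Euc n → F}
    (hg : AEStronglyMeasurable g volume) : eLpNorm (vmollify b g) 2 volume ≤ eLpNorm g 2 volume := by
  rw [eLpNorm_eq_lintegral_rpow_enorm_toReal two_ne_zero ENNReal.ofNat_ne_top,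
    eLpNorm_eq_lintegral_rpow_enorm_toReal two_ne_zero ENNReal.ofNat_ne_top]
  refine ENNReal.rpow_le_rpow ?_ (by positivity)
  simp only [ENNReal.toReal_ofNat, ENNReal.rpow_ofNat]
  have hm : AEMeasurable (Function.uncurry fun x y : Euc n => ‖b.normed volume (x - y)‖ₑ * ‖g y‖ₑ ^ 2)
      (volume.prod volume) := by
    have h1 : Measurable fun p : Euc n × Euc n => ‖b.normed volume (p.1 - p.2)‖ₑ :=
      ((b.continuous_normed).comp (continuous_fst.sub continuous_snd)).enorm.measurable
    exact h1.aemeasurable.mul ((hg.enorm.pow_const 2).comp_quasiMeasurePreserving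
      Measure.quasiMeasurePreserving_snd)
  calc ∫⁻ x, ‖vmollify b g x‖ₑ ^ 2 ≤ ∫⁻ x, ∫⁻ y, ‖b.normed volume (x - y)‖ₑ * ‖g y‖ₑ ^ 2 :=
        lintegral_mono fun x => enorm_vmollify_sq_le b hg x
    _ = ∫⁻ y, ∫⁻ x, ‖b.normed volume (x - y)‖ₑ * ‖g y‖ₑ ^ 2 := lintegral_lintegral_swap hm
    _ = ∫⁻ y, ‖g y‖ₑ ^ 2 := by
        refine lintegral_congr fun y => ?_
        have h1 : Measurable fun x : Euc n => ‖b.normed volume (x - y)‖ₑ :=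
          ((b.continuous_normed).comp (continuous_id.sub continuous_const)).enorm.measurable
        rw [lintegral_mul_const _ h1, lintegral_enorm_normed_sub_right, one_mul]

lemma continuous_vmollify [CompleteSpace F] (b : ContDiffBump (0 : Euc n)) {g : Euc n → F}
    (hg : LocallyIntegrable g volume) : Continuous (vmollify b g) := by
  rw [vmollify_eq_convolution]
  exact b.hasCompactSupport_normed.continuous_convolution_left _ b.continuous_normed hg

lemma integrable_normed_sub_smul (b : ContDiffBump (0 : Euc n)) {g : Euc n → F}
    (hg : LocallyIntegrable g volume) (x : Euc n) :
    Integrable fun y => b.normed volume (x - y) • g y :=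
  hg.integrable_smul_left_of_hasCompactSupport (contDiff_normed_sub b x).continuous
    (hasCompactSupport_normed_sub b x)

lemma vmollify_sub (b : ContDiffBump (0 : Euc n)) {g k : Euc n → F}
    (hg : LocallyIntegrable g volume) (hk : LocallyIntegrable k volume) :
    vmollify b (g - k) = vmollify b g - vmollify b k := by
  ext1 x
  simp only [vmollify, Pi.sub_apply, smul_sub]
  exact integral_sub (integrable_normed_sub_smul b hg x) (integrable_normed_sub_smul b hk x)

/-- Uniform continuity gives uniform smallness, and for radii below one the difference lives on a
fixed compact thickening of the support. -/
lemma tendsto_eLpNorm_vmollify_sub_of_continuous [CompleteSpace F] {k : Euc n → F}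
    (hk : Continuous k) (hc : HasCompactSupport k) {ε : ℝ≥0∞} (hε : ε ≠ 0) :
    ∃ δ₀ > 0, ∀ δ (hδ : 0 < δ), δ < δ₀ →
      eLpNorm (vmollify (smallBump δ hδ) k - k) 2 volume ≤ ε := by
  have hK : IsCompact (Metric.cthickening 1 (tsupport k)) := hc.isCompact.cthickening
  set V := volume (Metric.cthickening 1 (tsupport k)) with hV
  have hVt : V ≠ ⊤ := hK.measure_lt_top.ne
  obtain ⟨η, hη, hηε⟩ : ∃ η : ℝ, 0 < η ∧ ENNReal.ofReal η * V ^ (1 / (2 : ℝ)) ≤ ε := by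
    have h1 : V ^ (1 / (2 : ℝ)) ≠ ⊤ := by finiteness
    obtain ⟨η, hη0, hη⟩ := ENNReal.exists_nnreal_pos_mul_lt h1 hε
    refine ⟨η, hη0, ?_⟩
    rw [ENNReal.ofReal_coe_nnreal]
    exact hη.le
  obtain ⟨δ₁, hδ₁, hu⟩ := Metric.uniformContinuous_iff.1
    (hc.uniformContinuous_of_continuous hk) η hη
  refine ⟨min δ₁ 1, by positivity, fun δ hδ hlt => ?_⟩
  have hδ1 : δ < δ₁ := hlt.trans_le (min_le_left _ _)
  have hδ2 : δ < 1 := hlt.trans_le (min_le_right _ _)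
  set b := smallBump (n := n) δ hδ
  have hb : b.rOut = δ / 2 := rfl
  have h1 : ∀ x, ‖(vmollify b k - k) x‖ ≤ η := by
    intro x
    rw [Pi.sub_apply, ← dist_eq_norm, vmollify_eq_convolution]
    refine b.dist_normed_convolution_le hk.aestronglyMeasurable fun y hy => (hu ?_).le
    rw [hb] at hy
    exact (Metric.mem_ball.1 hy).trans (by linarith)
  have h2 : ∀ x, x ∉ Metric.cthickening 1 (tsupport k) → (vmollify b k - k) x = 0 := by
    intro x hx
    have hx' : ∀ y ∈ tsupport k, 1 < dist x y := fun y hy => by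
      by_contra! h
      exact hx (Metric.mem_cthickening_of_dist_le x y 1 _ hy h)
    have e1 : k x = 0 := image_eq_zero_of_notMem_tsupport fun h => by
      have := hx' x h; rw [dist_self] at this; linarith
    rw [Pi.sub_apply, e1, sub_zero, vmollify]
    refine integral_eq_zero_of_ae (ae_of_all _ fun y => ?_)
    by_cases hy : y ∈ tsupport k
    · have : b.normed volume (x - y) = 0 := by
        have : x - y ∉ Function.support (b.normed volume) := by
          rw [b.support_normed_eq, mem_ball_zero_iff, ← dist_eq_norm, hb]
          have := hx' y hy
          linarith
        simpa using this
      simp [this]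
    · simp [image_eq_zero_of_notMem_tsupport hy]
  have h3 : eLpNorm (vmollify b k - k) 2 volume
      = eLpNorm (vmollify b k - k) 2 (volume.restrict (Metric.cthickening 1 (tsupport k))) := by
    rw [← eLpNorm_indicator_eq_eLpNorm_restrict Metric.isClosed_cthickening.measurableSet]
    congr 1
    exact (indicator_eq_self.2 fun x hx => by_contra fun h => hx (h2 x h)).symm
  rw [h3]
  refine (eLpNorm_le_of_ae_bound (ae_of_all _ h1)).trans ?_
  rw [Measure.restrict_apply_univ, mul_comm]
  have e : ((2 : ℝ≥0∞).toReal)⁻¹ = 1 / 2 := by norm_num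
  rw [e]
  exact hηε

/-- Mollifications converge in `L²`. -/
lemma exists_eLpNorm_vmollify_sub_le [CompleteSpace F] {g : Euc n → F} (hg : MemLp g 2 volume)
    {ε : ℝ≥0∞} (hε : ε ≠ 0) :
    ∃ δ₀ > 0, ∀ δ (hδ : 0 < δ), δ < δ₀ →
      eLpNorm (vmollify (smallBump δ hδ) g - g) 2 volume ≤ ε := by
  have hε3 : ε / 3 ≠ 0 := by simp [hε]
  obtain ⟨k, hkc, hgk, hk, hkL⟩ := hg.exists_hasCompactSupport_eLpNorm_sub_le ENNReal.ofNat_ne_top hε3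
  obtain ⟨δ₀, hδ₀, h⟩ := tendsto_eLpNorm_vmollify_sub_of_continuous hk hkc hε3
  refine ⟨δ₀, hδ₀, fun δ hδ hlt => ?_⟩
  set b := smallBump (n := n) δ hδ
  have hgl := hg.locallyIntegrable one_le_two
  have hkl := hkL.locallyIntegrable one_le_two
  -- Approximation by a continuous `k` of compact support; mollification does not increase the `L²`
  -- norm, so each of the three terms costs `ε / 3`.
  have e : vmollify b g - g = vmollify b (g - k) + (vmollify b k - k) + (k - g) := by
    rw [vmollify_sub b hgl hkl]; abel
  have m1 : AEStronglyMeasurable (vmollify b (g - k)) volume :=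
    (continuous_vmollify b (hgl.sub hkl)).aestronglyMeasurable
  have m2 : AEStronglyMeasurable (vmollify b k - k) volume :=
    ((continuous_vmollify b hkl).sub hk).aestronglyMeasurable
  have m3 : AEStronglyMeasurable (k - g) volume := (hkL.sub hg).1
  rw [e]
  calc _ ≤ eLpNorm (vmollify b (g - k)) 2 volume + eLpNorm (vmollify b k - k) 2 volume
        + eLpNorm (k - g) 2 volume :=
        (eLpNorm_add_le (m1.add m2) m3 one_le_two).trans
          (add_le_add (eLpNorm_add_le m1 m2 one_le_two) le_rfl)
    _ ≤ ε / 3 + ε / 3 + ε / 3 := by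
        refine add_le_add (add_le_add ((eLpNorm_vmollify_le b (hg.sub hkL).1).trans hgk) (h δ hδ hlt)) ?_
        rw [eLpNorm_sub_comm]
        exact hgk
    _ = ε := ENNReal.add_thirds ε

end MollifyLp

/-! ### Sobolev functions -/

section Sobolev

variable {G G' : Set (Euc n)} {u w : Euc n → ℝ} {g k : Euc n → Euc n} {φ ψ : Euc n → ℝ}

lemma integrable_smul_of_memLp_two {F : Type*} [NormedAddCommGroup F] [NormedSpace ℝ F]
    {μ : Measure (Euc n)} {φ : Euc n → ℝ} {g : Euc n → F} (hφ : MemLp φ 2 μ) (hg : MemLp g 2 μ) :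
    Integrable (fun x => φ x • g x) μ :=
  memLp_one_iff_integrable.1 (hg.smul hφ)

lemma enorm_integral_smul_le {F : Type*} [NormedAddCommGroup F] [NormedSpace ℝ F]
    {μ : Measure (Euc n)} {φ : Euc n → ℝ} {g : Euc n → F} (hφ : MemLp φ 2 μ) (hg : MemLp g 2 μ) :
    ‖∫ x, φ x • g x ∂μ‖ₑ ≤ eLpNorm φ 2 μ * eLpNorm g 2 μ := by
  refine (enorm_integral_le_lintegral_enorm _).trans ?_
  rw [← eLpNorm_one_eq_lintegral_enorm]
  exact eLpNorm_smul_le_mul_eLpNorm hg.1 hφ.1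

lemma IsTest.memLp (h : IsTest G φ) (μ : Measure (Euc n)) [IsFiniteMeasureOnCompacts μ] :
    MemLp φ 2 μ := h.1.continuous.memLp_of_hasCompactSupport h.2.1

lemma IsTest.memLp_gradient (h : IsTest G φ) (μ : Measure (Euc n)) [IsFiniteMeasureOnCompacts μ] :
    MemLp (gradient φ) 2 μ :=
  (ContDiff.continuous_gradient (h.1.of_le (by simp))).memLp_of_hasCompactSupport
    (HasCompactSupport.gradient h.2.1)

lemma IsTest.mono (h : IsTest G φ) (hG : G ⊆ G') : IsTest G' φ := ⟨h.1, h.2.1, h.2.2.trans hG⟩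

lemma IsTest.add (h : IsTest G φ) (h' : IsTest G ψ) : IsTest G (fun x => φ x + ψ x) :=
  ⟨h.1.add h'.1, h.2.1.add h'.2.1,
    (tsupport_add φ ψ).trans (union_subset h.2.2 h'.2.2)⟩

lemma IsTest.mul_left (h : IsTest G φ) (hψ : ContDiff ℝ ∞ ψ) : IsTest G (fun x => ψ x * φ x) :=
  ⟨hψ.mul h.1, h.2.1.mul_left, (tsupport_mul_subset_right).trans h.2.2⟩

lemma IsTest.setIntegral_eq {F : Type*} [NormedAddCommGroup F] [NormedSpace ℝ F] (h : IsTest G φ)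
    (g : Euc n → F) : ∫ x in G, φ x • g x = ∫ x, φ x • g x :=
  setIntegral_eq_integral_of_forall_compl_eq_zero fun x hx => by
    rw [image_eq_zero_of_notMem_tsupport fun H => hx (h.2.2 H), zero_smul]

lemma IsTest.setIntegral_gradient_eq (h : IsTest G φ) (u : Euc n → ℝ) :
    ∫ x in G, u x • gradient φ x = ∫ x, u x • gradient φ x :=
  setIntegral_eq_integral_of_forall_compl_eq_zero fun x hx => by
    rw [gradient_eq_zero_of_notMem fun H => hx (h.2.2 H), smul_zero]

/-- Weak gradients are unique. -/
lemma IsWeakGradient.ae_eq (hG : IsOpen G) (h : IsWeakGradient G u g) (h' : IsWeakGradient G u k) :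
    g =ᵐ[volume.restrict G] k := by
  have hl : LocallyIntegrable (g - k) (volume.restrict G) :=
    (h.1.sub h'.1).locallyIntegrable one_le_two
  have := hG.ae_eq_zero_of_integral_contDiff_smul_eq_zero (μ := volume.restrict G)
    (f := g - k) (hl.locallyIntegrableOn G) fun φ hφ hc hs => by
      have ht : IsTest G φ := ⟨hφ, hc, hs⟩
      have e := (h.2 φ ht).symm.trans (h'.2 φ ht)
      simp only [Pi.sub_apply, smul_sub]
      rw [integral_sub (integrable_smul_of_memLp_two (ht.memLp _) h.1)
        (integrable_smul_of_memLp_two (ht.memLp _) h'.1), neg_injective e, sub_self]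
  filter_upwards [this, ae_restrict_mem hG.measurableSet] with x hx hxG
  exact sub_eq_zero.1 (hx hxG)

lemma weakGradient_spec (h : ∃ g, IsWeakGradient G u g) : IsWeakGradient G u (weakGradient G u) := by
  rw [weakGradient, dif_pos h]
  exact Classical.choose_spec h

lemma IsWeakGradient.weakGradient_ae_eq (hG : IsOpen G) (h : IsWeakGradient G u g) :
    weakGradient G u =ᵐ[volume.restrict G] g :=
  (weakGradient_spec ⟨g, h⟩).ae_eq hG h

lemma IsWeakGradient.congr (h : IsWeakGradient G u g) (hu : u =ᵐ[volume.restrict G] w)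
    (hg : g =ᵐ[volume.restrict G] k) : IsWeakGradient G w k := by
  refine ⟨(memLp_congr_ae hg).1 h.1, fun φ hφ => ?_⟩
  have e1 : ∫ x in G, w x • gradient φ x = ∫ x in G, u x • gradient φ x :=
    integral_congr_ae (hu.mono fun x hx => by simp only [hx])
  have e2 : ∫ x in G, φ x • k x = ∫ x in G, φ x • g x :=
    integral_congr_ae (hg.mono fun x hx => by simp only [hx])
  rw [e1, e2, h.2 φ hφ]

lemma IsWeakGradient.mono (h : IsWeakGradient G u g) (hG : G' ⊆ G) : IsWeakGradient G' u g := by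
  refine ⟨h.1.mono_measure (Measure.restrict_mono hG le_rfl), fun φ hφ => ?_⟩
  have hφ' := hφ.mono hG
  rw [hφ.setIntegral_gradient_eq, hφ.setIntegral_eq, ← hφ'.setIntegral_gradient_eq, h.2 φ hφ',
    hφ'.setIntegral_eq]

lemma MemH1.mono (h : MemH1 G u) (hG : G' ⊆ G) : MemH1 G' u :=
  ⟨h.1.mono_measure (Measure.restrict_mono hG le_rfl), h.2.imp fun _ h => h.mono hG⟩

lemma IsWeakGradient.add (hu : MemLp u 2 (volume.restrict G)) (hw : MemLp w 2 (volume.restrict G))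
    (h : IsWeakGradient G u g) (h' : IsWeakGradient G w k) :
    IsWeakGradient G (fun x => u x + w x) (fun x => g x + k x) := by
  refine ⟨h.1.add h'.1, fun φ hφ => ?_⟩
  simp only [add_smul, smul_add]
  rw [integral_add (integrable_smul_of_memLp_two hu (hφ.memLp_gradient _))
    (integrable_smul_of_memLp_two hw (hφ.memLp_gradient _)),
    integral_add (integrable_smul_of_memLp_two (hφ.memLp _) h.1)
    (integrable_smul_of_memLp_two (hφ.memLp _) h'.1), h.2 φ hφ, h'.2 φ hφ, neg_add]

lemma IsWeakGradient.neg (h : IsWeakGradient G u g) :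
    IsWeakGradient G (fun x => - u x) (fun x => - g x) := by
  refine ⟨h.1.neg, fun φ hφ => ?_⟩
  simp only [neg_smul, smul_neg, integral_neg]
  rw [h.2 φ hφ]

lemma MemH1.add (hu : MemH1 G u) (hw : MemH1 G w) : MemH1 G (fun x => u x + w x) := by
  obtain ⟨g, hg⟩ := hu.2
  obtain ⟨k, hk⟩ := hw.2
  exact ⟨hu.1.add hw.1, _, hg.add hu.1 hw.1 hk⟩

lemma MemH1.neg (hu : MemH1 G u) : MemH1 G (fun x => - u x) := by
  obtain ⟨g, hg⟩ := hu.2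
  exact ⟨hu.1.neg, _, hg.neg⟩

lemma MemH1.sub (hu : MemH1 G u) (hw : MemH1 G w) : MemH1 G (fun x => u x - w x) := by
  simpa only [sub_eq_add_neg] using hu.add hw.neg

lemma IsTest.isWeakGradient (h : IsTest G' φ) : IsWeakGradient G φ (gradient φ) := by
  refine ⟨h.memLp_gradient _, fun ψ hψ => ?_⟩
  rw [hψ.setIntegral_gradient_eq, hψ.setIntegral_eq, eq_neg_iff_add_eq_zero]
  have h1 := integral_gradient_eq_zero (φ := fun x => φ x * ψ x) ((h.1.mul hψ.1).of_le (by simp))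
    (hψ.2.1.mul_left)
  rw [← integral_add (integrable_smul_of_memLp_two (h.memLp _) (hψ.memLp_gradient _))
    (integrable_smul_of_memLp_two (hψ.memLp _) (h.memLp_gradient _)), ← h1]
  refine integral_congr_ae (ae_of_all _ fun x => ?_)
  simp only
  rw [gradient_mul (h.1.differentiable (by simp) x) (hψ.1.differentiable (by simp) x)]

/-- Weak gradients are stable under `H¹` limits of test functions. -/
lemma isWeakGradient_of_approx (hw : MemLp w 2 (volume.restrict G))
    (hg : MemLp g 2 (volume.restrict G))
    (h : ∀ ε : ℝ≥0∞, 0 < ε → ∃ φ : Euc n → ℝ, IsTest G φ ∧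
      eLpNorm (fun x => w x - φ x) 2 (volume.restrict G) < ε ∧
      eLpNorm (fun x => g x - gradient φ x) 2 (volume.restrict G) < ε) :
    IsWeakGradient G w g := by
  refine ⟨hg, fun ψ hψ => ?_⟩
  rw [eq_neg_iff_add_eq_zero, ← enorm_eq_zero]
  set C := eLpNorm (gradient ψ) 2 (volume.restrict G) + eLpNorm ψ 2 (volume.restrict G) with hC
  have hCt : C ≠ ⊤ := ENNReal.add_ne_top.2 ⟨(hψ.memLp_gradient _).2.ne, (hψ.memLp _).2.ne⟩
  refine le_antisymm (ENNReal.le_of_forall_pos_le_add fun η hη _ => ?_) bot_le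
  obtain ⟨ε, hε0, hε⟩ := ENNReal.exists_nnreal_pos_mul_lt hCt
    (ENNReal.coe_ne_zero.2 hη.ne')
  obtain ⟨φ, hφ, h1, h2⟩ := h ε (by exact_mod_cast hε0)
  have e := (hφ.isWeakGradient (G := G)).2 ψ hψ
  rw [eq_neg_iff_add_eq_zero] at e
  have m1 : MemLp (fun x => w x - φ x) 2 (volume.restrict G) := hw.sub (hφ.memLp _)
  have m2 : MemLp (fun x => g x - gradient φ x) 2 (volume.restrict G) := hg.sub (hφ.memLp_gradient _)
  have e2 : (∫ x in G, w x • gradient ψ x) + ∫ x in G, ψ x • g x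
      = (∫ x in G, (w x - φ x) • gradient ψ x) + ∫ x in G, ψ x • (g x - gradient φ x) := by
    simp only [sub_smul, smul_sub]
    rw [integral_sub (integrable_smul_of_memLp_two hw (hψ.memLp_gradient _))
      (integrable_smul_of_memLp_two (hφ.memLp _) (hψ.memLp_gradient _)),
      integral_sub (integrable_smul_of_memLp_two (hψ.memLp _) hg)
      (integrable_smul_of_memLp_two (hψ.memLp _) (hφ.memLp_gradient _)), ← sub_zero (_ + _), ← e]
    abel
  rw [e2, zero_add]
  calc _ ≤ ‖∫ x in G, (w x - φ x) • gradient ψ x‖ₑ + ‖∫ x in G, ψ x • (g x - gradient φ x)‖ₑ :=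
        enorm_add_le _ _
    _ ≤ ε * eLpNorm (gradient ψ) 2 (volume.restrict G) + eLpNorm ψ 2 (volume.restrict G) * ε := by
        refine add_le_add ((enorm_integral_smul_le m1 (hψ.memLp_gradient _)).trans ?_)
          ((enorm_integral_smul_le (hψ.memLp _) m2).trans ?_)
        · exact mul_le_mul' h1.le le_rfl
        · exact mul_le_mul' le_rfl h2.le
    _ = ε * C := by rw [hC]; ring
    _ ≤ η := hε.le

/-- `MemH10` speaks of the chosen `weakGradient`; here any candidate gradient may be used, the limit
itself showing that it is a weak gradient. -/
lemma memH10_of_approx (hG : IsOpen G) (hw : MemLp w 2 (volume.restrict G))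
    (hg : MemLp g 2 (volume.restrict G))
    (h : ∀ ε : ℝ≥0∞, 0 < ε → ∃ φ : Euc n → ℝ, IsTest G φ ∧
      eLpNorm (fun x => w x - φ x) 2 (volume.restrict G) < ε ∧
      eLpNorm (fun x => g x - gradient φ x) 2 (volume.restrict G) < ε) :
    MemH10 G w := by
  have hwg := isWeakGradient_of_approx hw hg h
  refine ⟨⟨hw, g, hwg⟩, fun ε hε => ?_⟩
  obtain ⟨φ, hφ, h1, h2⟩ := h ε hε
  refine ⟨φ, hφ, h1, ?_⟩
  rwa [eLpNorm_congr_ae (g := fun x => g x - gradient φ x)]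
  filter_upwards [hwg.weakGradient_ae_eq hG] with x hx
  rw [hx]

lemma MemH10.approx (hG : IsOpen G) (h : MemH10 G w) (hg : IsWeakGradient G w g) :
    ∀ ε : ℝ≥0∞, 0 < ε → ∃ φ : Euc n → ℝ, IsTest G φ ∧
      eLpNorm (fun x => w x - φ x) 2 (volume.restrict G) < ε ∧
      eLpNorm (fun x => g x - gradient φ x) 2 (volume.restrict G) < ε := by
  intro ε hε
  obtain ⟨φ, hφ, h1, h2⟩ := h.2 ε hε
  refine ⟨φ, hφ, h1, ?_⟩
  rwa [eLpNorm_congr_ae (g := fun x => weakGradient G w x - gradient φ x)]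
  filter_upwards [hg.weakGradient_ae_eq hG] with x hx
  rw [hx]

lemma MemH10.add (hG : IsOpen G) (hu : MemH10 G u) (hw : MemH10 G w) :
    MemH10 G (fun x => u x + w x) := by
  obtain ⟨g, hg⟩ := hu.1.2
  obtain ⟨k, hk⟩ := hw.1.2
  refine memH10_of_approx hG (hu.1.1.add hw.1.1) (hg.1.add hk.1) fun ε hε => ?_
  have hε2 : 0 < ε / 2 := ENNReal.half_pos hε.ne'
  obtain ⟨φ, hφ, h1, h2⟩ := hu.approx hG hg _ hε2
  obtain ⟨ψ, hψ, h3, h4⟩ := hw.approx hG hk _ hε2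
  refine ⟨_, hφ.add hψ, ?_, ?_⟩
  · have e : (fun x => u x + w x - (φ x + ψ x)) = (fun x => u x - φ x) + fun x => w x - ψ x := by
      ext x; simp only [Pi.add_apply]; ring
    change eLpNorm (fun x => u x + w x - (φ x + ψ x)) 2 _ < ε
    rw [e]
    refine (eLpNorm_add_le (hu.1.1.sub (hφ.memLp _)).1 (hw.1.1.sub (hψ.memLp _)).1 one_le_two).trans_lt ?_
    rw [← ENNReal.add_halves ε]
    exact ENNReal.add_lt_add h1 h3
  · have e : (fun x => g x + k x - gradient (fun x => φ x + ψ x) x)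
        = (fun x => g x - gradient φ x) + fun x => k x - gradient ψ x := by
      ext1 x
      rw [gradient_fun_add (hφ.1.differentiable (by simp) x) (hψ.1.differentiable (by simp) x)]
      simp only [Pi.add_apply]
      abel
    change eLpNorm (fun x => g x + k x - gradient (fun x => φ x + ψ x) x) 2 _ < ε
    rw [e]
    refine (eLpNorm_add_le (hg.1.sub (hφ.memLp_gradient _)).1
      (hk.1.sub (hψ.memLp_gradient _)).1 one_le_two).trans_lt ?_
    rw [← ENNReal.add_halves ε]
    exact ENNReal.add_lt_add h2 h4

/-- Extension by zero of functions in `H¹₀`. -/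
lemma MemH10.indicator (hG : IsOpen G) (hG' : IsOpen G') (hsub : G ⊆ G') (h : MemH10 G w)
    (hg : IsWeakGradient G w g) :
    MemH10 G' (G.indicator w) ∧ IsWeakGradient G' (G.indicator w) (G.indicator g) := by
  have hr : (volume.restrict G').restrict G = volume.restrict G := by
    rw [Measure.restrict_restrict hG.measurableSet, inter_eq_self_of_subset_left hsub]
  have m1 : MemLp (G.indicator w) 2 (volume.restrict G') := by
    rw [memLp_indicator_iff_restrict hG.measurableSet, hr]; exact h.1.1
  have m2 : MemLp (G.indicator g) 2 (volume.restrict G') := by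
    rw [memLp_indicator_iff_restrict hG.measurableSet, hr]; exact hg.1
  have key : ∀ ε : ℝ≥0∞, 0 < ε → ∃ φ : Euc n → ℝ, IsTest G' φ ∧
      eLpNorm (fun x => G.indicator w x - φ x) 2 (volume.restrict G') < ε ∧
      eLpNorm (fun x => G.indicator g x - gradient φ x) 2 (volume.restrict G') < ε := by
    intro ε hε
    obtain ⟨φ, hφ, h1, h2⟩ := h.approx hG hg ε hε
    refine ⟨φ, hφ.mono hsub, ?_, ?_⟩
    · have e : (fun x => G.indicator w x - φ x) = G.indicator fun x => w x - φ x := by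
        ext x
        by_cases hx : x ∈ G
        · simp [hx]
        · simp [hx, image_eq_zero_of_notMem_tsupport fun H => hx (hφ.2.2 H)]
      rwa [e, eLpNorm_indicator_eq_eLpNorm_restrict hG.measurableSet, hr]
    · have e : (fun x => G.indicator g x - gradient φ x) = G.indicator fun x => g x - gradient φ x := by
        ext1 x
        by_cases hx : x ∈ G
        · simp [hx]
        · simp [hx, gradient_eq_zero_of_notMem fun H => hx (hφ.2.2 H)]
      rwa [e, eLpNorm_indicator_eq_eLpNorm_restrict hG.measurableSet, hr]
  exact ⟨memH10_of_approx hG' m1 m2 key, isWeakGradient_of_approx m1 m2 key⟩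

/-- A Sobolev function vanishing off a compact subset belongs to `H¹₀`. -/
lemma MemH1.memH10_of_eq_zero (hG : IsOpen G) (hw : MemH1 G w) {K : Set (Euc n)}
    (hK : IsCompact K) (hKG : K ⊆ G) (h0 : ∀ x, x ∉ K → w x = 0) : MemH10 G w := by
  obtain ⟨g, hg⟩ := hw.2
  obtain ⟨δ₁, hδ₁, hth⟩ := hK.exists_cthickening_subset_open hG hKG
  have hKm := hK.measurableSet
  -- On the open set `G \ K` the zero field is also a weak gradient of `w`, so uniqueness applies.
  have hg0 : ∀ᵐ x ∂volume.restrict (G \ K), g x = 0 := by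
    have h1 := hg.mono (G' := G \ K) sdiff_subset
    have h2 : IsWeakGradient (G \ K) w 0 := by
      refine ⟨MemLp.zero, fun φ hφ => ?_⟩
      simp only [Pi.zero_apply, smul_zero, integral_zero, neg_zero]
      refine setIntegral_eq_zero_of_forall_eq_zero fun x hx => ?_
      rw [h0 x hx.2, zero_smul]
    exact h1.ae_eq (hG.sdiff hK.isClosed) h2
  set g' := G.indicator g with hg'
  have hg'0 : ∀ᵐ x, x ∉ K → g' x = 0 := by
    rw [ae_restrict_iff' (hG.measurableSet.diff hKm)] at hg0
    filter_upwards [hg0] with x hx hxK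
    by_cases hxG : x ∈ G
    · rw [hg', indicator_of_mem hxG, hx ⟨hxG, hxK⟩]
    · rw [hg', indicator_of_notMem hxG]
  have hg'm : MemLp g' 2 volume := by
    rw [hg', memLp_indicator_iff_restrict hG.measurableSet]; exact hg.1
  have hwm : MemLp w 2 volume := by
    have : w = G.indicator w := (indicator_eq_self.2 fun x hx => hKG (by_contra fun h => hx (h0 x h))).symm
    rw [this, memLp_indicator_iff_restrict hG.measurableSet]
    exact hw.1
  have hwl := hwm.locallyIntegrable one_le_two
  refine memH10_of_approx hG hw.1 hg.1 fun ε hε => ?_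
  obtain ⟨ε', hε'0, hε'⟩ := exists_between hε
  obtain ⟨δ₂, hδ₂, a1⟩ := exists_eLpNorm_vmollify_sub_le hwm hε'0.ne'
  obtain ⟨δ₃, hδ₃, a2⟩ := exists_eLpNorm_vmollify_sub_le hg'm hε'0.ne'
  obtain ⟨δ, hδ, hlt⟩ : ∃ δ > 0, δ < min δ₁ (min δ₂ δ₃) := exists_between (by positivity)
  have l1 : δ < δ₁ := hlt.trans_le (min_le_left _ _)
  have l2 : δ < δ₂ := hlt.trans_le ((min_le_right _ _).trans (min_le_left _ _))
  have l3 : δ < δ₃ := hlt.trans_le ((min_le_right _ _).trans (min_le_right _ _))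
  set b := smallBump (n := n) δ hδ
  have hb : b.rOut = δ / 2 := rfl
  have hsupp : tsupport (mollify b w) ⊆ Metric.cthickening (δ / 2) K := by
    refine closure_minimal (fun x hx => ?_) Metric.isClosed_cthickening
    by_contra hxK
    refine hx (integral_eq_zero_of_ae (ae_of_all _ fun y => ?_))
    by_cases hy : y ∈ K
    · have : x - y ∉ Function.support (b.normed volume) := by
        rw [b.support_normed_eq, mem_ball_zero_iff, ← dist_eq_norm, hb]
        intro hlt'
        exact hxK (Metric.mem_cthickening_of_dist_le x y _ _ hy hlt'.le)
      have : b.normed volume (x - y) = 0 := by simpa using this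
      simp [this]
    · simp [h0 y hy]
  have htest : IsTest G (mollify b w) :=
    ⟨contDiff_mollify b hwl, hK.cthickening.of_isClosed_subset (isClosed_tsupport _) hsupp,
      hsupp.trans ((Metric.cthickening_mono (by linarith) K).trans hth)⟩
  -- Near `K` the translated kernel is a test function in `G`, so the weak gradient formula applies.
  -- Away from `K` the kernel does not meet `K`, and both sides vanish.
  have hgrad : gradient (mollify b w) = vmollify b g' := by
    ext1 x
    rw [gradient_mollify b hwl]
    by_cases hx : x ∈ Metric.cthickening (δ / 2) K
    · have ht : IsTest G fun y => b.normed volume (x - y) := by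
        refine ⟨contDiff_normed_sub b x, hasCompactSupport_normed_sub b x,
          (tsupport_normed_sub b x).trans fun y hy => hth ?_⟩
        have h1 : Metric.infDist x K ≤ δ / 2 := ENNReal.toReal_le_of_le_ofReal (by positivity) hx
        rcases K.eq_empty_or_nonempty with rfl | hne
        · simp at hx
        · obtain ⟨z, hz, hxz⟩ := hK.exists_infDist_eq_dist hne x
          refine Metric.mem_cthickening_of_dist_le y z _ _ hz ?_
          rw [Metric.mem_closedBall, hb] at hy
          have := dist_triangle y x z
          linarith
      rw [← ht.setIntegral_gradient_eq, hg.2 _ ht, neg_neg, vmollify, ← ht.setIntegral_eq]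
      refine setIntegral_congr_fun hG.measurableSet fun y hy => ?_
      simp only [hg', indicator_of_mem hy]
    · have hfar : ∀ y ∈ K, b.normed volume (x - y) = 0 := fun y hy => by
        have : x - y ∉ Function.support (b.normed volume) := by
          rw [b.support_normed_eq, mem_ball_zero_iff, ← dist_eq_norm, hb]
          intro hlt'
          exact hx (Metric.mem_cthickening_of_dist_le x y _ _ hy hlt'.le)
        simpa using this
      rw [vmollify, integral_eq_zero_of_ae, neg_zero, eq_comm, integral_eq_zero_of_ae]
      · filter_upwards [hg'0] with y hy
        by_cases hyK : y ∈ K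
        · simp [hfar y hyK]
        · simp [hy hyK]
      · refine ae_of_all _ fun y => ?_
        by_cases hyK : y ∈ K
        · have : gradient (fun z => b.normed volume (x - z)) y = 0 := by
            refine gradient_eq_zero_of_notMem fun H => hx ?_
            have := tsupport_normed_sub b x H
            rw [Metric.mem_closedBall, dist_comm, hb] at this
            exact Metric.mem_cthickening_of_dist_le x y _ _ hyK this
          simp [this]
        · simp [h0 y hyK]
  refine ⟨mollify b w, htest, ?_, ?_⟩
  · refine lt_of_le_of_lt ?_ hε'
    refine le_trans ?_ (a1 δ hδ l2)
    rw [eLpNorm_sub_comm]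
    exact eLpNorm_mono_measure _ Measure.restrict_le_self
  · refine lt_of_le_of_lt ?_ hε'
    refine le_trans ?_ (a2 δ hδ l3)
    rw [eLpNorm_sub_comm, ← hgrad]
    have e : eLpNorm (fun x => g x - gradient (mollify b w) x) 2 (volume.restrict G)
        = eLpNorm (g' - gradient (mollify b w)) 2 (volume.restrict G) := by
      refine eLpNorm_congr_ae ?_
      filter_upwards [ae_restrict_mem hG.measurableSet] with x hx
      simp only [Pi.sub_apply, hg', indicator_of_mem hx]
    rw [e]
    exact eLpNorm_mono_measure _ Measure.restrict_le_self

end Sobolev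

/-! ### Inner variations of Sobolev functions -/

lemma aestronglyMeasurable_uncurry_comp {c : Euc n → Euc n → Euc n} {g : Euc n → Euc n}
    {μ : Measure (Euc n)} (hc : Continuous fun p : Euc n × Euc n => c p.1 p.2)
    (hg : AEStronglyMeasurable g μ) : AEStronglyMeasurable (fun x => c x (g x)) μ :=
  hc.comp_aestronglyMeasurable (aestronglyMeasurable_id.prodMk hg)

namespace Shear

variable (S : Shear n) {Ω : Set (Euc n)} {u w : Euc n → ℝ} {g : Euc n → Euc n}

lemma quasiMeasurePreserving_inv_restrict (hS : tsupport S.φ ⊆ Ω) :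
    Measure.QuasiMeasurePreserving S.inv (volume.restrict Ω) (volume.restrict Ω) := by
  refine S.quasiMeasurePreserving_inv.restrict fun y hy => ?_
  rw [← S.image_eq_of_tsupport_subset hS] at hy
  obtain ⟨x, hx, rfl⟩ := hy
  rwa [S.inv_fn]

lemma eLpNorm_comp_inv_le {F : Type*} [NormedAddCommGroup F] (hΩ : IsOpen Ω)
    (hS : tsupport S.φ ⊆ Ω) (k : Euc n → F) :
    eLpNorm (fun y => k (S.inv y)) 2 (volume.restrict Ω) ≤ 2 * eLpNorm k 2 (volume.restrict Ω) := by
  rw [eLpNorm_eq_lintegral_rpow_enorm_toReal two_ne_zero ENNReal.ofNat_ne_top,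
    eLpNorm_eq_lintegral_rpow_enorm_toReal two_ne_zero ENNReal.ofNat_ne_top]
  have e : ∫⁻ y in Ω, ‖k (S.inv y)‖ₑ ^ (2 : ℝ≥0∞).toReal
      = ∫⁻ x in Ω, ENNReal.ofReal (S.jac x) * ‖k x‖ₑ ^ (2 : ℝ≥0∞).toReal := by
    conv_lhs => rw [← S.image_eq_of_tsupport_subset hS]
    rw [S.lintegral_comp _ _ hΩ.measurableSet]
    simp only [S.inv_fn]
  rw [e]
  calc _ ≤ (∫⁻ x in Ω, 4 * ‖k x‖ₑ ^ (2 : ℝ≥0∞).toReal) ^ (1 / (2 : ℝ≥0∞).toReal) := by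
        refine ENNReal.rpow_le_rpow (lintegral_mono fun x => mul_le_mul' ?_ le_rfl) (by positivity)
        refine (ENNReal.ofReal_le_ofReal (show S.jac x ≤ 4 by linarith [(S.jac_bounds x).2])).trans ?_
        simp
    _ = _ := by
        rw [lintegral_const_mul' _ _ (by simp), ENNReal.mul_rpow_of_nonneg _ _ (by positivity)]
        congr 1
        rw [show (4 : ℝ≥0∞) = 2 ^ (2 : ℝ) by norm_num, ← ENNReal.rpow_mul]
        norm_num

lemma memLp_comp_inv {F : Type*} [NormedAddCommGroup F] (hΩ : IsOpen Ω)
    (hS : tsupport S.φ ⊆ Ω) {k : Euc n → F} (hk : MemLp k 2 (volume.restrict Ω)) :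
    MemLp (fun y => k (S.inv y)) 2 (volume.restrict Ω) :=
  ⟨hk.1.comp_quasiMeasurePreserving (S.quasiMeasurePreserving_inv_restrict hS),
    (S.eLpNorm_comp_inv_le hΩ hS k).trans_lt (ENNReal.mul_lt_top (by simp) hk.2)⟩

/-- The gradient of `u ∘ S⁻¹`, pulled back by `S`. -/
noncomputable def pullGradient (g : Euc n → Euc n) (x : Euc n) : Euc n :=
  (S.jac x)⁻¹ • S.cof x (g x)

lemma norm_pullGradient_le (g : Euc n → Euc n) (x : Euc n) : ‖S.pullGradient g x‖ ≤ 4 * ‖g x‖ := by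
  have h1 := (S.jac_bounds x).1
  have h2 := (S.norm_cof_bounds x (g x)).2
  rw [pullGradient, norm_smul, norm_inv, Real.norm_of_nonneg (S.jac_pos x).le, inv_mul_eq_div,
    div_le_iff₀ (S.jac_pos x)]
  nlinarith [norm_nonneg (g x)]

lemma memLp_pullGradient (hg : MemLp g 2 (volume.restrict Ω)) :
    MemLp (S.pullGradient g) 2 (volume.restrict Ω) := by
  refine hg.of_le_mul (c := 4) ?_ (ae_of_all _ (S.norm_pullGradient_le g))
  have h1 : Continuous fun x => (S.jac x)⁻¹ :=
    S.contDiff_jac.continuous.inv₀ fun x => (S.jac_pos x).ne'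
  have h2 : AEStronglyMeasurable (fun x => S.cof x (g x)) (volume.restrict Ω) :=
    aestronglyMeasurable_uncurry_comp (c := S.cof) S.continuous_cof hg.1
  exact h1.aestronglyMeasurable.smul h2

lemma isTest_comp_fn (hS : tsupport S.φ ⊆ Ω) {ψ : Euc n → ℝ} (hψ : IsTest Ω ψ) :
    IsTest Ω fun x => ψ (S.fn x) := by
  refine ⟨hψ.1.comp S.contDiff_fn, hψ.2.1.comp_homeomorph S.homeo, ?_⟩
  have : tsupport (fun x => ψ (S.fn x)) ⊆ S.fn ⁻¹' tsupport ψ :=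
    tsupport_comp_subset_preimage ψ S.continuous_fn
  refine this.trans fun x hx => ?_
  have h := hψ.2.2 hx
  rw [← S.image_eq_of_tsupport_subset hS] at h
  exact S.injective_fn.mem_set_image.1 h

lemma isTest_comp_inv (hS : tsupport S.φ ⊆ Ω) {ψ : Euc n → ℝ} (hψ : IsTest Ω ψ) :
    IsTest Ω fun x => ψ (S.inv x) := by
  refine ⟨hψ.1.comp S.contDiff_inv, hψ.2.1.comp_homeomorph S.homeo.symm, ?_⟩
  have : tsupport (fun x => ψ (S.inv x)) ⊆ S.inv ⁻¹' tsupport ψ :=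
    tsupport_comp_subset_preimage ψ S.continuous_inv
  refine this.trans fun x hx => ?_
  rw [← S.image_eq_of_tsupport_subset hS]
  exact ⟨S.inv x, hψ.2.2 hx, S.fn_inv x⟩

set_option maxHeartbeats 1000000 in
/-- Change of variables for weak gradients. -/
lemma isWeakGradient_comp_inv (hΩ : IsOpen Ω) (hS : tsupport S.φ ⊆ Ω)
    (hu : MemLp u 2 (volume.restrict Ω)) (hg : IsWeakGradient Ω u g) :
    IsWeakGradient Ω (fun y => u (S.inv y)) (fun y => S.pullGradient g (S.inv y)) := by
  refine ⟨S.memLp_comp_inv hΩ hS (S.memLp_pullGradient hg.1), fun ψ hψ => ?_⟩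
  have hΩS := S.image_eq_of_tsupport_subset hS
  have e1 : ∫ y in Ω, u (S.inv y) • gradient ψ y
      = ∫ x in Ω, u x • (S.jac x • gradient ψ (S.fn x)) := by
    conv_lhs => rw [← hΩS]
    rw [S.integral_comp _ _ hΩ.measurableSet]
    simp only [S.inv_fn, smul_comm (u _)]
  have e2 : ∫ y in Ω, ψ y • S.pullGradient g (S.inv y)
      = ∫ x in Ω, ψ (S.fn x) • S.cof x (g x) := by
    conv_lhs => rw [← hΩS]
    rw [S.integral_comp _ _ hΩ.measurableSet]
    refine integral_congr_ae (ae_of_all _ fun x => ?_)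
    have := (S.jac_pos x).ne'
    simp only [S.inv_fn, pullGradient]
    rw [smul_comm (ψ (S.fn x)), smul_smul, mul_inv_cancel₀ this, one_smul]
  rw [e1, e2]
  have hη := S.isTest_comp_fn hS hψ
  have hJη : IsTest Ω fun x => S.jac x * ψ (S.fn x) := hη.mul_left S.contDiff_jac
  have hψ1 : ContDiff ℝ 1 ψ := hψ.1.of_le (by simp)
  refine ext_inner_right ℝ fun v => ?_
  have hfd : ContDiff ℝ ∞ (fderiv ℝ S.φ) := S.smooth.fderiv_right (by simp)
  have hηv : IsTest Ω fun x => ψ (S.fn x) * fderiv ℝ S.φ x v := by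
    simpa only [mul_comm] using hη.mul_left (hfd.clm_apply contDiff_const)
  have i1 := integrable_smul_of_memLp_two hu (hJη.memLp_gradient (volume.restrict Ω))
  have i2 := integrable_smul_of_memLp_two hu (hηv.memLp_gradient (volume.restrict Ω))
  have iJ : Integrable (fun x => u x • (S.jac x • gradient ψ (S.fn x))) (volume.restrict Ω) := by
    refine integrable_smul_of_memLp_two hu ?_
    have a1 := S.contDiff_jac.continuous
    have a2 : Continuous fun x => gradient ψ (S.fn x) :=
      (ContDiff.continuous_gradient hψ1).comp S.continuous_fn
    have b1 : HasCompactSupport fun x => gradient ψ (S.fn x) :=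
      (HasCompactSupport.gradient hψ.2.1).comp_homeomorph S.homeo
    have a3 : Continuous fun x => S.jac x • gradient ψ (S.fn x) := a1.smul a2
    exact a3.memLp_of_hasCompactSupport (HasCompactSupport.smul_left (f := S.jac) b1)
  have j1 := integrable_smul_of_memLp_two (hJη.memLp (volume.restrict Ω)) hg.1
  have j2 := integrable_smul_of_memLp_two (hηv.memLp (volume.restrict Ω)) hg.1
  have j3 : Integrable (fun x => ψ (S.fn x) • S.cof x (g x)) (volume.restrict Ω) := by
    refine integrable_smul_of_memLp_two (hη.memLp _) ?_
    refine hg.1.of_le_mul (c := 2) ?_ (ae_of_all _ fun x => (S.norm_cof_bounds x (g x)).2)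
    exact aestronglyMeasurable_uncurry_comp (c := S.cof) S.continuous_cof hg.1.1
  have hI : ∀ {m : Measure (Euc n)} {g : Euc n → Euc n}, Integrable g m →
      ∫ x, inner ℝ (g x) v ∂m = inner ℝ (∫ x, g x ∂m) v := fun {m g} hg => by
    simp_rw [real_inner_comm v]
    exact integral_inner hg v
  calc inner ℝ (∫ x in Ω, u x • (S.jac x • gradient ψ (S.fn x))) v
      = ∫ x in Ω, inner ℝ (u x • (S.jac x • gradient ψ (S.fn x))) v := (hI iJ).symm
    _ = ∫ x in Ω, (inner ℝ (u x • gradient (fun z => S.jac z * ψ (S.fn z)) x) v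
        - S.t * inner ℝ S.e (u x • gradient (fun z => ψ (S.fn z) * fderiv ℝ S.φ z v) x)) := by
      refine integral_congr_ae (ae_of_all _ fun x => ?_)
      simp only
      rw [real_inner_smul_left, S.inner_jac_smul_gradient hψ1, real_inner_smul_left,
        inner_smul_right]
      ring
    _ = inner ℝ (∫ x in Ω, u x • gradient (fun z => S.jac z * ψ (S.fn z)) x) v
        - S.t * inner ℝ S.e (∫ x in Ω, u x • gradient (fun z => ψ (S.fn z) * fderiv ℝ S.φ z v) x) := by
      rw [integral_sub (i1.inner_const (𝕜 := ℝ) v) ((i2.const_inner (𝕜 := ℝ) S.e).const_mul S.t),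
        integral_const_mul, hI i1, integral_inner i2]
    _ = -(inner ℝ (∫ x in Ω, (S.jac x * ψ (S.fn x)) • g x) v
        - S.t * inner ℝ S.e (∫ x in Ω, (ψ (S.fn x) * fderiv ℝ S.φ x v) • g x)) := by
      rw [hg.2 _ hJη, hg.2 _ hηv, inner_neg_left, inner_neg_right]
      ring
    _ = -∫ x in Ω, (inner ℝ ((S.jac x * ψ (S.fn x)) • g x) v
        - S.t * inner ℝ S.e ((ψ (S.fn x) * fderiv ℝ S.φ x v) • g x)) := by
      rw [integral_sub (j1.inner_const (𝕜 := ℝ) v) ((j2.const_inner (𝕜 := ℝ) S.e).const_mul S.t),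
        integral_const_mul, hI j1, integral_inner j2]
    _ = -∫ x in Ω, inner ℝ (ψ (S.fn x) • S.cof x (g x)) v := by
      congr 1
      refine integral_congr_ae (ae_of_all _ fun x => ?_)
      simp only [real_inner_smul_left, inner_smul_right, inner_cof]
      ring
    _ = inner ℝ (-∫ x in Ω, ψ (S.fn x) • S.cof x (g x)) v := by rw [hI j3, inner_neg_left]

lemma memH1_comp_inv (hΩ : IsOpen Ω) (hS : tsupport S.φ ⊆ Ω) (hu : MemH1 Ω u) :
    MemH1 Ω fun y => u (S.inv y) := by
  obtain ⟨g, hg⟩ := hu.2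
  exact ⟨S.memLp_comp_inv hΩ hS hu.1, _, S.isWeakGradient_comp_inv hΩ hS hu.1 hg⟩

lemma pullGradient_sub (g k : Euc n → Euc n) (x : Euc n) :
    S.pullGradient g x - S.pullGradient k x = S.pullGradient (fun x => g x - k x) x := by
  rw [pullGradient, pullGradient, pullGradient, cof_sub, smul_sub]

/-- Composition with the smooth inverse shear keeps test functions in `Ω` and is bounded in the `H¹`
norm, so approximations are carried along. -/
lemma memH10_comp_inv (hΩ : IsOpen Ω) (hS : tsupport S.φ ⊆ Ω) (hu : MemH10 Ω u) :
    MemH10 Ω fun y => u (S.inv y) := by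
  obtain ⟨g, hg⟩ := hu.1.2
  have hw := S.isWeakGradient_comp_inv hΩ hS hu.1.1 hg
  refine memH10_of_approx hΩ (S.memLp_comp_inv hΩ hS hu.1.1) hw.1 fun ε hε => ?_
  -- Two for the change of variables in `L²` times four for the pulled-back gradient.
  have hε8 : 0 < ε / 8 := ENNReal.div_pos hε.ne' (by simp)
  have h8 : 8 * (ε / 8) = ε := ENNReal.mul_div_cancel (by simp) (by simp)
  obtain ⟨φ, hφ, h1, h2⟩ := hu.approx hΩ hg _ hε8
  refine ⟨_, S.isTest_comp_inv hS hφ, ?_, ?_⟩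
  · refine (S.eLpNorm_comp_inv_le hΩ hS fun x => u x - φ x).trans_lt ?_
    calc _ ≤ 8 * eLpNorm (fun x => u x - φ x) 2 (volume.restrict Ω) := by gcongr; norm_num
      _ < 8 * (ε / 8) := (ENNReal.mul_lt_mul_iff_right (by simp) (by simp)).2 h1
      _ = ε := h8
  · have e1 := S.isWeakGradient_comp_inv hΩ hS (hφ.memLp _) (hφ.isWeakGradient (G := Ω))
    have e2 := (S.isTest_comp_inv hS hφ).isWeakGradient (G := Ω)
    have e3 : (fun y => S.pullGradient g (S.inv y) - gradient (fun y => φ (S.inv y)) y)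
        =ᵐ[volume.restrict Ω] fun y => S.pullGradient (fun x => g x - gradient φ x) (S.inv y) := by
      filter_upwards [e2.ae_eq hΩ e1] with y hy
      rw [hy, pullGradient_sub]
    rw [eLpNorm_congr_ae e3]
    refine (S.eLpNorm_comp_inv_le hΩ hS _).trans_lt ?_
    have e4 : eLpNorm (S.pullGradient fun x => g x - gradient φ x) 2 (volume.restrict Ω)
        ≤ 4 * eLpNorm (fun x => g x - gradient φ x) 2 (volume.restrict Ω) := by
      have := eLpNorm_le_mul_eLpNorm_of_ae_le_mul (μ := volume.restrict Ω) (p := 2)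
        (ae_of_all _ (S.norm_pullGradient_le fun x => g x - gradient φ x))
      simpa using this
    calc _ ≤ 2 * (4 * eLpNorm (fun x => g x - gradient φ x) 2 (volume.restrict Ω)) :=
          mul_le_mul' le_rfl e4
      _ = 8 * eLpNorm (fun x => g x - gradient φ x) 2 (volume.restrict Ω) := by
          rw [← mul_assoc]; norm_num
      _ < 8 * (ε / 8) := (ENNReal.mul_lt_mul_iff_right (by simp) (by simp)).2 h2
      _ = ε := h8

/-- The boundary values are preserved by an inner variation. -/
lemma memH10_comp_inv_sub (hΩ : IsOpen Ω) (hS : tsupport S.φ ⊆ Ω) {u₀ : Euc n → ℝ}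
    (hu₀ : MemH1 Ω u₀) (hu : MemH10 Ω fun x => u x - u₀ x) :
    MemH10 Ω fun y => u (S.inv y) - u₀ y := by
  have h1 := S.memH10_comp_inv hΩ hS hu
  have h2 : MemH10 Ω fun y => u₀ (S.inv y) - u₀ y := by
    -- The shear moves no point off the compact support of `φ`, so `u₀ ∘ S⁻¹ - u₀` vanishes there
    -- even though `u₀` need not.
    refine ((S.memH1_comp_inv hΩ hS hu₀).sub hu₀).memH10_of_eq_zero hΩ S.compact.isCompact hS
      fun x hx => ?_
    rw [S.inv_eq_self hx, sub_self]
  have := h1.add hΩ h2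
  simpa using this

lemma norm_pullGradient_sq_mul_jac_le (g : Euc n → Euc n) (x : Euc n) :
    S.jac x * ‖S.pullGradient g x‖ ^ 2 ≤ (1 + 8 * |S.t|) * ‖g x‖ ^ 2 := by
  have hj := S.jac_pos x
  have h1 := S.norm_cof_sub_le x (g x)
  have h2 := norm_le_norm_add_norm_sub' (S.cof x (g x)) (g x)
  have h3 : ‖S.cof x (g x)‖ ≤ (1 + 2 * |S.t|) * ‖g x‖ := by linarith
  have h4 := S.abs_jac_sub_one_le x
  rw [_root_.abs_le] at h4
  have h0 := abs_nonneg S.t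
  have ht := S.abs_t
  have e : S.jac x * ‖S.pullGradient g x‖ ^ 2 = ‖S.cof x (g x)‖ ^ 2 / S.jac x := by
    rw [pullGradient, norm_smul, norm_inv, Real.norm_of_nonneg hj.le]
    field_simp
  rw [e, div_le_iff₀ hj]
  calc ‖S.cof x (g x)‖ ^ 2 ≤ ((1 + 2 * |S.t|) * ‖g x‖) ^ 2 := by gcongr
    _ = (1 + 2 * |S.t|) ^ 2 * ‖g x‖ ^ 2 := by ring
    -- Expanding, this amounts to `12 t² ≤ 3 |t|`, which is exactly `|t| ≤ 1/4`.
    _ ≤ ((1 + 8 * |S.t|) * (1 - |S.t|)) * ‖g x‖ ^ 2 := by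
      gcongr
      nlinarith
    _ ≤ ((1 + 8 * |S.t|) * S.jac x) * ‖g x‖ ^ 2 := by
      gcongr
      linarith
    _ = _ := by ring

lemma sigma_image (hS : tsupport S.φ ⊆ Ω) {α β : ℝ} (E : Set (Euc n)) (x : Euc n) :
    sigma α β Ω (S.fn '' E) (S.fn x) = sigma α β Ω E x := by
  have e1 : S.fn x ∈ Ω ↔ x ∈ Ω := by
    conv_lhs => rw [← S.image_eq_of_tsupport_subset hS]
    exact S.injective_fn.mem_set_image
  have e2 : S.fn x ∈ S.fn '' E ↔ x ∈ E := S.injective_fn.mem_set_image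
  by_cases h1 : x ∈ E <;> by_cases h2 : x ∈ Ω <;>
  simp [sigma, indicator, e1, h1, h2, S.injective_fn.eq_iff]

/-- The bulk energy is Lipschitz stable under shears. -/
lemma lintegral_weakGradient_comp_inv_le (hΩ : IsOpen Ω) (hS : tsupport S.φ ⊆ Ω)
    (hu : MemH1 Ω u) {α β : ℝ} (hα : 0 ≤ α) (hβ : 0 ≤ β) (E : Set (Euc n)) :
    ∫⁻ y in Ω, ENNReal.ofReal (sigma α β Ω (S.fn '' E) y *
        ‖weakGradient Ω (fun y => u (S.inv y)) y‖ ^ 2)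
      ≤ ENNReal.ofReal (1 + 8 * |S.t|) *
        ∫⁻ x in Ω, ENNReal.ofReal (sigma α β Ω E x * ‖weakGradient Ω u x‖ ^ 2) := by
  have hg := weakGradient_spec hu.2
  have hw := (S.isWeakGradient_comp_inv hΩ hS hu.1 hg).weakGradient_ae_eq hΩ
  have hσ : ∀ x, 0 ≤ sigma α β Ω E x := fun x =>
    add_nonneg (indicator_nonneg (fun _ _ => hα) _) (indicator_nonneg (fun _ _ => hβ) _)
  rw [← lintegral_const_mul' _ _ ENNReal.ofReal_ne_top]
  calc _ = ∫⁻ y in Ω, ENNReal.ofReal (sigma α β Ω (S.fn '' E) y *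
        ‖S.pullGradient (weakGradient Ω u) (S.inv y)‖ ^ 2) := by
        refine lintegral_congr_ae ?_
        filter_upwards [hw] with y hy
        rw [hy]
    _ = ∫⁻ x in Ω, ENNReal.ofReal (S.jac x) * ENNReal.ofReal (sigma α β Ω E x *
        ‖S.pullGradient (weakGradient Ω u) x‖ ^ 2) := by
        conv_lhs =>
          enter [1]
          rw [← S.image_eq_of_tsupport_subset hS]
        rw [S.lintegral_comp _ _ hΩ.measurableSet]
        simp only [S.inv_fn, S.sigma_image hS]
    _ ≤ _ := by
        refine lintegral_mono fun x => ?_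
        simp only
        rw [← ENNReal.ofReal_mul (S.jac_pos x).le, ← ENNReal.ofReal_mul (by positivity)]
        refine ENNReal.ofReal_le_ofReal ?_
        have := S.norm_pullGradient_sq_mul_jac_le (weakGradient Ω u) x
        nlinarith [hσ x, mul_le_mul_of_nonneg_left this (hσ x)]

end Shear

/-! ### Nondegeneracy of the first variation of volume -/

section Nondegeneracy

variable {E : Set (Euc n)} {μ : Measure (Euc n)} {f : Euc n → Euc n}

/-- Test functions with values and gradient bounded by one. -/
def IsUnitTest (G : Set (Euc n)) (φ : Euc n → ℝ) : Prop :=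
  IsTest G φ ∧ (∀ x, |φ x| ≤ 1) ∧ ∀ x, ‖gradient φ x‖ ≤ 1

/-- The `L¹` distance of the indicator of a set to its mollification. -/
lemma IsPolar.lintegral_mollify_sub_le (hp : IsPolar E μ f) (hE : NullMeasurableSet E volume)
    (x : Euc n) {r R s : ℝ} (hs : 0 < s) (hR : r + s ≤ R) :
    ∫⁻ z in Metric.ball x r, ‖mollify (smallBump s hs) (ind E) z - ind E z‖ₑ
      ≤ ENNReal.ofReal s * μ (Metric.ball x R) := by
  set b := smallBump (n := n) s hs
  have hb : b.rOut = s / 2 := rfl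
  have hbm : Measurable fun h : Euc n => ‖b.normed volume (-h)‖ₑ :=
    (b.continuous_normed.comp continuous_neg).enorm.measurable
  have h1 : ∀ z, ‖mollify b (ind E) z - ind E z‖ₑ
      ≤ ∫⁻ h, ‖b.normed volume (-h)‖ₑ * ‖ind E (z + h) - ind E z‖ₑ := by
    intro z
    have i1 := integrable_normed_sub_smul b (locallyIntegrable_ind hE) z
    have i2 : Integrable fun y => b.normed volume (z - y) • ind E z :=
      integrable_normed_sub_smul b (locallyIntegrable_const _) z
    have e : mollify b (ind E) z - ind E z
        = ∫ y, b.normed volume (z - y) • (ind E y - ind E z) := by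
      simp only [smul_sub]
      rw [integral_sub i1 i2, integral_smul_const,
        integral_sub_left_eq_self (fun y => b.normed volume y) volume z, b.integral_normed, one_smul]
      rfl
    rw [e]
    refine (enorm_integral_le_lintegral_enorm _).trans ?_
    rw [← lintegral_add_left_eq_self (fun y => ‖b.normed volume (z - y) • (ind E y - ind E z)‖ₑ) z]
    simp
  calc ∫⁻ z in Metric.ball x r, ‖mollify b (ind E) z - ind E z‖ₑ
      ≤ ∫⁻ z in Metric.ball x r, ∫⁻ h, ‖b.normed volume (-h)‖ₑ * ‖ind E (z + h) - ind E z‖ₑ :=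
        lintegral_mono h1
    _ = ∫⁻ h, ∫⁻ z in Metric.ball x r, ‖b.normed volume (-h)‖ₑ * ‖ind E (z + h) - ind E z‖ₑ := by
        refine (lintegral_lintegral_swap (f := fun h z : Euc n =>
          ‖b.normed volume (-h)‖ₑ * ‖ind E (z + h) - ind E z‖ₑ) ?_).symm
        have a1 := (aemeasurable_enorm_ind_translate hE)
        have a2 : AEMeasurable (fun p : Euc n × Euc n => ‖b.normed volume (-p.1)‖ₑ)
          (volume.prod volume) := (hbm.comp measurable_fst).aemeasurable
        refine (a2.mul a1).mono_measure ?_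
        exact Measure.prod_mono le_rfl Measure.restrict_le_self
    _ ≤ ∫⁻ h : Euc n, ‖b.normed volume (-h)‖ₑ * (ENNReal.ofReal s * μ (Metric.ball x R)) := by
        refine lintegral_mono fun h => ?_
        simp only
        rw [lintegral_const_mul' _ _ (by simp)]
        by_cases hh : ‖h‖ < s / 2
        · refine mul_le_mul' le_rfl ?_
          refine (hp.lintegral_translate_le hE x h (R := R) (by linarith)).trans ?_
          gcongr
          rw [← ofReal_norm]
          exact ENNReal.ofReal_le_ofReal (by linarith)
        · have : -h ∉ Function.support (b.normed volume) := by
            rw [b.support_normed_eq, mem_ball_zero_iff, hb, norm_neg]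
            exact hh
          have : b.normed volume (-h) = 0 := by simpa using this
          simp [this]
    _ = ENNReal.ofReal s * μ (Metric.ball x R) := by
        rw [lintegral_mul_const _ hbm]
        have := lintegral_enorm_normed_sub_left b 0
        simp only [zero_sub] at this
        rw [this, one_mul]

lemma exists_bound_smallBump {s : ℝ} (hs : 0 < s) :
    ∃ A > 0, ∀ z : Euc n, |(smallBump s hs).normed volume z| ≤ A ∧
      ‖gradient ((smallBump s hs).normed volume) z‖ ≤ A := by
  set b := smallBump (n := n) s hs
  have h1 : ContDiff ℝ 1 (b.normed volume) := b.contDiff_normed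
  have hc := b.hasCompactSupport_normed (μ := volume)
  obtain ⟨C, hC⟩ := hc.exists_bound_of_continuous h1.continuous
  obtain ⟨D, hD⟩ := gradient_bounded h1 hc
  refine ⟨max 1 (max C D), by positivity, fun z => ⟨?_, ?_⟩⟩
  · exact (hC z).trans ((le_max_left _ _).trans (le_max_right _ _))
  · exact (hD z).trans ((le_max_right _ _).trans (le_max_right _ _))

/-- The gradient of the mollified indicator at `z` is, up to sign, the integral over `E` of the
gradient of the kernel centred at `z`. Dividing by `A` makes the kernel a unit test function, and
taking `e` in the direction of that integral recovers its norm. -/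
lemma norm_gradient_mollify_ind_le (hE : NullMeasurableSet E volume) {s A ε : ℝ} (hs : 0 < s)
    (hA0 : 0 < A) (hA : ∀ z : Euc n, |(smallBump s hs).normed volume z| ≤ A ∧
      ‖gradient ((smallBump s hs).normed volume) z‖ ≤ A) {G : Set (Euc n)}
    (hε0 : 0 ≤ ε)
    (hε : ∀ φ e, IsUnitTest G φ → ‖e‖ = 1 → |∫ x in E, fderiv ℝ φ x e| ≤ ε)
    {z : Euc n} (hz : Metric.closedBall z (s / 2) ⊆ G) :
    ‖gradient (mollify (smallBump s hs) (ind E)) z‖ ≤ A * ε := by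
  set b := smallBump (n := n) s hs
  have hb : b.rOut = s / 2 := rfl
  rw [gradient_mollify_ind hE, norm_neg]
  set φ : Euc n → ℝ := fun y => b.normed volume (z - y) with hφ
  have hφs : ContDiff ℝ ∞ φ := contDiff_normed_sub b z
  have hφc : HasCompactSupport φ := hasCompactSupport_normed_sub b z
  have hgr : ∀ y, gradient (fun y => A⁻¹ * φ y) y = A⁻¹ • gradient φ y := fun y =>
    gradient_const_mul _
  have hut : IsUnitTest G fun y => A⁻¹ * φ y := by
    refine ⟨⟨contDiff_const.mul hφs, hφc.mul_left, (tsupport_mul_subset_right).trans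
      ((tsupport_normed_sub b z).trans (by rw [hb]; exact hz))⟩, fun y => ?_, fun y => ?_⟩
    · rw [abs_mul, abs_of_pos (inv_pos.2 hA0), inv_mul_le_iff₀ hA0, mul_one]
      exact (hA _).1
    · rw [hgr, norm_smul, norm_inv, Real.norm_of_nonneg hA0.le, inv_mul_le_iff₀ hA0, mul_one, hφ,
        gradient_normed_sub, norm_neg]
      exact (hA _).2
  have hi : Integrable (gradient φ) (volume.restrict E) :=
    (integrable_gradient (hφs.of_le (by simp)) hφc volume).restrict
  set v := ∫ y in E, gradient φ y with hv
  rcases eq_or_ne v 0 with h0 | h0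
  · rw [h0, norm_zero]; positivity
  · have hvn := norm_pos_iff.2 h0
    have h1 := hε _ (‖v‖⁻¹ • v) hut (by rw [norm_smul, norm_inv, norm_norm, inv_mul_cancel₀ hvn.ne'])
    have h2 : ∫ x in E, fderiv ℝ (fun y => A⁻¹ * φ y) x (‖v‖⁻¹ • v) = A⁻¹ * ‖v‖ := by
      simp_rw [← inner_gradient_eq_fderiv, hgr, real_inner_smul_left, inner_smul_right]
      rw [integral_const_mul, integral_const_mul]
      have : ∫ x in E, inner ℝ (gradient φ x) v = ‖v‖ ^ 2 := by
        simp_rw [real_inner_comm v]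
        rw [integral_inner hi, ← hv, real_inner_self_eq_norm_sq]
      rw [this]
      field_simp
    rw [h2, abs_of_pos (by positivity), inv_mul_le_iff₀ hA0] at h1
    exact h1

/-- The mollified indicator `w` is almost constant on the ball when first variations are small, and
`L¹`-close to the indicator when `s` times the perimeter is small. An indicator close to a constant
must be mostly zero or mostly one. -/
lemma IsPolar.min_volume_le (hp : IsPolar E μ f) (hE : NullMeasurableSet E volume) (x : Euc n)
    {r s A ε : ℝ} (hs : 0 < s) (hsr : s < r) (hA0 : 0 < A)
    (hA : ∀ z : Euc n, |(smallBump s hs).normed volume z| ≤ A ∧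
      ‖gradient ((smallBump s hs).normed volume) z‖ ≤ A) (hε0 : 0 ≤ ε)
    (hε : ∀ φ e, IsUnitTest (Metric.ball x (2 * r)) φ → ‖e‖ = 1 → |∫ x in E, fderiv ℝ φ x e| ≤ ε) :
    min (volume.real (Metric.ball x r ∩ E)) (volume.real (Metric.ball x r \ E))
      ≤ 2 * (s * μ.real (Metric.ball x (2 * r)) + r * A * ε * volume.real (Metric.ball x r)) := by
  have := hp.finite
  set b := smallBump (n := n) s hs
  set w := mollify b (ind E) with hw
  set B := Metric.ball x r with hB
  have hr : 0 < r := hs.trans hsr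
  have hws : ContDiff ℝ ∞ w := contDiff_mollify b (locallyIntegrable_ind hE)
  have hosc : ∀ z ∈ B, |w z - w x| ≤ r * A * ε := by
    intro z hz
    have h := Convex.norm_image_sub_le_of_norm_fderiv_le (𝕜 := ℝ) (f := w) (C := A * ε) (s := B)
      (x := x) (y := z) (fun y _ => hws.differentiable (by simp) y)
      (fun y hy => by
        rw [← norm_gradient]
        refine norm_gradient_mollify_ind_le hE hs hA0 hA hε0 hε fun p hp => ?_
        rw [hB, Metric.mem_ball] at hy
        rw [Metric.mem_closedBall] at hp
        rw [Metric.mem_ball]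
        linarith [dist_triangle p y x])
      (convex_ball x r) (Metric.mem_ball_self hr) hz
    rw [Real.norm_eq_abs] at h
    rw [hB, Metric.mem_ball, dist_eq_norm] at hz
    calc _ ≤ A * ε * ‖z - x‖ := h
      _ ≤ A * ε * r := by gcongr
      _ = _ := by ring
  have hBfin : volume B ≠ ⊤ := measure_ball_lt_top.ne
  have : IsFiniteMeasure (volume.restrict B) := ⟨by simpa using hBfin.lt_top⟩
  have hindi : Integrable (ind E) (volume.restrict B) := by
    refine Integrable.of_bound (aestronglyMeasurable_ind hE).restrict 1 (ae_of_all _ fun z => ?_)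
    rw [Real.norm_of_nonneg (ind_nonneg E z)]
    exact ind_le_one E z
  have hwi : Integrable w (volume.restrict B) :=
    (hws.continuous.locallyIntegrable.integrableOn_isCompact (isCompact_closedBall x r)).mono_set
      Metric.ball_subset_closedBall
  have hwe : Integrable (fun z => |w z - ind E z|) (volume.restrict B) := (hwi.sub hindi).abs
  have h1 : ∫ z in B, |w z - ind E z| ≤ s * μ.real (Metric.ball x (2 * r)) := by
    have h := hp.lintegral_mollify_sub_le hE x (r := r) (R := 2 * r) hs (by linarith)
    rw [integral_eq_lintegral_of_nonneg_ae (ae_of_all _ fun z => abs_nonneg _)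
      hwe.1]
    refine ENNReal.toReal_le_of_le_ofReal (by positivity) ?_
    rw [ENNReal.ofReal_mul hs.le, ofReal_measureReal]
    refine le_trans (le_of_eq ?_) h
    refine lintegral_congr fun z => ?_
    rw [← Real.norm_eq_abs, ofReal_norm]
  have h2 : ∫ z in B, |ind E z - w x|
      ≤ s * μ.real (Metric.ball x (2 * r)) + r * A * ε * volume.real B := by
    calc ∫ z in B, |ind E z - w x| ≤ ∫ z in B, (|w z - ind E z| + r * A * ε) := by
          refine setIntegral_mono_on (hindi.sub (integrable_const _)).abs
            (hwe.add (integrable_const _)) measurableSet_ball fun z hz => ?_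
          have := hosc z hz
          have h3 := abs_sub_le (ind E z) (w z) (w x)
          rw [abs_sub_comm (ind E z) (w z)] at h3
          linarith
      _ = (∫ z in B, |w z - ind E z|) + r * A * ε * volume.real B := by
          rw [integral_add hwe (integrable_const _)]
          simp [mul_comm]
      _ ≤ _ := by gcongr
  -- Chebyshev's inequality at level `1/2`.
  have hsub : ∀ T : Set (Euc n), NullMeasurableSet T volume → T ⊆ B →
      (∀ z ∈ T, 1 / 2 ≤ |ind E z - w x|) → volume.real T ≤ 2 * ∫ z in B, |ind E z - w x| := by
    intro T hT hTB hTl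
    have hTfin : volume T ≠ ⊤ := ((measure_mono hTB).trans_lt hBfin.lt_top).ne
    have i1 : IntegrableOn (fun z => |ind E z - w x|) B := (hindi.sub (integrable_const _)).abs
    have h4 : ∫ z in T, (1 / 2 : ℝ) ≤ ∫ z in T, |ind E z - w x| := by
      refine integral_mono_ae ?_ (i1.mono_set hTB) ?_
      · exact integrableOn_const hTfin
      · filter_upwards [ae_restrict_mem₀ hT] with z hz using hTl z hz
    have h5 : ∫ z in T, |ind E z - w x| ≤ ∫ z in B, |ind E z - w x| :=
      setIntegral_mono_set i1 (ae_of_all _ fun z => abs_nonneg _) hTB.eventuallyLE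
    simp only [integral_const, measureReal_restrict_apply_univ, smul_eq_mul] at h4
    linarith
  have hBm : NullMeasurableSet B volume := measurableSet_ball.nullMeasurableSet
  -- Whichever of the values `0` and `1` is far from `w x` can only be taken on a small set.
  rcases le_total (w x) (1 / 2) with hc | hc
  · refine (min_le_left _ _).trans ((hsub _ (hBm.inter hE) inter_subset_left fun z hz => ?_).trans
      (by linarith))
    have : ind E z = 1 := by simp [ind, hz.2]
    rw [this]
    exact le_trans (by linarith) (le_abs_self _)
  · refine (min_le_right _ _).trans ((hsub _ (hBm.diff hE) sdiff_subset fun z hz => ?_).trans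
      (by linarith))
    have : ind E z = 0 := by simp [ind, hz.2]
    rw [this, abs_sub_comm]
    exact le_trans (by linarith) (le_abs_self _)

end Nondegeneracy

/-! ### Uniform nondegeneracy by compactness and connectedness -/

section Compactness

variable {Ω : Set (Euc n)} {ι : Type*} {l : Filter ι}

/-- Sets vanishing locally in the limit vanish globally. -/
lemma eq_zero_of_tendsto_volume (hΩo : IsOpen Ω) (hΩf : volume Ω ≠ ⊤) [l.NeBot]
    {T : ι → Set (Euc n)} (hT : ∀ k, T k ⊆ Ω)
    (hloc : ∀ x ∈ Ω, ∃ r > 0, Tendsto (fun k => volume.real (Metric.ball x r ∩ T k)) l (𝓝 0))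
    {τ : ℝ} (hτ : Tendsto (fun k => volume.real (T k)) l (𝓝 τ)) : τ ≤ 0 := by
  by_contra! h
  have hTf : ∀ k, volume (T k) ≠ ⊤ := fun k => ((measure_mono (hT k)).trans_lt hΩf.lt_top).ne
  have hST : ∀ S k, volume (S ∩ T k) ≠ ⊤ := fun S k =>
    ((measure_mono inter_subset_right).trans_lt (hTf k).lt_top).ne
  -- Inner regularity leaves less than `τ` outside a compact `K`, on which finitely many of the
  -- given balls suffice.
  obtain ⟨K, hKΩ, hK, hKη⟩ : ∃ K ⊆ Ω, IsCompact K ∧ volume.real (Ω \ K) < τ := by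
    rcases eq_or_ne (volume Ω) 0 with h0 | h0
    · exact ⟨∅, empty_subset _, isCompact_empty, by simp [measureReal_def, h0, h]⟩
    obtain ⟨K, hKΩ, hK, hlt⟩ := hΩo.exists_lt_isCompact
      (ENNReal.sub_lt_self hΩf h0 (ENNReal.ofReal_pos.2 h).ne')
    refine ⟨K, hKΩ, hK, ?_⟩
    have hKf : volume K ≠ ⊤ := hK.measure_lt_top.ne
    rw [measureReal_def, measure_sdiff hKΩ hK.measurableSet.nullMeasurableSet hKf]
    have : volume Ω - volume K < ENNReal.ofReal τ := by
      refine ENNReal.sub_lt_of_lt_add (measure_mono hKΩ) ?_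
      rw [add_comm]
      exact ENNReal.lt_add_of_sub_lt_right (Or.inl hΩf) hlt
    calc _ < (ENNReal.ofReal τ).toReal := (ENNReal.toReal_lt_toReal (this.trans_le le_top).ne (by simp)).2 this
      _ = τ := ENNReal.toReal_ofReal h.le
  have hKt : Tendsto (fun k => volume.real (K ∩ T k)) l (𝓝 0) := by
    refine hK.induction_on (p := fun S => Tendsto (fun k => volume.real (S ∩ T k)) l (𝓝 0)) ?_ ?_ ?_ ?_
    · simp
    · intro s t hst ht
      exact squeeze_zero (fun k => measureReal_nonneg)
        (fun k => measureReal_mono (inter_subset_inter_left _ hst) (hST t k)) ht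
    · intro s t hs ht
      refine squeeze_zero (fun k => measureReal_nonneg) (fun k => ?_) (by simpa using hs.add ht)
      rw [union_inter_distrib_right]
      exact measureReal_union_le _ _
    · intro x hx
      obtain ⟨r, hr, hr'⟩ := hloc x (hKΩ hx)
      exact ⟨_, mem_nhdsWithin_of_mem_nhds (Metric.ball_mem_nhds x hr), hr'⟩
  have hle : ∀ k, volume.real (T k) ≤ volume.real (K ∩ T k) + volume.real (Ω \ K) := fun k => by
    have hsub : T k ⊆ (K ∩ T k) ∪ (Ω \ K) := fun x hx => by
      by_cases hxK : x ∈ K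
      · exact Or.inl ⟨hxK, hx⟩
      · exact Or.inr ⟨hT k hx, hxK⟩
    refine (measureReal_mono hsub ?_).trans (measureReal_union_le _ _)
    exact (measure_union_lt_top (hST K k).lt_top
      ((measure_mono sdiff_subset).trans_lt hΩf.lt_top)).ne
  have := le_of_tendsto_of_tendsto' hτ (hKt.add_const _) hle
  linarith

/-- At volume strictly between zero and `|Ω|`, the first variation of the volume is bounded from
below on sets of bounded perimeter. -/
theorem exists_nondegenerate (hΩo : IsOpen Ω) (hΩb : Bornology.IsBounded Ω) (hΩc : IsConnected Ω)
    {d : ℝ} (hd0 : 0 < d) (hd1 : d < volume.real Ω) {M : ℝ≥0∞} (hM : M ≠ ⊤) :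
    ∃ c > 0, ∃ δ > 0, ∀ (E : Set (Euc n)) (μ : Measure (Euc n)) (f : Euc n → Euc n), E ⊆ Ω →
      NullMeasurableSet E volume → IsPolar E μ f → μ Ω ≤ M → |volume.real E - d| ≤ δ →
      ∃ φ e, IsUnitTest Ω φ ∧ ‖e‖ = 1 ∧ c ≤ |∫ x in E, fderiv ℝ φ x e| := by
  by_contra hcon
  push Not at hcon
  have hpos : ∀ k : ℕ, (0 : ℝ) < 1 / ((k : ℝ) + 1) := fun k => by positivity
  choose E μ f hEΩ hE hp hμ hvol hφ using fun k : ℕ => hcon _ (hpos k) _ (hpos k)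
  have hΩf : volume Ω ≠ ⊤ := hΩb.measure_lt_top.ne
  have hEf : ∀ k, volume (E k) ≠ ⊤ := fun k => ((measure_mono (hEΩ k)).trans_lt hΩf.lt_top).ne
  -- An ultrafilter finer than `atTop` spares the extraction of subsequences: each dichotomy below
  -- is decided for the whole sequence at once.
  set U : Ultrafilter ℕ := hyperfilter ℕ
  have hU : (U : Filter ℕ) ≤ atTop := Nat.hyperfilter_le_atTop
  have hε : Tendsto (fun k : ℕ => 1 / ((k : ℝ) + 1)) U (𝓝 0) :=
    (tendsto_one_div_add_atTop_nhds_zero_nat (𝕜 := ℝ)).mono_left hU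
  have hvolt : Tendsto (fun k => volume.real (E k)) U (𝓝 d) := by
    rw [tendsto_iff_dist_tendsto_zero]
    exact squeeze_zero (fun k => dist_nonneg) hvol hε
  have hlocal : ∀ x ∈ Ω, ∃ r > 0, Metric.ball x r ⊆ Ω ∧
      (Tendsto (fun k => volume.real (Metric.ball x r ∩ E k)) U (𝓝 0) ∨
      Tendsto (fun k => volume.real (Metric.ball x r ∩ (Ω \ E k))) U (𝓝 0)) := by
    intro x hx
    obtain ⟨R, hR, hRΩ⟩ := Metric.isOpen_iff.1 hΩo x hx
    set r := R / 2 with hr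
    have hr0 : 0 < r := by positivity
    have h2r : Metric.ball x (2 * r) ⊆ Ω := by rw [hr]; convert hRΩ using 2; ring
    have hrΩ : Metric.ball x r ⊆ Ω := (Metric.ball_subset_ball (by linarith)).trans h2r
    refine ⟨r, hr0, hrΩ, ?_⟩
    have hdiff : ∀ k, Metric.ball x r ∩ (Ω \ E k) = Metric.ball x r \ E k := fun k => by
      ext z
      constructor
      · rintro ⟨h1, h2⟩; exact ⟨h1, h2.2⟩
      · rintro ⟨h1, h2⟩; exact ⟨h1, hrΩ h1, h2⟩
    simp_rw [hdiff]
    have hmin : Tendsto (fun k => min (volume.real (Metric.ball x r ∩ E k))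
        (volume.real (Metric.ball x r \ E k))) U (𝓝 0) := by
      rw [Metric.tendsto_nhds]
      intro η hη
      -- The scale is fixed first from the perimeter bound alone; the constant `A` of the kernel
      -- depends on it, and only then is `k` taken large.
      obtain ⟨s, hs0, hsr, hsM⟩ : ∃ s : ℝ, 0 < s ∧ s < r ∧ 2 * (s * M.toReal) < η / 2 := by
        have hM0 : 0 ≤ M.toReal := ENNReal.toReal_nonneg
        refine ⟨min (r / 2) (η / (8 * (M.toReal + 1))), by positivity,
          (min_le_left _ _).trans_lt (by linarith), ?_⟩
        have : min (r / 2) (η / (8 * (M.toReal + 1))) * M.toReal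
            ≤ η / (8 * (M.toReal + 1)) * (M.toReal + 1) := by
          gcongr
          · exact min_le_right _ _
          · linarith
        have e : η / (8 * (M.toReal + 1)) * (M.toReal + 1) = η / 8 := by field_simp
        linarith
      obtain ⟨A, hA0, hA⟩ := exists_bound_smallBump (n := n) hs0
      have h1 : Tendsto (fun k : ℕ => 2 * (r * A * (1 / ((k : ℝ) + 1)) * volume.real (Metric.ball x r)))
          U (𝓝 0) := by
        have := ((hε.const_mul (r * A)).mul_const (volume.real (Metric.ball x r))).const_mul 2
        simpa using this
      filter_upwards [h1.eventually (gt_mem_nhds (show (0 : ℝ) < η / 2 by positivity))] with k hk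
      have h2 := (hp k).min_volume_le (hE k) x hs0 hsr hA0 hA (hpos k).le fun φ e hφ' he =>
        (hφ k φ e ⟨hφ'.1.mono h2r, hφ'.2⟩ he).le
      have h3 : (μ k).real (Metric.ball x (2 * r)) ≤ M.toReal :=
        ENNReal.toReal_mono hM ((measure_mono h2r).trans (hμ k))
      have h4 : s * (μ k).real (Metric.ball x (2 * r)) ≤ s * M.toReal := by gcongr
      rw [dist_zero_right, Real.norm_of_nonneg (le_min measureReal_nonneg measureReal_nonneg)]
      linarith
    have hor : ∀ᶠ k in (U : Filter ℕ), volume.real (Metric.ball x r ∩ E k) ≤ volume.real (Metric.ball x r \ E k)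
        ∨ volume.real (Metric.ball x r \ E k) ≤ volume.real (Metric.ball x r ∩ E k) :=
      Eventually.of_forall fun k => le_total _ _
    -- The minimum tends to zero, and the ultrafilter decides which of the two volumes realizes it.
    rcases Ultrafilter.eventually_or.1 hor with h | h
    · left
      refine hmin.congr' ?_
      filter_upwards [h] with k hk using min_eq_left hk
    · right
      refine hmin.congr' ?_
      filter_upwards [h] with k hk using min_eq_right hk
  have hopen : ∀ T : ℕ → Set (Euc n), (∀ k, T k ⊆ Ω) →
      IsOpen {x | ∃ r > 0, Tendsto (fun k => volume.real (Metric.ball x r ∩ T k)) U (𝓝 0)} := by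
    intro T hT
    refine Metric.isOpen_iff.2 fun x ⟨r, hr, ht⟩ => ⟨r / 2, by positivity, fun y hy => ⟨r / 2, by positivity, ?_⟩⟩
    refine squeeze_zero (fun k => measureReal_nonneg) (fun k => ?_) ht
    refine measureReal_mono (inter_subset_inter_left _ (Metric.ball_subset_ball' ?_)) ?_
    · rw [Metric.mem_ball] at hy; linarith
    · exact ((measure_mono (inter_subset_right.trans (hT k))).trans_lt hΩf.lt_top).ne
  have hdf : ∀ k, Ω \ E k ⊆ Ω := fun k => sdiff_subset
  set u := {x | ∃ r > 0, Tendsto (fun k => volume.real (Metric.ball x r ∩ E k)) U (𝓝 0)} with hu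
  set v := {x | ∃ r > 0, Tendsto (fun k => volume.real (Metric.ball x r ∩ (Ω \ E k))) U (𝓝 0)} with hv
  have hcov : Ω ⊆ u ∪ v := fun x hx => by
    obtain ⟨r, hr, -, h | h⟩ := hlocal x hx
    · exact Or.inl ⟨r, hr, h⟩
    · exact Or.inr ⟨r, hr, h⟩
  have hΩm := hΩo.measurableSet.nullMeasurableSet (μ := (volume : Measure (Euc n)))
  -- A ball cannot be nearly free both of `E k` and of its complement, its volume being fixed and
  -- positive.
  have hdisj : ¬ (Ω ∩ (u ∩ v)).Nonempty := by
    rintro ⟨x, hx, ⟨r₁, hr₁, h₁⟩, ⟨r₂, hr₂, h₂⟩⟩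
    obtain ⟨R, hR, hRΩ⟩ := Metric.isOpen_iff.1 hΩo x hx
    set r := min R (min r₁ r₂)
    have hr : 0 < r := by positivity
    have hle : ∀ k, volume.real (Metric.ball x r) ≤ volume.real (Metric.ball x r₁ ∩ E k) +
        volume.real (Metric.ball x r₂ ∩ (Ω \ E k)) := fun k => by
      refine (measureReal_mono (fun z hz => ?_) ?_).trans (measureReal_union_le _ _)
      · by_cases hzE : z ∈ E k
        · exact Or.inl ⟨Metric.ball_subset_ball ((min_le_right _ _).trans (min_le_left _ _)) hz, hzE⟩
        · exact Or.inr ⟨Metric.ball_subset_ball ((min_le_right _ _).trans (min_le_right _ _)) hz,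
            hRΩ (Metric.ball_subset_ball (min_le_left _ _) hz), hzE⟩
      · exact (measure_union_lt_top
          ((measure_mono (inter_subset_right.trans (hEΩ k))).trans_lt hΩf.lt_top)
          ((measure_mono (inter_subset_right.trans (hdf k))).trans_lt hΩf.lt_top)).ne
    have h3 := ge_of_tendsto' (h₁.add h₂) hle
    rw [add_zero] at h3
    have h4 : 0 < volume.real (Metric.ball x r) :=
      ENNReal.toReal_pos (Metric.measure_ball_pos volume x hr).ne' measure_ball_lt_top.ne
    linarith
  -- One of the two open sets covers `Ω`, so in the limit either `E k` or its complement in `Ω` has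
  -- no volume, although the volumes tend to `d` and `|Ω| - d`.
  have hconn := hΩc.isPreconnected u v (hopen E hEΩ) (hopen _ hdf) hcov
  by_cases hnu : (Ω ∩ u).Nonempty
  · have hnv : ¬ (Ω ∩ v).Nonempty := fun h => hdisj (hconn hnu h)
    have hΩu : ∀ x ∈ Ω, x ∈ u := fun x hx => (hcov hx).resolve_right fun h => hnv ⟨x, hx, h⟩
    have := eq_zero_of_tendsto_volume hΩo hΩf hEΩ hΩu hvolt
    linarith
  · have hΩv : ∀ x ∈ Ω, x ∈ v := fun x hx => (hcov hx).resolve_left fun h => hnu ⟨x, hx, h⟩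
    have ht : Tendsto (fun k => volume.real (Ω \ E k)) U (𝓝 (volume.real Ω - d)) := by
      refine (hvolt.const_sub (volume.real Ω)).congr fun k => ?_
      rw [measureReal_def, measureReal_def, measureReal_def, measure_sdiff (hEΩ k) (hE k) (hEf k),
        ENNReal.toReal_sub_of_le (measure_mono (hEΩ k)) hΩf]
    have := eq_zero_of_tendsto_volume hΩo hΩf hdf hΩv ht
    linarith

end Compactness

/-! ### Locality of the reduced boundary -/

section Locality

variable {E F U : Set (Euc n)} {μ μ' : Measure (Euc n)} {f f' : Euc n → Euc n}

lemma setIntegral_gradient_congr_of_inter_eq (hE : NullMeasurableSet E volume)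
    (hF : NullMeasurableSet F volume) (hEF : E ∩ U = F ∩ U) {φ : Euc n → ℝ} (hφ : tsupport φ ⊆ U) :
    ∫ x in E, gradient φ x = ∫ x in F, gradient φ x := by
  have key : ∀ T : Set (Euc n), NullMeasurableSet T volume →
      ∫ x in T, gradient φ x = ∫ x in T ∩ U, gradient φ x := fun T hT =>
    setIntegral_eq_of_subset_of_ae_sdiff_eq_zero hT inter_subset_left
      (ae_of_all _ fun x hx => gradient_eq_zero_of_notMem fun h => hx.2 ⟨hx.1, hφ h⟩)
  rw [key E hE, key F hF, hEF]

lemma IsPolar.setIntegral_eq_of_inter_eq (hp : IsPolar E μ f) (hp' : IsPolar F μ' f')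
    (hE : NullMeasurableSet E volume) (hF : NullMeasurableSet F volume) (hU : IsOpen U)
    (hEF : E ∩ U = F ∩ U) {s : Set (Euc n)} (hs : MeasurableSet s) (hsU : s ⊆ U) :
    ∫ x in s, f x ∂μ = ∫ x in s, f' x ∂μ' := by
  have := hp.finite
  have := hp'.finite
  refine setIntegral_eq_of_integral_test_eq hp.integrable hp'.integrable hU
    (fun φ hφ hc hsub => ?_) hs hsU
  rw [← hp.integral_gradient φ (hφ.of_le (by simp)) hc, ← hp'.integral_gradient φ (hφ.of_le (by simp)) hc,
    setIntegral_gradient_congr_of_inter_eq hE hF hEF hsub]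

lemma IsPolar.restrict_eq_of_inter_eq (hp : IsPolar E μ f) (hp' : IsPolar F μ' f')
    (hE : NullMeasurableSet E volume) (hF : NullMeasurableSet F volume) (hU : IsOpen U)
    (hEF : E ∩ U = F ∩ U) : μ.restrict U = μ'.restrict U := by
  have := hp.finite
  have := hp'.finite
  have e : (μ.restrict U).withDensityᵥ f = (μ'.restrict U).withDensityᵥ f' := by
    ext1 s hs
    rw [withDensityᵥ_apply hp.integrable.restrict hs, withDensityᵥ_apply hp'.integrable.restrict hs,
      Measure.restrict_restrict hs, Measure.restrict_restrict hs]
    exact hp.setIntegral_eq_of_inter_eq hp' hE hF hU hEF (hs.inter hU.measurableSet) inter_subset_right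
  rw [← variation_withDensity_of_norm_eq_one hp.measurable (ae_restrict_of_ae hp.norm_eq_one), e,
    variation_withDensity_of_norm_eq_one hp'.measurable (ae_restrict_of_ae hp'.norm_eq_one)]

/-- Test functions supported in `U` see only `E ∩ U`, so the Gauss-Green measures agree in `U`, and
small balls around `x` lie in `U`. -/
lemma normalRatio_eventuallyEq (hE : HasFinitePerimeter E) (hF : HasFinitePerimeter F) (hU : IsOpen U)
    (hEF : E ∩ U = F ∩ U) {x : Euc n} (hx : x ∈ U) :
    normalRatio E x =ᶠ[𝓝[>] 0] normalRatio F x := by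
  obtain ⟨f, hp⟩ := hE.exists_polar
  obtain ⟨f', hp'⟩ := hF.exists_polar
  obtain ⟨R, hR, hRU⟩ := Metric.isOpen_iff.1 hU x hx
  filter_upwards [Ioo_mem_nhdsGT hR] with r hr
  have hsub : Metric.ball x r ⊆ U := (Metric.ball_subset_ball hr.2.le).trans hRU
  have h1 := hp.restrict_eq_of_inter_eq hp' hE.1 hF.1 hU hEF
  have h2 : (gaussGreen E).variation (Metric.ball x r) = (gaussGreen F).variation (Metric.ball x r) := by
    rw [← Measure.restrict_eq_self _ hsub, h1, Measure.restrict_eq_self _ hsub]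
  rw [hp.normalRatio_eq, hp'.normalRatio_eq, measureReal_def, measureReal_def, h2,
    hp.setIntegral_eq_of_inter_eq hp' hE.1 hF.1 hU hEF measurableSet_ball hsub]

lemma mem_reducedBoundary_congr (hE : HasFinitePerimeter E) (hF : HasFinitePerimeter F)
    (hU : IsOpen U) (hEF : E ∩ U = F ∩ U) {x : Euc n} (hx : x ∈ U) :
    x ∈ reducedBoundary E ↔ x ∈ reducedBoundary F := by
  have h := normalRatio_eventuallyEq hE hF hU hEF hx
  simp only [reducedBoundary, mem_ofPred_eq, tendsto_congr' h]

lemma outerNormal_congr (hE : HasFinitePerimeter E) (hF : HasFinitePerimeter F)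
    (hU : IsOpen U) (hEF : E ∩ U = F ∩ U) {x : Euc n} (hx : x ∈ U) :
    outerNormal E x = outerNormal F x := by
  have h := normalRatio_eventuallyEq hE hF hU hEF hx
  simp only [outerNormal, limUnder, Filter.map_congr h]

lemma isPolar_empty : IsPolar (∅ : Set (Euc n)) 0 0 :=
  ⟨inferInstance, measurable_const, by simp, by simp⟩

lemma isPolar_univ : IsPolar (univ : Set (Euc n)) 0 0 :=
  ⟨inferInstance, measurable_const, by simp, fun φ hφ hc => by
    simpa using integral_gradient_eq_zero hφ hc⟩

lemma IsPolar.hasFinitePerimeter (hp : IsPolar E μ f) (hE : NullMeasurableSet E volume) :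
    HasFinitePerimeter E := ⟨hE, _, hp.isGaussGreen⟩

lemma IsPolar.reducedBoundary_eq_empty (hp : IsPolar E 0 f) : reducedBoundary E = ∅ := by
  refine eq_empty_of_forall_notMem fun x ⟨ν, hν, ht⟩ => ?_
  have : normalRatio E x = fun _ => 0 := by
    ext1 r
    rw [hp.normalRatio_eq]
    simp
  rw [this] at ht
  have := tendsto_nhds_unique ht tendsto_const_nhds
  rw [this, norm_zero] at hν
  exact zero_ne_one hν

/-- Off the frontier the set is locally everything or nothing, and both the whole space and the
empty set have zero Gauss-Green measure. -/
lemma reducedBoundary_subset_frontier (hE : HasFinitePerimeter E) : reducedBoundary E ⊆ frontier E := by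
  intro x hx
  by_contra hf
  rw [frontier, Set.mem_sdiff, not_and_not_right] at hf
  by_cases hc : x ∈ closure E
  · have h1 : E ∩ interior E = univ ∩ interior E := by
      rw [univ_inter, inter_eq_right]; exact interior_subset
    rw [mem_reducedBoundary_congr hE (isPolar_univ.hasFinitePerimeter nullMeasurableSet_univ)
      isOpen_interior h1 (hf hc), isPolar_univ.reducedBoundary_eq_empty] at hx
    exact hx
  · have h1 : E ∩ (closure E)ᶜ = ∅ ∩ (closure E)ᶜ := by
      rw [empty_inter]
      exact disjoint_iff_inter_eq_empty.1 (disjoint_compl_right.mono_left subset_closure)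
    rw [mem_reducedBoundary_congr hE (isPolar_empty.hasFinitePerimeter nullMeasurableSet_empty)
      isClosed_closure.isOpen_compl h1 hc, isPolar_empty.reducedBoundary_eq_empty] at hx
    exact hx

end Locality

/-! ### Functionals represented by vector measures -/

section Represented

/-- The functional `L` on `C¹_c` is given by a finite vector measure. -/
def IsRepresented (L : (Euc n → ℝ) → Euc n) : Prop :=
  ∃ (ρ : Measure (Euc n)) (g : Euc n → Euc n), IsFiniteMeasure ρ ∧ Measurable g ∧ Integrable g ρ ∧
    ∀ φ : Euc n → ℝ, ContDiff ℝ 1 φ → HasCompactSupport φ → L φ = ∫ x, φ x • g x ∂ρ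

lemma isRepresented_const (ρ : Measure (Euc n)) [IsFiniteMeasure ρ] (v : Euc n) :
    IsRepresented fun φ : Euc n → ℝ => ∫ x, φ x • v ∂ρ :=
  ⟨ρ, fun _ => v, inferInstance, measurable_const, integrable_const v, fun _ _ _ => rfl⟩

lemma IsRepresented.congr {L L' : (Euc n → ℝ) → Euc n} (h : IsRepresented L)
    (he : ∀ φ : Euc n → ℝ, ContDiff ℝ 1 φ → HasCompactSupport φ → L' φ = L φ) : IsRepresented L' := by
  obtain ⟨ρ, g, h1, h2, h3, h4⟩ := h
  exact ⟨ρ, g, h1, h2, h3, fun φ hφ hc => (he φ hφ hc).trans (h4 φ hφ hc)⟩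

lemma Integrable.smul_of_contDiff {ρ : Measure (Euc n)} {g : Euc n → Euc n} (hg : Integrable g ρ)
    {φ : Euc n → ℝ} (hφ : ContDiff ℝ 1 φ) (hc : HasCompactSupport φ) :
    Integrable (fun x => φ x • g x) ρ := by
  obtain ⟨K, hK⟩ := hc.exists_bound_of_continuous hφ.continuous
  exact hg.bdd_smul K hφ.continuous.aestronglyMeasurable (ae_of_all _ hK)

lemma exists_density_of_absolutelyContinuous {ρ σ : Measure (Euc n)} [IsFiniteMeasure ρ]
    [IsFiniteMeasure σ] (h : ρ ≪ σ) {g : Euc n → Euc n} (hg : Measurable g) (hgi : Integrable g ρ) :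
    ∃ k : Euc n → Euc n, Measurable k ∧ Integrable k σ ∧
      ∀ φ : Euc n → ℝ, ∫ x, φ x • g x ∂ρ = ∫ x, φ x • k x ∂σ := by
  have := Measure.haveLebesgueDecomposition_of_sigmaFinite ρ σ
  refine ⟨fun x => (ρ.rnDeriv σ x).toReal • g x,
    (Measure.measurable_rnDeriv ρ σ).ennreal_toReal.smul hg, ?_, fun φ => ?_⟩
  · exact (integrable_rnDeriv_smul_iff h).2 hgi
  · rw [← integral_rnDeriv_smul h]
    refine integral_congr_ae (ae_of_all _ fun x => ?_)
    simp only
    rw [smul_comm]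

/-- Both functionals are rewritten with densities against the common measure `ρ + ρ'`. -/
lemma IsRepresented.add {L L' : (Euc n → ℝ) → Euc n} (h : IsRepresented L) (h' : IsRepresented L') :
    IsRepresented fun φ => L φ + L' φ := by
  obtain ⟨ρ, g, h1, h2, h3, h4⟩ := h
  obtain ⟨ρ', g', h1', h2', h3', h4'⟩ := h'
  obtain ⟨k, hk1, hk2, hk3⟩ := exists_density_of_absolutelyContinuous (σ := ρ + ρ')
    (Measure.AbsolutelyContinuous.rfl.add_right ρ') h2 h3
  obtain ⟨k', hk1', hk2', hk3'⟩ := exists_density_of_absolutelyContinuous (σ := ρ + ρ')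
    (by rw [add_comm]; exact Measure.AbsolutelyContinuous.rfl.add_right ρ) h2' h3'
  refine ⟨ρ + ρ', fun x => k x + k' x, inferInstance, hk1.add hk1', hk2.add hk2', fun φ hφ hc => ?_⟩
  simp only [smul_add]
  rw [integral_add (Integrable.smul_of_contDiff hk2 hφ hc) (Integrable.smul_of_contDiff hk2' hφ hc),
    h4 φ hφ hc, h4' φ hφ hc, hk3, hk3']

lemma isRepresented_sum {ι : Type*} (s : Finset ι) (L : ι → (Euc n → ℝ) → Euc n)
    (h : ∀ i ∈ s, IsRepresented (L i)) : IsRepresented fun φ => ∑ i ∈ s, L i φ := by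
  classical
  induction s using Finset.induction_on with
  | empty => simpa using isRepresented_const (0 : Measure (Euc n)) 0
  | insert i s hi ih =>
    simp only [Finset.sum_insert hi]
    exact (h i (by simp)).add (ih fun j hj => h j (by simp [hj]))

/-- Normalization: `g ρ = (g / ‖g‖) (‖g‖ ρ)`, the zeros of `g` being null for the new measure. -/
lemma IsRepresented.exists_isPolar {E : Set (Euc n)}
    (h : IsRepresented fun φ : Euc n → ℝ => ∫ x in E, gradient φ x) : ∃ μ f, IsPolar E μ f := by
  obtain ⟨ρ, g, h1, h2, h3, h4⟩ := h
  refine ⟨ρ.withDensity fun x => ‖g x‖ₑ, fun x => ‖g x‖⁻¹ • g x, ?_, h2.norm.inv.smul h2, ?_,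
    fun φ hφ hc => ?_⟩
  · exact isFiniteMeasure_withDensity h3.2.ne
  · rw [ae_withDensity_iff h2.enorm]
    refine ae_of_all _ fun x hx => ?_
    have : ‖g x‖ ≠ 0 := by simpa using hx
    rw [norm_smul, norm_inv, norm_norm, inv_mul_cancel₀ this]
  · have e : (fun x => ‖g x‖ₑ) = fun x => ((‖g x‖₊ : ℝ≥0) : ℝ≥0∞) := rfl
    rw [e, integral_withDensity_eq_integral_smul h2.nnnorm]
    refine (h4 φ hφ hc).trans ?_
    refine integral_congr_ae (ae_of_all _ fun x => ?_)
    simp only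
    rw [NNReal.smul_def, coe_nnnorm, smul_comm (φ x), smul_smul]
    rcases eq_or_ne (g x) 0 with h0 | h0
    · simp [h0]
    · rw [mul_inv_cancel₀ (norm_ne_zero_iff.2 h0), one_smul]

end Represented

/-! ### Unions of boxes -/

section Boxes

/-- A closed box. -/
def box (a b : Fin n → ℝ) : Set (Euc n) := {x | ∀ i, a i ≤ x i ∧ x i ≤ b i}

/-- The identification of `Fin n → ℝ` with Euclidean space. -/
noncomputable def toEuc (n : ℕ) : (Fin n → ℝ) ≃L[ℝ] Euc n :=
  (PiLp.continuousLinearEquiv 2 ℝ (fun _ : Fin n => ℝ)).symm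

@[simp] lemma toEuc_apply (y : Fin n → ℝ) (i : Fin n) : toEuc n y i = y i := rfl

lemma preimage_box (a b : Fin n → ℝ) : toEuc n ⁻¹' box a b = Icc a b := by
  ext y
  simp only [box, mem_preimage, mem_ofPred_eq, toEuc_apply, mem_Icc, Pi.le_def]
  exact forall_and

lemma isClosed_box (a b : Fin n → ℝ) : IsClosed (box a b) := by
  have : box a b = ⋂ i, {x : Euc n | a i ≤ x i ∧ x i ≤ b i} := by ext; simp [box]
  rw [this]
  refine isClosed_iInter fun i => ?_
  have h : Continuous fun x : Euc n => x i := by fun_prop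
  exact (isClosed_le continuous_const h).inter (isClosed_le h continuous_const)

lemma measurePreserving_toEuc : MeasurePreserving (toEuc n) volume volume :=
  PiLp.volume_preserving_toLp (Fin n)

lemma measurableEmbedding_toEuc : MeasurableEmbedding (toEuc n) :=
  (toEuc n).toHomeomorph.measurableEmbedding

lemma volume_box (a b : Fin n → ℝ) : volume (box a b) = ∏ i, ENNReal.ofReal (b i - a i) := by
  rw [← measurePreserving_toEuc.measure_preimage (isClosed_box a b).measurableSet.nullMeasurableSet,
    preimage_box, Real.volume_Icc_pi]

/-- The embedding of a coordinate hyperplane. -/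
noncomputable def faceMap {m : ℕ} (i : Fin (m + 1)) (c : ℝ) (y : Fin m → ℝ) : Euc (m + 1) :=
  toEuc (m + 1) (i.insertNth c y)

lemma lipschitzWith_faceMap {m : ℕ} (i : Fin (m + 1)) (c : ℝ) :
    LipschitzWith (‖(toEuc (m + 1) : (Fin (m + 1) → ℝ) →L[ℝ] Euc (m + 1))‖₊) (faceMap i c) := by
  have h1 : LipschitzWith 1 fun y : Fin m → ℝ => (i.insertNth c y : Fin (m + 1) → ℝ) := by
    refine LipschitzWith.of_dist_le_mul fun x y => ?_
    rw [NNReal.coe_one, one_mul, dist_pi_le_iff dist_nonneg, Fin.forall_iff_succAbove i]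
    simp only [Fin.insertNth_apply_same, dist_self, dist_nonneg, Fin.insertNth_apply_succAbove,
      true_and]
    exact fun j => dist_le_pi_dist x y j
  have h2 := (toEuc (m + 1) : (Fin (m + 1) → ℝ) →L[ℝ] Euc (m + 1)).lipschitz.comp h1
  rwa [mul_one] at h2

/-- A face is a Lipschitz image of an `m`-dimensional box, on which `𝓗^m` is Lebesgue measure. -/
lemma surfaceMeasure_face_lt_top {m : ℕ} (i : Fin (m + 1)) (c : ℝ) (a b : Fin m → ℝ) :
    surfaceMeasure (m + 1) (faceMap i c '' Icc a b) < ⊤ := by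
  rw [surfaceMeasure, Measure.smul_apply, smul_eq_mul]
  refine ENNReal.mul_lt_top surfaceMeasure_const_ne_top.lt_top ?_
  have e : ((m + 1 : ℕ) : ℝ) - 1 = m := by push_cast; ring
  rw [e]
  refine (((lipschitzWith_faceMap i c).lipschitzOnWith).hausdorffMeasure_image_le
    (Nat.cast_nonneg m)).trans_lt ?_
  have h := hausdorffMeasure_pi_real (ι := Fin m)
  rw [Fintype.card_fin] at h
  rw [h, Real.volume_Icc_pi]
  refine ENNReal.mul_lt_top (ENNReal.rpow_lt_top_of_nonneg (Nat.cast_nonneg m) (by simp)) ?_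
  exact ENNReal.prod_lt_top fun _ _ => ENNReal.ofReal_lt_top

lemma sum_fderiv_smul (φ : Euc n → ℝ) (x : Euc n) :
    ∑ i, fderiv ℝ φ x (toEuc n (Pi.single i 1)) • toEuc n (Pi.single i 1) = gradient φ x := by
  have h := (EuclideanSpace.basisFun (Fin n) ℝ).sum_repr (gradient φ x)
  rw [← h]
  refine Finset.sum_congr rfl fun i _ => ?_
  have e : toEuc n (Pi.single i 1) = EuclideanSpace.basisFun (Fin n) ℝ i := by
    rw [EuclideanSpace.basisFun_apply]; rfl
  rw [e, ← inner_gradient_eq_fderiv, real_inner_comm, OrthonormalBasis.repr_apply_apply]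

/-- The vector-valued divergence theorem with components `φ e_i`, whose divergence is `∇φ`. The
representing measures are push-forwards of Lebesgue measure to the faces, with the outer normals
`±e_i`. -/
lemma isRepresented_box {m : ℕ} {a b : Fin (m + 1) → ℝ} (hab : a ≤ b) :
    IsRepresented fun φ : Euc (m + 1) → ℝ => ∫ x in box a b, gradient φ x := by
  set T := toEuc (m + 1)
  set e : Fin (m + 1) → Euc (m + 1) := fun i => T (Pi.single i 1)
  set Q : Fin (m + 1) → Set (Fin m → ℝ) := fun i => Icc (a ∘ i.succAbove) (b ∘ i.succAbove)
  have hfin : ∀ i (c : ℝ), IsFiniteMeasure ((volume.restrict (Q i)).map (faceMap i c)) := fun i c => by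
    have : IsFiniteMeasure (volume.restrict (Q i)) := ⟨by simpa using isCompact_Icc.measure_lt_top⟩
    infer_instance
  have hrep : IsRepresented fun φ : Euc (m + 1) → ℝ => ∑ i,
      ((∫ x, φ x • e i ∂(volume.restrict (Q i)).map (faceMap i (b i))) +
        ∫ x, φ x • (-e i) ∂(volume.restrict (Q i)).map (faceMap i (a i))) := by
    refine isRepresented_sum Finset.univ _ fun i _ => ?_
    have := hfin i (a i)
    have := hfin i (b i)
    exact (isRepresented_const _ _).add (isRepresented_const _ _)
  refine hrep.congr fun φ hφ hc => ?_
  have hmap : ∀ i c (v : Euc (m + 1)), ∫ x, φ x • v ∂(volume.restrict (Q i)).map (faceMap i c)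
      = ∫ y in Q i, φ (faceMap i c y) • v := fun i c v =>
    integral_map (lipschitzWith_faceMap i c).continuous.measurable.aemeasurable
      (hφ.continuous.smul continuous_const).aestronglyMeasurable
  simp_rw [hmap]
  have hdiv := integral_divergence_of_hasFDerivAt_off_countable' a b hab
    (fun i y => φ (T y) • e i)
    (fun i y => ((fderiv ℝ φ (T y)).comp (T : (Fin (m + 1) → ℝ) →L[ℝ] Euc (m + 1))).smulRight (e i))
    ∅ countable_empty
    (fun i => ((hφ.continuous.comp T.continuous).smul continuous_const).continuousOn)
    (fun y _ i => ((hφ.differentiable one_ne_zero (T y)).hasFDerivAt.comp y T.hasFDerivAt).smul_const (e i))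
    (by
      have : (fun y => ∑ i, (((fderiv ℝ φ (T y)).comp
          (T : (Fin (m + 1) → ℝ) →L[ℝ] Euc (m + 1))).smulRight (e i)) (Pi.single i 1))
          = fun y => gradient φ (T y) := by
        ext1 y
        exact sum_fderiv_smul φ (T y)
      rw [this]
      exact ((ContDiff.continuous_gradient hφ).comp T.continuous).continuousOn.integrableOn_compact
        isCompact_Icc)
  have e1 : ∫ x in box a b, gradient φ x = ∫ y in Icc a b, gradient φ (T y) := by
    rw [← measurePreserving_toEuc.setIntegral_preimage_emb measurableEmbedding_toEuc, preimage_box]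
  rw [e1]
  refine Eq.trans ?_ (hdiv.trans ?_)
  · refine integral_congr_ae (ae_of_all _ fun y => ?_)
    exact (sum_fderiv_smul φ (T y)).symm
  · refine Finset.sum_congr rfl fun i _ => ?_
    simp only [smul_neg, integral_neg]
    rw [← sub_eq_add_neg]
    rfl

lemma frontier_box_subset {m : ℕ} (a b : Fin (m + 1) → ℝ) (x : Euc (m + 1)) (hx : x ∈ box a b)
    (hx' : x ∉ interior (box a b)) :
    x ∈ ⋃ i, (faceMap i (a i) '' Icc (a ∘ i.succAbove) (b ∘ i.succAbove)) ∪
      (faceMap i (b i) '' Icc (a ∘ i.succAbove) (b ∘ i.succAbove)) := by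
  have hface : ∀ i c, x i = c → x ∈ faceMap i c '' Icc (a ∘ i.succAbove) (b ∘ i.succAbove) := by
    rintro i c rfl
    refine ⟨fun j => x (i.succAbove j), ⟨fun j => (hx _).1, fun j => (hx _).2⟩, ?_⟩
    ext j
    rw [faceMap, toEuc_apply]
    exact congrFun (Fin.insertNth_self_removeNth i (fun k => x k)) j
  by_contra hn
  simp only [mem_iUnion, mem_union, not_exists, not_or] at hn
  refine hx' (mem_interior.2 ⟨{y | ∀ i, a i < y i ∧ y i < b i}, fun y hy i => ⟨(hy i).1.le, (hy i).2.le⟩,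
    ?_, fun i => ⟨?_, ?_⟩⟩)
  · have : {y : Euc (m + 1) | ∀ i, a i < y i ∧ y i < b i}
        = ⋂ i, {y : Euc (m + 1) | a i < y i ∧ y i < b i} := by ext; simp
    rw [this]
    refine isOpen_iInter_of_finite fun i => ?_
    have h : Continuous fun x : Euc (m + 1) => x i := by fun_prop
    exact (isOpen_lt continuous_const h).inter (isOpen_lt h continuous_const)
  · exact lt_of_le_of_ne (hx i).1 fun h => (hn i).1 (hface i _ h.symm)
  · exact lt_of_le_of_ne (hx i).2 fun h => (hn i).2 (hface i _ h)

/-- Disjointness lets the gradient integrals be added, and the reduced boundary sits in the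
frontier, which is contained in finitely many faces. -/
lemma hasFinitePerimeter_biUnion_box {m : ℕ} {ι : Type*} (Z : Finset ι) (a b : ι → Fin (m + 1) → ℝ)
    (hab : ∀ z ∈ Z, a z ≤ b z)
    (hd : Set.Pairwise (Z : Set ι) (Function.onFun Disjoint fun z => box (a z) (b z))) :
    HasFinitePerimeter (⋃ z ∈ Z, box (a z) (b z)) ∧
      surfaceMeasure (m + 1) (reducedBoundary (⋃ z ∈ Z, box (a z) (b z))) < ⊤ := by
  have hclosed : IsClosed (⋃ z ∈ Z, box (a z) (b z)) :=
    isClosed_biUnion_finset fun z _ => isClosed_box _ _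
  have hfp : HasFinitePerimeter (⋃ z ∈ Z, box (a z) (b z)) := by
    have hr : IsRepresented fun φ : Euc (m + 1) → ℝ => ∫ x in ⋃ z ∈ Z, box (a z) (b z), gradient φ x := by
      refine (isRepresented_sum Z _ fun z hz => isRepresented_box (hab z hz)).congr fun φ hφ hc => ?_
      exact integral_biUnion_finset Z (fun z _ => (isClosed_box _ _).measurableSet) hd
        fun z _ => (integrable_gradient hφ hc volume).integrableOn
    obtain ⟨μ, f, hp⟩ := hr.exists_isPolar
    exact hp.hasFinitePerimeter hclosed.measurableSet.nullMeasurableSet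
  refine ⟨hfp, ?_⟩
  have hsub : reducedBoundary (⋃ z ∈ Z, box (a z) (b z)) ⊆ ⋃ z ∈ Z, ⋃ i,
      (faceMap i (a z i) '' Icc (a z ∘ i.succAbove) (b z ∘ i.succAbove)) ∪
      (faceMap i (b z i) '' Icc (a z ∘ i.succAbove) (b z ∘ i.succAbove)) := by
    refine (reducedBoundary_subset_frontier hfp).trans fun x hx => ?_
    rw [hclosed.frontier_eq] at hx
    obtain ⟨hx1, hx2⟩ := hx
    simp only [mem_iUnion₂] at hx1
    obtain ⟨z, hz, hxz⟩ := hx1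
    refine mem_biUnion hz (frontier_box_subset _ _ x hxz fun h => hx2 ?_)
    exact interior_mono (subset_biUnion_of_mem (u := fun z => box (a z) (b z)) hz) h
  refine (measure_mono hsub).trans_lt ?_
  refine (measure_biUnion_finset_le _ _).trans_lt (ENNReal.sum_lt_top.2 fun z _ => ?_)
  refine (measure_iUnion_le _).trans_lt ?_
  rw [tsum_fintype]
  exact ENNReal.sum_lt_top.2 fun i _ =>
    measure_union_lt_top (surfaceMeasure_face_lt_top _ _ _ _) (surfaceMeasure_face_lt_top _ _ _ _)

end Boxes

/-- Cubes of a grid. -/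
lemma exists_grid_cover {K : Set (Euc n)} (hK : IsCompact K) {h : ℝ} (hh : 0 < h) :
    ∃ Z : Finset (Fin n → ℤ), K ⊆ (⋃ z ∈ Z, box (fun i => h * z i) (fun i => h * z i + h)) ∧
      ∀ z ∈ Z, (box (fun i => h * z i) (fun i => h * z i + h) ∩ K).Nonempty := by
  classical
  obtain ⟨R, hR⟩ := hK.isBounded.exists_norm_le
  obtain ⟨N, hN⟩ := exists_nat_gt (R / h + 1)
  refine ⟨(Fintype.piFinset fun _ : Fin n => Finset.Icc (-(N : ℤ)) N).filter fun z =>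
    (box (fun i => h * z i) (fun i => h * z i + h) ∩ K).Nonempty, fun x hx => ?_,
    fun z hz => (Finset.mem_filter.1 hz).2⟩
  have hbox : x ∈ box (fun i => h * (⌊x i / h⌋ : ℤ)) (fun i => h * (⌊x i / h⌋ : ℤ) + h) := by
    intro i
    have h1 := Int.floor_le (x i / h)
    have h2 := (Int.lt_floor_add_one (x i / h)).le
    rw [le_div_iff₀ hh] at h1
    rw [div_le_iff₀ hh] at h2
    constructor <;> nlinarith
  refine mem_biUnion (x := fun i => ⌊x i / h⌋) (Finset.mem_coe.2 (Finset.mem_filter.2 ⟨?_, x, hbox, hx⟩)) hbox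
  rw [Fintype.mem_piFinset]
  intro i
  have hxi : |x i| ≤ R := (PiLp.norm_apply_le x i).trans (hR x hx)
  have h3 : |x i / h| ≤ R / h := by
    rw [abs_div, abs_of_pos hh]; gcongr
  rw [abs_le] at h3
  rw [Finset.mem_Icc]
  constructor
  · rw [Int.le_floor]
    push_cast
    linarith [h3.1]
  · rw [← Int.lt_add_one_iff, Int.floor_lt]
    push_cast
    linarith [h3.2]

/-- A set of prescribed volume with finite perimeter. -/
lemma exists_hasFinitePerimeter_volume_eq (hn : 1 ≤ n) {Ω : Set (Euc n)} (hΩo : IsOpen Ω)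
    {d : ℝ} (hd0 : 0 < d) (hd1 : ENNReal.ofReal d < volume Ω) :
    ∃ E ⊆ Ω, HasFinitePerimeter E ∧ volume E = ENNReal.ofReal d ∧
      surfaceMeasure n (reducedBoundary E) < ⊤ := by
  obtain ⟨m, rfl⟩ : ∃ m, n = m + 1 := ⟨n - 1, by omega⟩
  obtain ⟨K, hKΩ, hK, hKd⟩ := hΩo.exists_lt_isCompact hd1
  obtain ⟨η, hη, hth⟩ := hK.exists_cthickening_subset_open hΩo hKΩ
  set L : ℝ := ‖(toEuc (m + 1) : (Fin (m + 1) → ℝ) →L[ℝ] Euc (m + 1))‖ with hL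
  have hL0 : 0 ≤ L := norm_nonneg _
  -- The factor `L` converts the sup norm into the Euclidean one, so a cube of side `h` meeting `K`
  -- stays within distance `η` of `K`, hence in `Ω`.
  set h : ℝ := η / (L + 1) with hh
  have hh0 : 0 < h := by positivity
  have hLh : L * h ≤ η := by
    rw [hh, mul_div_assoc', div_le_iff₀ (by positivity)]
    nlinarith
  obtain ⟨Z, hZK, hZ⟩ := exists_grid_cover hK hh0
  have hcube : ∀ (z : Fin (m + 1) → ℤ) (s : ℝ), 0 ≤ s → volume (box (fun i => h * z i) (fun i => h * z i + s))
      = ENNReal.ofReal (s ^ (m + 1)) := fun z s hs => by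
    rw [volume_box]
    simp [ENNReal.ofReal_pow hs]
  have hN : d < Z.card * h ^ (m + 1) := by
    have h1 : ENNReal.ofReal d < ENNReal.ofReal (Z.card * h ^ (m + 1)) := by
      refine hKd.trans_le ((measure_mono hZK).trans ((measure_biUnion_finset_le _ _).trans ?_))
      rw [Finset.sum_congr rfl fun z _ => hcube z h hh0.le, Finset.sum_const, nsmul_eq_mul,
        ENNReal.ofReal_mul (by positivity), ENNReal.ofReal_natCast]
    exact (ENNReal.ofReal_lt_ofReal_iff_of_nonneg hd0.le).1 h1
  have hZ0 : (0 : ℝ) < Z.card := by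
    by_contra hneg
    have : (Z.card : ℝ) = 0 := le_antisymm (not_lt.1 hneg) (Nat.cast_nonneg _)
    rw [this, zero_mul] at hN
    linarith
  -- All cubes are shrunk to a common side so that the total volume is exactly `d`; since `s < h`,
  -- the shrunken closed cubes are disjoint.
  set s : ℝ := (d / Z.card) ^ (((m + 1 : ℕ) : ℝ)⁻¹) with hs
  have hs0 : 0 ≤ s := by positivity
  have hsn : s ^ (m + 1) = d / Z.card := Real.rpow_inv_natCast_pow (by positivity) (by omega)
  have hsh : s < h := by
    refine lt_of_pow_lt_pow_left₀ (m + 1) hh0.le ?_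
    rw [hsn, div_lt_iff₀ hZ0]
    linarith
  have hdisj : Set.Pairwise (Z : Set (Fin (m + 1) → ℤ)) (Function.onFun Disjoint fun z =>
      box (fun i => h * z i) (fun i => h * z i + s)) := by
    intro z _ w _ hzw
    obtain ⟨i, hi⟩ := Function.ne_iff.1 hzw
    refine Set.disjoint_left.2 fun x hx hx' => ?_
    have h1 := hx i
    have h2 := hx' i
    simp only at h1 h2
    rcases lt_or_gt_of_ne hi with hlt | hlt
    · have : ((z i : ℤ) : ℝ) + 1 ≤ w i := by exact_mod_cast hlt
      nlinarith [h1.2, h2.1]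
    · have : ((w i : ℤ) : ℝ) + 1 ≤ z i := by exact_mod_cast hlt
      nlinarith [h1.1, h2.2]
  obtain ⟨hfp, hfin⟩ := hasFinitePerimeter_biUnion_box Z (fun z i => h * z i) (fun z i => h * z i + s)
    (fun z _ i => by simp only; linarith) hdisj
  refine ⟨_, ?_, hfp, ?_, hfin⟩
  · refine iUnion₂_subset fun z hz x hx => hth ?_
    obtain ⟨y, hy, hyK⟩ := hZ z hz
    refine Metric.mem_cthickening_of_dist_le x y _ _ hyK ?_
    refine le_trans ?_ hLh
    have h1 := (toEuc (m + 1) : (Fin (m + 1) → ℝ) →L[ℝ] Euc (m + 1)).le_opNorm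
      ((fun i => x i) - fun i => y i)
    have e : (toEuc (m + 1) : (Fin (m + 1) → ℝ) →L[ℝ] Euc (m + 1)) ((fun i => x i) - fun i => y i)
        = x - y := rfl
    rw [e] at h1
    rw [dist_eq_norm]
    refine h1.trans ?_
    gcongr
    rw [pi_norm_le_iff_of_nonneg hh0.le]
    intro i
    have h2 := hx i
    have h3 := hy i
    simp only at h2 h3
    rw [Pi.sub_apply, Real.norm_eq_abs, abs_le]
    constructor <;> linarith [h2.1, h2.2, h3.1, h3.2]
  · rw [measure_biUnion_finset hdisj fun z _ => (isClosed_box _ _).measurableSet,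
      Finset.sum_congr rfl fun z _ => hcube z s hs0, Finset.sum_const, nsmul_eq_mul, hsn,
      ← ENNReal.ofReal_natCast, ← ENNReal.ofReal_mul (by positivity)]
    congr 1
    field_simp

/-! ### Finiteness of the energy of the reference competitor -/

lemma sigma_nonneg {α β : ℝ} (hα : 0 ≤ α) (hβ : 0 ≤ β) (Ω E : Set (Euc n)) (x : Euc n) :
    0 ≤ sigma α β Ω E x :=
  add_nonneg (indicator_nonneg (fun _ _ => hα) _) (indicator_nonneg (fun _ _ => hβ) _)

lemma sigma_le {α β : ℝ} (hα : 0 ≤ α) (hβ : 0 ≤ β) (Ω E : Set (Euc n)) (x : Euc n) :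
    sigma α β Ω E x ≤ α + β :=
  add_le_add (indicator_le' (fun _ _ => le_rfl) (fun _ _ => hα) x)
    (indicator_le' (fun _ _ => le_rfl) (fun _ _ => hβ) x)

lemma lintegral_sigma_lt_top {α β : ℝ} (hα : 0 ≤ α) (hβ : 0 ≤ β) {Ω : Set (Euc n)} (E : Set (Euc n))
    {u : Euc n → ℝ} (hu : MemH1 Ω u) {G : Set (Euc n)} (hG : G ⊆ Ω) :
    ∫⁻ x in G, ENNReal.ofReal (sigma α β Ω E x * ‖weakGradient Ω u x‖ ^ 2) < ⊤ := by
  have hg := (weakGradient_spec hu.2).1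
  have h1 : ∫⁻ x in Ω, ‖weakGradient Ω u x‖ₑ ^ 2 < ⊤ := by
    have := lintegral_rpow_enorm_lt_top_of_eLpNorm_lt_top two_ne_zero ENNReal.ofNat_ne_top hg.2
    simpa using this
  calc _ ≤ ∫⁻ x in Ω, ENNReal.ofReal (α + β) * ‖weakGradient Ω u x‖ₑ ^ 2 := by
        refine lintegral_mono' (Measure.restrict_mono hG le_rfl) fun x => ?_
        rw [ENNReal.ofReal_mul (sigma_nonneg hα hβ _ _ _), ENNReal.ofReal_pow (norm_nonneg _), ofReal_norm]
        exact mul_le_mul' (ENNReal.ofReal_le_ofReal (sigma_le hα hβ _ _ _)) le_rfl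
    _ < ⊤ := by
        rw [lintegral_const_mul' _ _ ENNReal.ofReal_ne_top]
        exact ENNReal.mul_lt_top ENNReal.ofReal_lt_top h1

lemma anisoPerimeter_lt_top {E Ω : Set (Euc n)} {A : Euc n → Matrix (Fin n) (Fin n) ℝ} {lam Lam : ℝ}
    (hE : HasFinitePerimeter E) (hΩ : MeasurableSet Ω) (hell : UniformlyElliptic Ω A lam Lam)
    (h : surfaceMeasure n (reducedBoundary E) < ⊤) : anisoPerimeter A E Ω < ⊤ := by
  obtain ⟨f, hp⟩ := hE.exists_polar
  calc anisoPerimeter A E Ω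
      ≤ ∫⁻ _ in Ω ∩ reducedBoundary E, ENNReal.ofReal (Real.sqrt Lam) ∂surfaceMeasure n := by
        refine setLIntegral_mono' (hΩ.inter hp.measurableSet_reducedBoundary) fun x hx => ?_
        obtain ⟨ν, hν, ht⟩ := hx.2
        refine ENNReal.ofReal_le_ofReal (Real.sqrt_le_sqrt ?_)
        rw [outerNormal_eq ht]
        simpa [hν] using (hell x hx.1 ν).2
    _ < ⊤ := by
        rw [setLIntegral_const]
        exact ENNReal.mul_lt_top ENNReal.ofReal_lt_top ((measure_mono inter_subset_right).trans_lt h)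

lemma memH10_zero {G : Set (Euc n)} (hG : IsOpen G) : MemH10 G fun _ => 0 := by
  have ht : IsTest G fun _ => (0 : ℝ) := ⟨contDiff_const, HasCompactSupport.zero, by
    have : tsupport (fun _ : Euc n => (0 : ℝ)) = ∅ := tsupport_eq_empty_iff.2 rfl
    rw [this]; exact empty_subset _⟩
  have hg : gradient (fun _ : Euc n => (0 : ℝ)) = fun _ => 0 := by
    ext1 x; simp [gradient]
  refine memH10_of_approx hG MemLp.zero (g := fun _ => 0) MemLp.zero fun ε hε =>
    ⟨_, ht, by simpa using hε, by simpa [hg] using hε⟩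

lemma Admissible.memH1 {Ω E : Set (Euc n)} {u u₀ : Euc n → ℝ} (hu₀ : MemH1 Ω u₀)
    (h : Admissible Ω u₀ E u) : MemH1 Ω u := by
  simpa using h.2.2.1.add hu₀

/-! ### Correction of the volume -/

section VolumeCorrection

variable {Ω : Set (Euc n)} {α β : ℝ} {A : Euc n → Matrix (Fin n) (Fin n) ℝ} {lam Lam γ d : ℝ}
  {u₀ : Euc n → ℝ}

/-- The bulk factor `1 + 8|t|` and the surface factor `1 + C|t|^γ` are both at most `1 + (8 +
C)|t|^γ`, because `|t| ≤ |t|^γ`. -/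
lemma Shear.energy_image_le (S : Shear n) (hΩo : IsOpen Ω) (hα : 0 ≤ α) (hβ : 0 ≤ β)
    (hS : tsupport S.φ ⊆ Ω) (hγ1 : γ ≤ 1) {E : Set (Euc n)}
    {u : Euc n → ℝ} (hu : MemH1 Ω u) {C : ℝ} (hC : 0 ≤ C)
    (hper : anisoPerimeter A (S.fn '' E) Ω
        ≤ ENNReal.ofReal (1 + C * |S.t| ^ γ) * anisoPerimeter A E Ω) :
    energy α β A Ω (S.fn '' E) (fun y => u (S.inv y)) Ω
      ≤ energy α β A Ω E u Ω + ENNReal.ofReal ((8 + C) * |S.t| ^ γ) * energy α β A Ω E u Ω := by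
  have hbulk := S.lintegral_weakGradient_comp_inv_le hΩo hS hu hα hβ E
  set a := |S.t| ^ γ
  have ha0 : 0 ≤ a := by positivity
  have hta : |S.t| ≤ a := by
    rcases (abs_nonneg S.t).eq_or_lt with h | h
    · rw [← h]; exact ha0
    · simpa using Real.rpow_le_rpow_of_exponent_ge h (S.abs_t.trans (by norm_num)) hγ1
  set I := ∫⁻ x in Ω, ENNReal.ofReal (sigma α β Ω E x * ‖weakGradient Ω u x‖ ^ 2) with hI
  have h1 : ENNReal.ofReal (1 + 8 * |S.t|) ≤ 1 + ENNReal.ofReal ((8 + C) * a) := by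
    rw [← ENNReal.ofReal_one, ← ENNReal.ofReal_add zero_le_one (by positivity)]
    refine ENNReal.ofReal_le_ofReal ?_
    have : 0 ≤ C * a := by positivity
    linarith
  have h2 : ENNReal.ofReal (1 + C * a) ≤ 1 + ENNReal.ofReal ((8 + C) * a) := by
    rw [← ENNReal.ofReal_one, ← ENNReal.ofReal_add zero_le_one (by positivity)]
    refine ENNReal.ofReal_le_ofReal ?_
    linarith
  calc _ ≤ ENNReal.ofReal (1 + 8 * |S.t|) * I + ENNReal.ofReal (1 + C * a) * anisoPerimeter A E Ω :=
        add_le_add hbulk hper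
    _ ≤ (1 + ENNReal.ofReal ((8 + C) * a)) * I +
        (1 + ENNReal.ofReal ((8 + C) * a)) * anisoPerimeter A E Ω :=
        add_le_add (mul_le_mul' h1 le_rfl) (mul_le_mul' h2 le_rfl)
    _ = (1 + ENNReal.ofReal ((8 + C) * a)) * (I + anisoPerimeter A E Ω) := by ring
    _ = _ := by rw [add_mul, one_mul]; rfl

/-- The volume of an admissible pair can be corrected at a cost controlled by the volume defect. -/
theorem exists_volume_correction (hn : 1 ≤ n) (hΩo : IsOpen Ω) (hΩb : Bornology.IsBounded Ω)
    (hΩc : IsConnected Ω) (hα : 0 ≤ α) (hβ : 0 ≤ β) (hlam : 0 < lam)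
    (hell : UniformlyElliptic Ω A lam Lam) (hγ0 : 0 < γ) (hγ1 : γ ≤ 1) (hA : HolderMatrix Ω A γ)
    (hu₀ : MemH1 Ω u₀) (hd0 : 0 < d) (hd1 : d < volume.real Ω) :
    ∃ C : ℝ, 0 ≤ C ∧ ∀ E u, Admissible Ω u₀ E u → ∃ F v, Admissible Ω u₀ F v ∧
      volume F = ENNReal.ofReal d ∧ energy α β A Ω F v Ω ≠ ⊤ ∧
      energy α β A Ω F v Ω ≤ energy α β A Ω E u Ω +
        ENNReal.ofReal (C * |(volume E).toReal - d| ^ γ) := by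
  have hn0 : n ≠ 0 := by omega
  have hΩf : volume Ω ≠ ⊤ := hΩb.measure_lt_top.ne
  obtain ⟨E₀, hE₀Ω, hE₀, hE₀d, hE₀s⟩ := exists_hasFinitePerimeter_volume_eq hn hΩo hd0
    ((ENNReal.ofReal_lt_iff_lt_toReal hd0.le hΩf).2 hd1)
  have hadm₀ : Admissible Ω u₀ E₀ u₀ := ⟨hE₀Ω, hE₀, by simpa using memH10_zero hΩo⟩
  set J := energy α β A Ω E₀ u₀ Ω with hJ
  have hJt : J < ⊤ := ENNReal.add_lt_top.2 ⟨lintegral_sigma_lt_top hα hβ E₀ hu₀ le_rfl,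
    anisoPerimeter_lt_top hE₀ hΩo.measurableSet hell hE₀s⟩
  obtain ⟨Cp, hCpt, hCp⟩ := exists_measure_le_anisoPerimeter hn0 hΩo.measurableSet hlam hell
  -- Only sets of energy at most `J` will be deformed, which fixes the perimeter bound `Cp * J`.
  obtain ⟨c, hc, δ, hδ, hnd⟩ := exists_nondegenerate hΩo hΩb hΩc hd0 hd1
    (M := Cp * J) (ENNReal.mul_ne_top hCpt hJt.ne)
  -- Besides `δ`, the bound `c / 4` on the volume defect is imposed below: it gives `|t| ≤ 1/4`, as
  -- a shear requires.
  obtain ⟨C₁, hC₁, hper⟩ := exists_anisoPerimeter_image_le hn hΩo hΩb hlam hell hγ0 hγ1 hA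
  set δ' := min δ (c / 4) with hδ'
  have hδ'0 : 0 < δ' := by positivity
  -- `Ca` pays for replacing the pair by `(E₀, u₀)` when the defect exceeds `δ'`; `Cb` pays for the
  -- shear when it does not.
  set Ca := J.toReal / δ' ^ γ
  set Cb := (8 + C₁) / c ^ γ * J.toReal
  have hCa : 0 ≤ Ca := by positivity
  have hCb : 0 ≤ Cb := by positivity
  refine ⟨Ca + Cb, by positivity, fun E u hadm => ?_⟩
  set Δ := |(volume E).toReal - d| with hΔ
  by_cases hcase : J ≤ energy α β A Ω E u Ω + ENNReal.ofReal ((Ca + Cb) * Δ ^ γ)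
  · exact ⟨E₀, u₀, hadm₀, hE₀d, hJt.ne, hcase⟩
  rw [not_le] at hcase
  have hEJ : energy α β A Ω E u Ω ≤ J := le_self_add.trans hcase.le
  -- A larger defect would give `Ca Δ^γ ≥ J`, which belongs to the case already settled.
  have hΔδ : Δ ≤ δ' := by
    by_contra! hlt
    refine hcase.not_ge (le_trans ?_ le_add_self)
    rw [← ENNReal.ofReal_toReal hJt.ne]
    refine ENNReal.ofReal_le_ofReal ?_
    have h1 : J.toReal = Ca * δ' ^ γ := by
      rw [div_mul_cancel₀]; positivity
    calc J.toReal = Ca * δ' ^ γ := h1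
      _ ≤ (Ca + Cb) * Δ ^ γ := by gcongr; linarith
  obtain ⟨f, hp⟩ := hadm.2.1.exists_polar
  have hEf : volume E ≠ ⊤ := ((measure_mono hadm.1).trans_lt hΩf.lt_top).ne
  obtain ⟨φ, e, hφ, he, hI⟩ := hnd E _ f hadm.1 hadm.2.1.1 hp
    ((hCp E _ f hadm.2.1.1 hp).trans (mul_le_mul' le_rfl (le_add_self.trans hEJ)))
    (hΔδ.trans (min_le_left _ _))
  set I := ∫ x in E, fderiv ℝ φ x e with hIdef
  have hI0 : 0 < |I| := hc.trans_le hI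
  have ht : |(d - volume.real E) / I| ≤ Δ / c := by
    rw [abs_div, abs_sub_comm]
    gcongr
    exact le_rfl
  have ht4 : |(d - volume.real E) / I| ≤ 1 / 4 := by
    refine ht.trans ?_
    rw [div_le_iff₀ hc]
    linarith [hΔδ.trans (min_le_right _ _)]
  -- The size `t` solves the affine equation `|E| + t I = d`.
  let S : Shear n := ⟨φ, e, (d - volume.real E) / I, hφ.1.1, hφ.1.2.1, hφ.2.1, hφ.2.2, he, ht4⟩
  have hS : tsupport S.φ ⊆ Ω := hφ.1.2.2
  have hFΩ : S.fn '' E ⊆ Ω := by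
    conv_rhs => rw [← S.image_eq_of_tsupport_subset hS]
    exact image_mono hadm.1
  have hu := hadm.memH1 hu₀
  have hen : energy α β A Ω (S.fn '' E) (fun y => u (S.inv y)) Ω ≤ energy α β A Ω E u Ω +
      ENNReal.ofReal ((Ca + Cb) * Δ ^ γ) := by
    refine (S.energy_image_le hΩo hα hβ hS hγ1 hu hC₁ (hper S hS E hadm.2.1)).trans ?_
    refine add_le_add le_rfl ?_
    -- The relative energy increase becomes absolute because the energy is at most `J`.
    calc _ ≤ ENNReal.ofReal ((8 + C₁) * |S.t| ^ γ) * ENNReal.ofReal J.toReal := by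
          rw [ENNReal.ofReal_toReal hJt.ne]
          exact mul_le_mul' le_rfl hEJ
      _ = ENNReal.ofReal ((8 + C₁) * |S.t| ^ γ * J.toReal) := by
          rw [← ENNReal.ofReal_mul (by positivity)]
      _ ≤ _ := by
          refine ENNReal.ofReal_le_ofReal ?_
          have hta : |S.t| ^ γ ≤ Δ ^ γ / c ^ γ := by
            rw [← Real.div_rpow (abs_nonneg _) hc.le]
            exact Real.rpow_le_rpow (abs_nonneg _) ht hγ0.le
          calc (8 + C₁) * |S.t| ^ γ * J.toReal ≤ (8 + C₁) * (Δ ^ γ / c ^ γ) * J.toReal := by gcongr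
            _ = Cb * Δ ^ γ := by ring
            _ ≤ (Ca + Cb) * Δ ^ γ := by gcongr; linarith
  refine ⟨S.fn '' E, fun y => u (S.inv y), ⟨hFΩ, (S.isPolar_image hp hadm.2.1.1).hasFinitePerimeter
    (S.nullMeasurableSet_image hadm.2.1.1), S.memH10_comp_inv_sub hΩo hS hu₀ hadm.2.2⟩, ?_, (hen.trans_lt (hcase.trans hJt)).ne, hen⟩
  · have hv := S.volume_real_image hadm.2.1.1 hEf
    have hval : volume.real (S.fn '' E) = d := by
      rw [hv]
      change volume.real E + (d - volume.real E) / I * I = d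
      rw [div_mul_cancel₀ _ (abs_pos.1 hI0)]
      ring
    rw [← hval, ofReal_measureReal ((measure_mono hFΩ).trans_lt hΩf.lt_top).ne]

end VolumeCorrection

/-! ### Localization and almost minimality -/

section Minimizers

variable {Ω : Set (Euc n)} {α β : ℝ} {A : Euc n → Matrix (Fin n) (Fin n) ℝ} {γ d κ : ℝ}
  {u₀ u v : Euc n → ℝ} {E F B : Set (Euc n)}

lemma penalizedEnergy_eq_energy (hγ0 : 0 < γ) (hd0 : 0 < d) (hE : volume E = ENNReal.ofReal d) :
    penalizedEnergy α β A Ω d γ κ E u = energy α β A Ω E u Ω := by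
  rw [penalizedEnergy, hE, ENNReal.toReal_ofReal hd0.le, sub_self, abs_zero, Real.zero_rpow hγ0.ne',
    mul_zero, ENNReal.ofReal_zero, add_zero]

/-- Distances in a bounded set are bounded, so the surplus power `γ - μ` goes into the constant. -/
lemma HolderMatrix.mono_exponent (hΩb : Bornology.IsBounded Ω) (hA : HolderMatrix Ω A γ) {μ : ℝ}
    (hμ0 : 0 < μ) (hμγ : μ ≤ γ) : HolderMatrix Ω A μ := by
  obtain ⟨C, hC⟩ := hA
  obtain ⟨R, hR⟩ := hΩb.exists_norm_le
  refine ⟨|C| * (2 * |R|) ^ (γ - μ), fun x hx y hy => (hC x hx y hy).trans ?_⟩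
  have hxy : ‖x - y‖ ≤ 2 * |R| :=
    (norm_sub_le _ _).trans (by linarith [hR x hx, hR y hy, le_abs_self R])
  have e : ‖x - y‖ ^ γ = ‖x - y‖ ^ (γ - μ) * ‖x - y‖ ^ μ := by
    rcases (norm_nonneg (x - y)).eq_or_lt with h | h
    · rw [← h, Real.zero_rpow (hμ0.trans_le hμγ).ne', Real.zero_rpow hμ0.ne', mul_zero]
    · rw [← Real.rpow_add h, sub_add_cancel]
  rw [e, mul_assoc]
  have h1 : ‖x - y‖ ^ (γ - μ) ≤ (2 * |R|) ^ (γ - μ) :=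
    Real.rpow_le_rpow (norm_nonneg _) hxy (by linarith)
  calc C * (‖x - y‖ ^ (γ - μ) * ‖x - y‖ ^ μ) ≤ |C| * (‖x - y‖ ^ (γ - μ) * ‖x - y‖ ^ μ) := by
        gcongr
        exact le_abs_self C
    _ ≤ _ := by gcongr

lemma abs_volume_sub_le (hEf : volume E ≠ ⊤) (hFf : volume F ≠ ⊤) :
    |volume.real F - volume.real E| ≤ volume.real (symmDiff E F) := by
  have hfin : volume (symmDiff E F) ≠ ⊤ :=
    ((measure_mono symmDiff_subset_union).trans_lt (measure_union_lt_top hEf.lt_top hFf.lt_top)).ne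
  have h1 : volume.real F ≤ volume.real E + volume.real (symmDiff E F) := by
    refine (measureReal_mono (fun x hx => ?_) ?_).trans (measureReal_union_le _ _)
    · by_cases hxE : x ∈ E
      · exact Or.inl hxE
      · exact Or.inr (Or.inr ⟨hx, hxE⟩)
    · exact (measure_union_lt_top hEf.lt_top hfin.lt_top).ne
  have h2 : volume.real E ≤ volume.real F + volume.real (symmDiff E F) := by
    refine (measureReal_mono (fun x hx => ?_) ?_).trans (measureReal_union_le _ _)
    · by_cases hxF : x ∈ F
      · exact Or.inl hxF
      · exact Or.inr (Or.inl ⟨hx, hxF⟩)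
    · exact (measure_union_lt_top hFf.lt_top hfin.lt_top).ne
  rw [abs_le]
  constructor <;> linarith

/-- The part of the energy carried by `Ω \ B`. -/
noncomputable def outerEnergy (α β : ℝ) (A : Euc n → Matrix (Fin n) (Fin n) ℝ) (Ω E : Set (Euc n))
    (u : Euc n → ℝ) (B : Set (Euc n)) : ℝ≥0∞ :=
  (∫⁻ x in Ω \ B, ENNReal.ofReal (sigma α β Ω E x * ‖weakGradient Ω u x‖ ^ 2)) +
    anisoPerimeter A E (Ω \ B)

lemma anisoPerimeter_add_sdiff (hΩ : MeasurableSet Ω) (hB : MeasurableSet B) (hBΩ : B ⊆ Ω)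
    (hE : HasFinitePerimeter E) :
    anisoPerimeter A E Ω = anisoPerimeter A E B + anisoPerimeter A E (Ω \ B) := by
  obtain ⟨f, hp⟩ := hE.exists_polar
  have e : Ω ∩ reducedBoundary E = (B ∩ reducedBoundary E) ∪ ((Ω \ B) ∩ reducedBoundary E) := by
    rw [← union_inter_distrib_right, union_sdiff_cancel hBΩ]
  rw [anisoPerimeter, e, lintegral_union ((hΩ.diff hB).inter hp.measurableSet_reducedBoundary)]
  · rfl
  · exact disjoint_sdiff_right.mono inter_subset_left inter_subset_left

lemma lintegral_eq_add_sdiff (hΩ : MeasurableSet Ω) (hB : MeasurableSet B) (hBΩ : B ⊆ Ω)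
    (g : Euc n → ℝ≥0∞) : ∫⁻ x in Ω, g x = (∫⁻ x in B, g x) + ∫⁻ x in Ω \ B, g x := by
  rw [← lintegral_union (hΩ.diff hB) disjoint_sdiff_right, union_sdiff_cancel hBΩ]

/-- The inner energy is written with `weakGradient B u`, a separate choice; uniqueness of weak
gradients identifies it with that of `Ω` almost everywhere on `B`. -/
lemma energy_eq_add_outerEnergy (hΩo : IsOpen Ω) (hB : IsOpen B) (hBΩ : B ⊆ Ω)
    (hE : HasFinitePerimeter E) (hu : MemH1 Ω u) :
    energy α β A Ω E u Ω = energy α β A Ω E u B + outerEnergy α β A Ω E u B := by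
  have hg := (weakGradient_spec hu.2).mono hBΩ
  have e : ∫⁻ x in B, ENNReal.ofReal (sigma α β Ω E x * ‖weakGradient Ω u x‖ ^ 2)
      = ∫⁻ x in B, ENNReal.ofReal (sigma α β Ω E x * ‖weakGradient B u x‖ ^ 2) := by
    refine lintegral_congr_ae ?_
    filter_upwards [hg.weakGradient_ae_eq hB] with x hx
    rw [hx]
  rw [energy, energy, outerEnergy, lintegral_eq_add_sdiff hΩo.measurableSet hB.measurableSet hBΩ,
    anisoPerimeter_add_sdiff hΩo.measurableSet hB.measurableSet hBΩ hE, e]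
  abel

/-- Localization of the energy of a competitor. -/
lemma energy_competitor_eq (hΩo : IsOpen Ω) (hB : IsOpen B) (hBΩ : B ⊆ Ω)
    (hE : HasFinitePerimeter E) (hF : HasFinitePerimeter F) (hu : MemH1 Ω u)
    (hFE : CompactlyContained (symmDiff F E) B) (hv : MemH10 B fun x => v x - u x) :
    energy α β A Ω F (fun x => u x + B.indicator (fun x => v x - u x) x) Ω
      = energy α β A Ω F v B + outerEnergy α β A Ω E u B := by
  obtain ⟨k, hk⟩ := hv.1.2
  obtain ⟨hw, hwk⟩ := hv.indicator hB hΩo hBΩ hk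
  have hgu := weakGradient_spec hu.2
  have hv' : MemH1 Ω fun x => u x + B.indicator (fun x => v x - u x) x := hu.add hw.1
  have hgv' := (hgu.add hu.1 hw.1.1 hwk).weakGradient_ae_eq hΩo
  have hgB : weakGradient B (fun x => u x + B.indicator (fun x => v x - u x) x)
      =ᵐ[volume.restrict B] weakGradient B v := by
    have h1 := weakGradient_spec (hv'.mono hBΩ).2
    have h2 : IsWeakGradient B v (weakGradient B fun x => u x + B.indicator (fun x => v x - u x) x) := by
      refine h1.congr ?_ EventuallyEq.rfl
      filter_upwards [ae_restrict_mem hB.measurableSet] with x hx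
      simp [hx]
    exact (h2.weakGradient_ae_eq hB).symm
  rw [energy_eq_add_outerEnergy hΩo hB hBΩ hF hv']
  have e₁ : energy α β A Ω F (fun x => u x + B.indicator (fun x => v x - u x) x) B
      = energy α β A Ω F v B := by
    unfold energy
    refine congrArg (· + anisoPerimeter A F B) (lintegral_congr_ae ?_)
    filter_upwards [hgB] with x hx
    rw [hx]
  have e₂ : outerEnergy α β A Ω F (fun x => u x + B.indicator (fun x => v x - u x) x) B
      = outerEnergy α β A Ω E u B := by
    unfold outerEnergy
    have hout : ∀ x, x ∉ B → (x ∈ E ↔ x ∈ F) := fun x hx => by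
      by_contra h
      refine hx (hFE.2 (subset_closure ?_))
      by_cases hxE : x ∈ E
      · exact Or.inr ⟨hxE, fun hxF => h (iff_of_true hxE hxF)⟩
      · exact Or.inl ⟨by_contra fun hxF => h (iff_of_false hxE hxF), hxE⟩
    refine congrArg₂ (· + ·) ?_ ?_
    · refine lintegral_congr_ae ?_
      have hmono : volume.restrict (Ω \ B) ≤ volume.restrict Ω :=
        Measure.restrict_mono sdiff_subset le_rfl
      filter_upwards [ae_mono hmono hgv', ae_restrict_mem (hΩo.measurableSet.diff hB.measurableSet)]
        with x hx hxm
      have hσ : sigma α β Ω F x = sigma α β Ω E x := by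
        by_cases hxE : x ∈ E
        · simp [sigma, hxE, (hout x hxm.2).1 hxE]
        · simp [sigma, hxE, mt (hout x hxm.2).2 hxE, hxm.1, indicator]
      rw [hx, indicator_of_notMem hxm.2, add_zero, hσ]
    -- The sets agree on a neighbourhood of `Ω \ B`, including the sphere, because the closure of
    -- the symmetric difference lies inside `B`; locality then applies at each of its points.
    · have hU : IsOpen (closure (symmDiff F E))ᶜ := isClosed_closure.isOpen_compl
      have hEF : E ∩ (closure (symmDiff F E))ᶜ = F ∩ (closure (symmDiff F E))ᶜ := by
        ext x
        refine and_congr_left fun hx => ?_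
        have hx' : x ∉ symmDiff F E := fun h => hx (subset_closure h)
        by_contra h
        refine hx' ?_
        by_cases hxE : x ∈ E
        · exact Or.inr ⟨hxE, fun hxF => h (iff_of_true hxE hxF)⟩
        · exact Or.inl ⟨by_contra fun hxF => h (iff_of_false hxE hxF), hxE⟩
      have hmem : ∀ x ∈ Ω \ B, x ∈ (closure (symmDiff F E))ᶜ := fun x hx h => hx.2 (hFE.2 h)
      have hset : (Ω \ B) ∩ reducedBoundary F = (Ω \ B) ∩ reducedBoundary E := by
        ext x
        refine and_congr_right fun hx => ?_
        exact (mem_reducedBoundary_congr hE hF hU hEF (hmem x hx)).symm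
      rw [anisoPerimeter, anisoPerimeter, hset]
      obtain ⟨f, hp⟩ := hE.exists_polar
      refine setLIntegral_congr_fun
        ((hΩo.measurableSet.diff hB.measurableSet).inter hp.measurableSet_reducedBoundary)
        fun x hx => ?_
      rw [outerNormal_congr hE hF hU hEF (hmem x hx.1)]
  rw [e₁, e₂]

/-- Constrained minimizers that minimize the penalized energy are almost minimizers. -/
lemma IsPenalizedMinimizer.isAlmostMinimizer (hn : 1 ≤ n) (hΩo : IsOpen Ω)
    (hΩb : Bornology.IsBounded Ω) (hu₀ : MemH1 Ω u₀) (hγ0 : 0 < γ) (hd0 : 0 < d) (hκ : 0 ≤ κ)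
    (h : IsPenalizedMinimizer α β A Ω u₀ d γ κ E u) (hE : volume E = ENNReal.ofReal d)
    (hfin : energy α β A Ω E u Ω ≠ ⊤) {U : Set (Euc n)} (hU : CompactlyContained U Ω) :
    IsAlmostMinimizer α β A Ω κ (γ * n - n + 1) U E u := by
  have hu := h.1.memH1 hu₀
  refine ⟨h.1.1, h.1.2.1, hu, fun x₀ r hr hBU F v hF hFE hv => ?_⟩
  set B := Metric.ball x₀ r
  have hBo : IsOpen B := Metric.isOpen_ball
  have hBΩ : B ⊆ Ω := hBU.trans (subset_closure.trans hU.2)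
  have hΩf : volume Ω ≠ ⊤ := hΩb.measure_lt_top.ne
  -- Competitors for almost minimality are not assumed to lie in `Ω`; they do, since they differ
  -- from `E` only inside the ball.
  have hFΩ : F ⊆ Ω := fun x hx => by
    by_cases hxE : x ∈ E
    · exact h.1.1 hxE
    · exact hBΩ (hFE.2 (subset_closure (Or.inl ⟨hx, hxE⟩)))
  obtain ⟨k, hk⟩ := hv.1.2
  have hadm : Admissible Ω u₀ F fun x => u x + B.indicator (fun x => v x - u x) x := by
    refine ⟨hFΩ, hF, ?_⟩
    have := h.1.2.2.add hΩo (hv.indicator hBo hΩo hBΩ hk).1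
    convert this using 2 with x
    ring
  have hmin := h.2 _ _ hadm
  rw [penalizedEnergy_eq_energy hγ0 hd0 hE, penalizedEnergy,
    energy_competitor_eq hΩo hBo hBΩ h.1.2.1 hF hu hFE hv,
    energy_eq_add_outerEnergy hΩo hBo hBΩ h.1.2.1 hu] at hmin
  rw [energy_eq_add_outerEnergy hΩo hBo hBΩ h.1.2.1 hu] at hfin
  -- Finiteness is what permits cancelling the outer energy in `[0, ∞]`.
  have hR : outerEnergy α β A Ω E u B ≠ ⊤ := (ENNReal.add_ne_top.1 hfin).2
  rw [add_right_comm] at hmin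
  refine ((ENNReal.add_le_add_iff_right hR).1 hmin).trans (add_le_add le_rfl
    (ENNReal.ofReal_le_ofReal ?_))
  have hn0 : (n : ℝ) ≠ 0 := by positivity
  have hexp : ((n : ℝ) - 1) / n + (γ * n - n + 1) / n = γ := by field_simp; ring
  rw [hexp]
  have hdE : d = volume.real E := by rw [measureReal_def, hE, ENNReal.toReal_ofReal hd0.le]
  have hle := abs_volume_sub_le ((measure_mono h.1.1).trans_lt hΩf.lt_top).ne
    ((measure_mono hFΩ).trans_lt hΩf.lt_top).ne
  rw [← hdE] at hle
  exact mul_le_mul_of_nonneg_left (Real.rpow_le_rpow (abs_nonneg _) hle hγ0.le) hκ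

end Minimizers

end FreeBoundary

/-! ### Exact penalization -/

theorem theorem8p2 {n : ℕ} (hn : 1 ≤ n)
    (Ω : Set (FreeBoundary.Euc n)) (hΩo : IsOpen Ω) (hΩb : Bornology.IsBounded Ω)
    (hΩc : IsConnected Ω)
    (α β : ℝ) (hα : 0 < α) (hαβ : α < β)
    (A : FreeBoundary.Euc n → Matrix (Fin n) (Fin n) ℝ)
    (lam Lam : ℝ) (hlam : 0 < lam) (hLam : lam ≤ Lam)
    (hell : FreeBoundary.UniformlyElliptic Ω A lam Lam)
    (γ : ℝ) (hγ0 : 0 < γ) (hγ1 : γ ≤ 1) (hA : FreeBoundary.HolderMatrix Ω A γ)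
    (u₀ : FreeBoundary.Euc n → ℝ) (hu₀ : FreeBoundary.MemH1 Ω u₀)
    (d : ℝ) (hd0 : 0 < d) (hd1 : d < (volume Ω).toReal) :
    ∃ κ₀ : ℝ, 0 < κ₀ ∧
      (∀ κ : ℝ, κ₀ ≤ κ → ∀ (E : Set (FreeBoundary.Euc n)) (u : FreeBoundary.Euc n → ℝ),
        FreeBoundary.IsPenalizedMinimizer α β A Ω u₀ d γ κ E u →
          volume E = ENNReal.ofReal d ∧
            FreeBoundary.IsConstrainedMinimizer α β A Ω u₀ d E u) ∧
      (∀ (E : Set (FreeBoundary.Euc n)) (u : FreeBoundary.Euc n → ℝ),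
        FreeBoundary.IsConstrainedMinimizer α β A Ω u₀ d E u →
          ∀ κ : ℝ, κ₀ ≤ κ → FreeBoundary.IsPenalizedMinimizer α β A Ω u₀ d γ κ E u) ∧
      (((n : ℝ) - 1) / n < γ → γ < 1 →
        0 < γ * n - n + 1 ∧ γ * n - n + 1 ≤ 1 ∧
        FreeBoundary.HolderMatrix Ω A (γ * n - n + 1) ∧
        ∀ (E : Set (FreeBoundary.Euc n)) (u : FreeBoundary.Euc n → ℝ),
          FreeBoundary.IsConstrainedMinimizer α β A Ω u₀ d E u →
            ∀ κ : ℝ, κ₀ ≤ κ →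
              ∀ U : Set (FreeBoundary.Euc n), FreeBoundary.CompactlyContained U Ω →
                FreeBoundary.IsAlmostMinimizer α β A Ω κ (γ * n - n + 1) U E u) := by
  have hΩf : volume Ω ≠ ⊤ := hΩb.measure_lt_top.ne
  obtain ⟨C, hC, hcorr⟩ := FreeBoundary.exists_volume_correction (β := β) (u₀ := u₀) hn hΩo hΩb hΩc
    hα.le (hα.trans hαβ).le hlam hell hγ0 hγ1 hA hu₀ hd0 hd1
  have hpen : ∀ (E : Set (FreeBoundary.Euc n)) (u : FreeBoundary.Euc n → ℝ),
      FreeBoundary.IsConstrainedMinimizer α β A Ω u₀ d E u → ∀ κ : ℝ, C + 1 ≤ κ →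
        FreeBoundary.IsPenalizedMinimizer α β A Ω u₀ d γ κ E u := by
    refine fun E u h κ hκ => ⟨h.1, fun F v hF => ?_⟩
    obtain ⟨F', v', hadm, hvol, -, hle⟩ := hcorr F v hF
    rw [FreeBoundary.penalizedEnergy_eq_energy hγ0 hd0 h.2.1]
    refine (h.2.2 F' v' hadm hvol).trans (hle.trans ?_)
    refine add_le_add le_rfl (ENNReal.ofReal_le_ofReal ?_)
    gcongr
    linarith
  -- The margin of one over `C` makes `κ t ≤ C t` force `t = 0`.
  refine ⟨C + 1, by linarith, fun κ hκ E u h => ?_, hpen, fun hγn hγ1' => ?_⟩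
  · obtain ⟨F, v, hadm, hvol, hfin, hle⟩ := hcorr E u h.1
    have h1 := h.2 F v hadm
    rw [FreeBoundary.penalizedEnergy_eq_energy hγ0 hd0 hvol] at h1
    -- The correction has finite energy by construction, so minimality makes the energy of the
    -- minimizer finite and it can be cancelled.
    have hEt : FreeBoundary.energy α β A Ω E u Ω ≠ ⊤ :=
      ((le_self_add.trans h1).trans_lt hfin.lt_top).ne
    have h2 := h1.trans hle
    rw [FreeBoundary.penalizedEnergy, ENNReal.add_le_add_iff_left hEt,
      ENNReal.ofReal_le_ofReal_iff (by positivity)] at h2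
    have h3 : |(volume E).toReal - d| ^ γ = 0 := by
      have : 0 ≤ |(volume E).toReal - d| ^ γ := by positivity
      nlinarith
    have h4 : (volume E).toReal = d := by
      have := (Real.rpow_eq_zero (abs_nonneg _) hγ0.ne').1 h3
      exact sub_eq_zero.1 (abs_eq_zero.1 this)
    have hEd : volume E = ENNReal.ofReal d := by
      rw [← h4, ENNReal.ofReal_toReal ((measure_mono h.1.1).trans_lt hΩf.lt_top).ne]
    refine ⟨hEd, h.1, hEd, fun G w hG hGd => ?_⟩
    have h5 := h.2 G w hG
    rwa [FreeBoundary.penalizedEnergy_eq_energy hγ0 hd0 hEd,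
      FreeBoundary.penalizedEnergy_eq_energy hγ0 hd0 hGd] at h5
  · have hn1 : (1 : ℝ) ≤ n := by exact_mod_cast hn
    have hμ0 : 0 < γ * n - n + 1 := by
      rw [div_lt_iff₀ (by linarith)] at hγn
      linarith
    -- Equivalent to `(n - 1)(γ - 1) ≤ 0`.
    have hμγ : γ * n - n + 1 ≤ γ := by nlinarith
    refine ⟨hμ0, by linarith, hA.mono_exponent hΩb hμ0 hμγ, fun E u h κ hκ U hU => ?_⟩
    -- The correction is used here only as a competitor of finite energy.
    obtain ⟨F, v, hadm, hvol, hfin, -⟩ := hcorr E u h.1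
    exact (hpen E u h κ hκ).isAlmostMinimizer hn hΩo hΩb hu₀ hγ0 hd0 (by linarith) h.2.1
      ((h.2.2 F v hadm hvol).trans_lt hfin.lt_top).ne hU
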